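/- **Conventions.** A coarse structure on a set $X$ is a family of subsets of $X\times X$ (entourages) containing the diagonal and closed under subsets, finite unions, inverses and compositions. For an entourage $E$ and $A\subset X$ put $\mathrm{Pen}_E(A)=\{x\mid\exists y\in A\colon (x,y)\in E\}$. $X$ is coarsely connected if every point of $X\times X$ lies in an entourage, and countably generated if there is an increasing sequence of entourages such that each entourage is contained in one of them. A set $S$ is bounded if $S\times S$ is an entourage. A map is controlled if it maps entourages to entourages, and coarse if moreover preimages of bounded sets are bounded. Subsets and products carry the subspace and product coarse structures. A triad $(X;A,B)$ is excisive if for every entourage $E$ there is an entourage $F$ with $\mathrm{Pen}_E(A)\cap\mathrm{Pen}_E(B)\subset\mathrm{Pen}_F(A\cap B)$. For a compact interval $J$ and a family $\mathcal U=\{U_x\}_{x\in X}$ of neighbourhoods of the diagonal in $J\times J$, the warped product $X\times_{\mathcal U}J$ is $X\times J$ with the coarse structure generated by the sets $\{((x,s),(y,s))\mid (x,y)\in E,\ s\in J\}$, $E$ an entourage of $X$, and $\{((x,s),(x,t))\mid (s,t)\in U_x\}$. Write $\mathcal U\in\mathcal N^\sigma(X,A;J)$ if for every $\varepsilon>0$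 there is an entourage $E$ such that $|s-t|\le\varepsilon$ for all $(s,t)\in U_x$ and all $x\notin\mathrm{Pen}_E(A)$. A family $\mathcal V$ refines $\mathcal U$ if $V_x\subset U_x$ for all $x$. The subset $A\subset X$ is a weak generalized controlled deformation retract if there are $\mathcal U\in\mathcal N^\sigma(X,A;[0,1])$ and a controlled map $H\colon X\times_{\mathcal U}[0,1]\to X$ (a deformation to $A$) with $H(x,0)=x$, $H(x,1)\in A$ for all $x\in X$, and $H(A\times[0,1])\subset A$. For an abelian group $M$ and $m\ge 0$ let $\mathrm{CX}^m(X;M)$ be the group of functions $\varphi\colon X^{m+1}\to M$ whose support meets each penumbra of the multidiagonal in a finite union of bounded sets, with the Alexander–Spanier coboundary $\delta$. Let $\mathrm{CX}^m(X,A;M)$ be the subgroup of those $\varphi$ vanishing on $A^{m+1}$, with cohomology $\mathrm{HX}^m(X,A;M)$, and $\mathrm{CX}^m(X,A+B;M)$ the subgroup of those vanishing on $A^{m+1}\cup B^{m+1}$. All these groups are $0$ in negative degrees. **Data.** Let $X$ be a nonempty, coarsely connected, countably generated coarse space and $A,B\subset X$ weak generalized controlled deformation retracts (hence nonempty) such that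 $(X;A,B)$ is excisive. Let $M_1,M_2,M_3$ be abelian groups with a bilinear pairing $M_1\times M_2\to M_3$, $(r,s)\mapsto r\cdot s$, and let $m,n\ge 0$ with $m+n\ge1$ (in all other degrees the group $\mathrm{HX}^{m+n-1}(X,A\cup B;M_3)$ or one of the factors below is $0$). Put $I=[-1,1]$, $\partial I=\{-1,1\}$. **Roe's secondary product.** For $a\in A$, $b\in B$ and cocycles $\varphi\in\mathrm{CX}^m(X,A;M_1)$, $\psi\in\mathrm{CX}^n(X,B;M_2)$ let $$\varphi*\psi=(-1)^{m+1}(s_a\varphi)\cup\psi+\varphi\cup(s_b\psi),$$ where $(s_o\varphi)(x_0,\dots,x_{m-1})=\varphi(o,x_0,\dots,x_{m-1})$, $(\varphi\cup\psi)(x_0,\dots,x_{m+n})=\varphi(x_0,\dots,x_m)\cdot\psi(x_m,\dots,x_{m+n})$, and the first (second) summand is read as $0$ if $m=0$ ($n=0$). A class $z\in\mathrm{HX}^{m+n-1}(X,A\cup B;M_3)$ is the product $[\varphi]*[\psi]$ if the inclusion $\mathrm{CX}^*(X,A\cup B;M_3)\subset\mathrm{CX}^*(X,A+B;M_3)$ maps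 $z$ to the class of $\varphi*\psi$, which is required to be a cocycle of the larger complex, for all cocycles $\varphi,\psi$ representing the two given classes. **Secondary cup product.** The cross product $x\times y\in\mathrm{HX}^{m+n}(X\times X,A\times X\cup X\times B;M_3)$ is the class which is mapped to $[\varphi\times\psi]$ in the cohomology of $\mathrm{CX}^*(X\times X,A\times X+X\times B;M_3)$ for all cocycles $\varphi,\psi$ representing $x,y$, where $$(\varphi\times\psi)\big((x_0,y_0),\dots,(x_{m+n},y_{m+n})\big)=\varphi(x_0,\dots,x_m)\cdot\psi(y_m,\dots,y_{m+n}).$$ For deformations $H^A,H^B$ of $X$ to $A$ and to $B$ put $\Gamma(x,t)=(H^A(x,-\min(t,0)),H^B(x,\max(t,0)))$ for $t\in I$, and let $\mathcal U\in\mathcal N^\sigma(X,A\cup B;I)$ be a family that supports $\Gamma$, that is, such that $\Gamma\colon X\times_{\mathcal U}I\to X\times X$ is a coarse map. For $D\subset X$ and $\mathcal U\in\mathcal N^\sigma(X,D;I)$ the suspension homomorphism $$\sigma^*\colon\mathrm{HX}^{k+1}(X\times_{\mathcal U}I,\,X\times\partial I\cup D\times I)\to\mathrm{HX}^k(X,D)$$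 is restriction to a refinement $\mathcal V\in\mathcal N^\sigma(X,D;I)$ for which the homomorphism $$\mathrm{HX}^k(X,D)\cong\mathrm{HX}^k(X\times\partial I\cup D\times I,\ X\times\{1\}\cup D\times I)\xrightarrow{\ \delta\ }\mathrm{HX}^{k+1}(X\times_{\mathcal V}I,\ X\times\partial I\cup D\times I)$$ is an isomorphism, followed by the inverse of this isomorphism; the first map is the inverse of the isomorphism induced by $x\mapsto(x,-1)$, the second one is the connecting homomorphism, and all subsets carry the coarse structure of $X\times_{\mathcal V}I$. The secondary cup product is $$x\Cup y=(-1)^m\,\sigma^*\,\Gamma^*(x\times y)\in\mathrm{HX}^{m+n-1}(X,A\cup B;M_3),$$ where $\sigma^*$ is formed with $D=A\cup B$ and $k=m+n-1$. **Theorem.** For all $x\in\mathrm{HX}^m(X,A;M_1)$ and $y\in\mathrm{HX}^n(X,B;M_2)$ both products are well defined and coincide: there is $z\in\mathrm{HX}^{m+n-1}(X,A\cup B;M_3)$ such that 1. for all $a\in A$, $b\in B$, the class $z$ is the one and only class that is the Roe secondary product $x*y$ formed with $a,b$; 2. for all deformations $H^A,H^B$ there is a supporting $\mathcal U$, and for all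 deformations $H^A,H^B$ and all supporting $\mathcal U$ the class $z$ is the one and only class that is the secondary cup product $x\Cup y$ formed with $H^A,H^B,\mathcal U$. In particular $x*y=x\Cup y$. -/

import Mathlib

/-- A coarse structure on a set. -/
@[ext]
structure CoarseStructure (X : Type*) where
  /-- The entourages (controlled sets). -/
  entourages : Set (Set (X × X))
  diagonal_mem : Set.diagonal X ∈ entourages
  subset_mem : ∀ {E F : Set (X × X)}, E ∈ entourages → F ⊆ E → F ∈ entourages
  union_mem : ∀ {E F : Set (X × X)}, E ∈ entourages → F ∈ entourages → E ∪ F ∈ entourages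
  inv_mem : ∀ {E : Set (X × X)}, E ∈ entourages → {p | (p.2, p.1) ∈ E} ∈ entourages
  comp_mem : ∀ {E F : Set (X × X)}, E ∈ entourages → F ∈ entourages →
    {p | ∃ y, (p.1, y) ∈ E ∧ (y, p.2) ∈ F} ∈ entourages

namespace CoarseStructure

section Basic

variable {X Y Z : Type*}

/-- The coarse structure generated by a family of subsets of `X × X`. -/
def generate (S : Set (Set (X × X))) : CoarseStructure X where
  entourages := {E | ∀ C : CoarseStructure X, S ⊆ C.entourages → E ∈ C.entourages}
  diagonal_mem := fun C _ => C.diagonal_mem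
  subset_mem := fun hE h C hC => C.subset_mem (hE C hC) h
  union_mem := fun hE hF C hC => C.union_mem (hE C hC) (hF C hC)
  inv_mem := fun hE C hC => C.inv_mem (hE C hC)
  comp_mem := fun hE hF C hC => C.comp_mem (hE C hC) (hF C hC)

lemma mem_generate {S : Set (Set (X × X))} {E : Set (X × X)} (h : E ∈ S) :
    E ∈ (generate S).entourages := fun _ hC => hC h

/-- The coarse structure induced by a map: `E` is an entourage iff `(f × f)(E)` is one.
For the inclusion of a subset this is the subspace coarse structure. -/
def comap (f : X → Y) (D : CoarseStructure Y) : CoarseStructure X where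
  entourages := {E | Prod.map f f '' E ∈ D.entourages}
  diagonal_mem := D.subset_mem D.diagonal_mem (by rintro _ ⟨⟨a, b⟩, h, rfl⟩; simp_all)
  subset_mem := fun hE h => D.subset_mem hE (Set.image_mono h)
  union_mem := fun hE hF => by
    change Prod.map f f '' _ ∈ D.entourages
    rw [Set.image_union]
    exact D.union_mem hE hF
  inv_mem := fun hE => D.subset_mem (D.inv_mem hE) (by
    rintro _ ⟨⟨a, b⟩, h, rfl⟩
    exact ⟨(b, a), h, rfl⟩)
  comp_mem := fun hE hF => D.subset_mem (D.comp_mem hE hF) (by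
    rintro _ ⟨⟨a, b⟩, ⟨y, h1, h2⟩, rfl⟩
    exact ⟨f y, ⟨_, h1, rfl⟩, ⟨_, h2, rfl⟩⟩)

/-- The coarse structure on a subset. -/
def subspace (C : CoarseStructure X) (A : Set X) : CoarseStructure A :=
  C.comap (Subtype.val : A → X)

/-- The product coarse structure on `X^ι`. -/
def pi (C : CoarseStructure X) (ι : Type*) : CoarseStructure (ι → X) where
  entourages := {E | ∀ i, E ∈ (C.comap (fun x : ι → X => x i)).entourages}
  diagonal_mem := fun _ => diagonal_mem _
  subset_mem := fun hE h i => subset_mem _ (hE i) h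
  union_mem := fun hE hF i => union_mem _ (hE i) (hF i)
  inv_mem := fun hE i => inv_mem _ (hE i)
  comp_mem := fun hE hF i => comp_mem _ (hE i) (hF i)

/-- The product coarse structure on `X × Y`. -/
def prod (C : CoarseStructure X) (D : CoarseStructure Y) : CoarseStructure (X × Y) where
  entourages := (C.comap Prod.fst).entourages ∩ (D.comap Prod.snd).entourages
  diagonal_mem := ⟨diagonal_mem _, diagonal_mem _⟩
  subset_mem := fun hE h => ⟨subset_mem _ hE.1 h, subset_mem _ hE.2 h⟩
  union_mem := fun hE hF => ⟨union_mem _ hE.1 hF.1, union_mem _ hE.2 hF.2⟩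
  inv_mem := fun hE => ⟨inv_mem _ hE.1, inv_mem _ hE.2⟩
  comp_mem := fun hE hF => ⟨comp_mem _ hE.1 hF.1, comp_mem _ hE.2 hF.2⟩

/-- The penumbra `Pen_E(A)`. -/
def pen (E : Set (X × X)) (A : Set X) : Set X := {x | ∃ y ∈ A, (x, y) ∈ E}

/-- Coarse connectedness: any two points are related by some entourage. -/
def IsCoarselyConnected (C : CoarseStructure X) : Prop :=
  ∀ x y : X, ∃ E ∈ C.entourages, (x, y) ∈ E

/-- Countably generated: there is an increasing sequence of entourages such that each entourage
is contained in one of them. -/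
def IsCountablyGenerated (C : CoarseStructure X) : Prop :=
  ∃ E : ℕ → Set (X × X), Monotone E ∧ (∀ n, E n ∈ C.entourages) ∧
    ∀ F ∈ C.entourages, ∃ n, F ⊆ E n

/-- Bounded subsets. -/
def IsBounded (C : CoarseStructure X) (S : Set X) : Prop := S ×ˢ S ∈ C.entourages

/-- Precompact subsets: finite unions of bounded subsets. -/
def IsPrecompact (C : CoarseStructure X) (S : Set X) : Prop :=
  ∃ T : Set (Set X), T.Finite ∧ (∀ t ∈ T, C.IsBounded t) ∧ S = ⋃₀ T

/-- Controlled maps. -/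
def IsControlled (C : CoarseStructure X) (D : CoarseStructure Y) (f : X → Y) : Prop :=
  ∀ E ∈ C.entourages, Prod.map f f '' E ∈ D.entourages

/-- Coarse maps: controlled maps for which preimages of bounded sets are bounded. -/
structure IsCoarse (C : CoarseStructure X) (D : CoarseStructure Y) (f : X → Y) : Prop where
  controlled : IsControlled C D f
  proper : ∀ S, D.IsBounded S → C.IsBounded (f ⁻¹' S)

/-- The triad `(X; A, B)` is coarsely excisive. -/
def IsExcisive (C : CoarseStructure X) (A B : Set X) : Prop :=
  ∀ E ∈ C.entourages, ∃ F ∈ C.entourages, pen E A ∩ pen E B ⊆ pen F (A ∩ B)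

lemma IsBounded.mono {C : CoarseStructure X} {S T : Set X} (h : C.IsBounded T) (hST : S ⊆ T) :
    C.IsBounded S :=
  C.subset_mem h (Set.prod_mono hST hST)

lemma IsBounded.image {C : CoarseStructure X} {D : CoarseStructure Y} {f : X → Y}
    (hf : IsControlled C D f) {S : Set X} (h : C.IsBounded S) : D.IsBounded (f '' S) := by
  refine D.subset_mem (hf _ h) ?_
  rintro ⟨_, _⟩ ⟨⟨a, ha, rfl⟩, ⟨b, hb, rfl⟩⟩
  exact ⟨(a, b), ⟨ha, hb⟩, rfl⟩

lemma IsPrecompact.mono {C : CoarseStructure X} {S S' : Set X} (h : C.IsPrecompact S)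
    (hS : S' ⊆ S) : C.IsPrecompact S' := by
  obtain ⟨T, hT, hb, rfl⟩ := h
  refine ⟨(fun t => t ∩ S') '' T, hT.image _, ?_, ?_⟩
  · rintro _ ⟨t, ht, rfl⟩
    exact (hb t ht).mono Set.inter_subset_left
  · ext x
    constructor
    · intro hx
      obtain ⟨t, ht, hxt⟩ := hS hx
      exact ⟨_, ⟨t, ht, rfl⟩, hxt, hx⟩
    · rintro ⟨_, ⟨t, _, rfl⟩, hx⟩
      exact hx.2

lemma isPrecompact_empty (C : CoarseStructure X) : C.IsPrecompact (∅ : Set X) :=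
  ⟨∅, Set.finite_empty, by simp, by simp⟩

lemma IsPrecompact.union {C : CoarseStructure X} {S T : Set X} (hS : C.IsPrecompact S)
    (hT : C.IsPrecompact T) : C.IsPrecompact (S ∪ T) := by
  obtain ⟨S, hS1, hS2, rfl⟩ := hS
  obtain ⟨T, hT1, hT2, rfl⟩ := hT
  refine ⟨S ∪ T, hS1.union hT1, ?_, (Set.sUnion_union S T).symm⟩
  rintro t (ht | ht)
  exacts [hS2 t ht, hT2 t ht]

lemma IsPrecompact.biUnion {C : CoarseStructure X} {ι : Type*} (s : Finset ι) (S : ι → Set X)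
    (h : ∀ i ∈ s, C.IsPrecompact (S i)) : C.IsPrecompact (⋃ i ∈ s, S i) := by
  classical
  induction s using Finset.induction_on with
  | empty => simpa using isPrecompact_empty C
  | insert a s _ ih =>
    rw [Finset.set_biUnion_insert]
    exact (h a (Finset.mem_insert_self a s)).union
      (ih fun i hi => h i (Finset.mem_insert_of_mem hi))

/-- Precompactness is transported along relations sending bounded sets into bounded sets. -/
lemma IsPrecompact.transport {C : CoarseStructure X} {D : CoarseStructure Y} {S : Set X}
    (h : C.IsPrecompact S) (Φ : Set X → Set Y)
    (hΦ : ∀ t, C.IsBounded t → D.IsBounded (Φ t)) {R : Set Y}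
    (hR : ∀ y ∈ R, ∃ x ∈ S, ∀ t, x ∈ t → y ∈ Φ t) : D.IsPrecompact R := by
  obtain ⟨T, hT, hb, rfl⟩ := h
  refine IsPrecompact.mono (S := ⋃₀ (Φ '' T)) ⟨Φ '' T, hT.image _, ?_, rfl⟩ ?_
  · rintro _ ⟨t, ht, rfl⟩
    exact hΦ t (hb t ht)
  · intro y hy
    obtain ⟨x, ⟨t, ht, hxt⟩, hx⟩ := hR y hy
    exact ⟨Φ t, ⟨t, ht, rfl⟩, hx t hxt⟩

lemma IsControlled.pi {C : CoarseStructure X} {D : CoarseStructure Y} {f : X → Y}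
    (hf : IsControlled C D f) (ι : Type*) :
    IsControlled (C.pi ι) (D.pi ι) (fun x i => f (x i)) := by
  intro E hE i
  refine D.subset_mem (hf _ (hE i)) ?_
  rintro _ ⟨_, ⟨⟨x, y⟩, h, rfl⟩, rfl⟩
  exact ⟨(x i, y i), ⟨(x, y), h, rfl⟩, rfl⟩

lemma isBounded_pi {C : CoarseStructure X} {ι : Type*} {S : Set (ι → X)} :
    (C.pi ι).IsBounded S ↔ ∀ i, C.IsBounded ((fun x => x i) '' S) := by
  refine forall_congr' fun i => ?_
  have : Prod.map (fun x : ι → X => x i) (fun x : ι → X => x i) '' (S ×ˢ S)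
      = ((fun x : ι → X => x i) '' S) ×ˢ ((fun x : ι → X => x i) '' S) :=
    Set.prodMap_image_prod _ _ _ _
  change _ ∈ C.entourages ↔ _ ∈ C.entourages
  rw [this]

lemma IsCoarse.pi {C : CoarseStructure X} {D : CoarseStructure Y} {f : X → Y}
    (hf : IsCoarse C D f) (ι : Type*) :
    IsCoarse (C.pi ι) (D.pi ι) (fun x i => f (x i)) := by
  refine ⟨hf.controlled.pi ι, fun S hS => ?_⟩
  rw [isBounded_pi] at hS ⊢
  intro i
  refine (hf.proper _ (hS i)).mono ?_
  rintro _ ⟨x, hx, rfl⟩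
  exact ⟨_, hx, rfl⟩

lemma IsCoarse.comp {C : CoarseStructure X} {D : CoarseStructure Y} {F : CoarseStructure Z}
    {g : Y → Z} {f : X → Y} (hg : IsCoarse D F g) (hf : IsCoarse C D f) :
    IsCoarse C F (g ∘ f) := by
  refine ⟨fun E hE => ?_, fun S hS => hf.proper _ (hg.proper _ hS)⟩
  have := hg.controlled _ (hf.controlled _ hE)
  rwa [Set.image_image] at this

lemma isCoarse_id (C : CoarseStructure X) : IsCoarse C C id :=
  ⟨fun E hE => by simpa using hE, fun S hS => by simpa using hS⟩

end Basic

section Cochains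

variable {X Y : Type*} {M : Type*} [AddCommGroup M]

/-- The multidiagonal in `X^(m+1)`. -/
def multidiagonal (X : Type*) (m : ℕ) : Set (Fin (m + 1) → X) := Set.range fun x _ => x

/-- The Alexander--Spanier coboundary
`δφ(x₀,…,x_{m+1}) = ∑ᵢ (-1)ⁱ φ(x₀,…,x_{i-1},x_{i+1},…,x_{m+1})`. -/
def coboundary (X M : Type*) [AddCommGroup M] (m : ℕ) :
    ((Fin (m + 1) → X) → M) →+ ((Fin (m + 2) → X) → M) where
  toFun φ := fun x => ∑ i : Fin (m + 2), (-1 : ℤ) ^ (i : ℕ) • φ (i.removeNth x)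
  map_zero' := by ext x; simp
  map_add' φ ψ := by ext x; simp [Finset.sum_add_distrib]

lemma coboundary_apply {m : ℕ} (φ : (Fin (m + 1) → X) → M) (x : Fin (m + 2) → X) :
    coboundary X M m φ x = ∑ i : Fin (m + 2), (-1 : ℤ) ^ (i : ℕ) • φ (i.removeNth x) := rfl

lemma coboundary_coboundary {m : ℕ} (φ : (Fin (m + 1) → X) → M) :
    coboundary X M (m + 1) (coboundary X M m φ) = 0 := by
  ext x
  simp only [coboundary_apply, Finset.smul_sum, smul_smul, ← pow_add, Pi.zero_apply]
  rw [← Finset.sum_product']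
  refine Finset.sum_involution
    (fun p _ => (p.1.succAbove p.2, p.2.predAbove p.1)) ?_ ?_ ?_ ?_
  · rintro ⟨i, j⟩ _
    dsimp only
    rw [Fin.removeNth_removeNth_eq_swap x j i, Fin.neg_one_pow_succAbove_add_predAbove, neg_smul,
      add_neg_cancel]
  · rintro ⟨i, j⟩ _ _ h
    exact Fin.succAbove_ne i j (congrArg Prod.fst h)
  · simp
  · rintro ⟨i, j⟩ _
    ext1
    · exact Fin.succAbove_succAbove_predAbove i j
    · exact Fin.predAbove_predAbove_succAbove i j

/-- The group `CX^m(X; M)` of coarse cochains: functions on `X^(m+1)` whose support meets every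
penumbra of the multidiagonal in a precompact subset of `X^(m+1)`. -/
def cochains (C : CoarseStructure X) (m : ℕ) (M : Type*) [AddCommGroup M] :
    AddSubgroup ((Fin (m + 1) → X) → M) where
  carrier := {φ | ∀ E ∈ (C.pi (Fin (m + 1))).entourages,
    (C.pi (Fin (m + 1))).IsPrecompact (Function.support φ ∩ pen E (multidiagonal X m))}
  zero_mem' := by
    intro E _
    simpa using isPrecompact_empty _
  add_mem' := by
    intro φ ψ hφ hψ E hE
    refine ((hφ E hE).union (hψ E hE)).mono ?_
    rw [← Set.union_inter_distrib_right]
    exact Set.inter_subset_inter_left _ (Function.support_add φ ψ)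
  neg_mem' := by
    intro φ hφ E hE
    simpa [Function.support_neg] using hφ E hE

/-- Tuples all of whose entries are mutually `E`-close. -/
def closeTuples (E : Set (X × X)) (m : ℕ) : Set (Fin (m + 1) → X) := {x | ∀ i j, (x i, x j) ∈ E}

lemma mem_cochains_iff {C : CoarseStructure X} {m : ℕ} {φ : (Fin (m + 1) → X) → M} :
    φ ∈ C.cochains m M ↔ ∀ E ∈ C.entourages,
      (C.pi (Fin (m + 1))).IsPrecompact (Function.support φ ∩ closeTuples E m) := by
  constructor
  · intro h E hE
    refine (h {p | ∀ i, (p.1 i, p.2 i) ∈ E} ?_).mono ?_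
    · intro i
      refine C.subset_mem hE ?_
      rintro _ ⟨⟨x, y⟩, hxy, rfl⟩
      exact hxy i
    · rintro x ⟨hx, hxE⟩
      exact ⟨hx, fun _ => x 0, ⟨x 0, rfl⟩, fun i => hxE i 0⟩
  · intro h E hE
    let G : Fin (m + 1) → Set (X × X) := fun i =>
      Prod.map (fun x : Fin (m + 1) → X => x i) (fun x : Fin (m + 1) → X => x i) '' E
    have hG : (⋃ i, G i) ∈ C.entourages := by
      have key : ∀ s : Finset (Fin (m + 1)), (⋃ i ∈ s, G i) ∈ C.entourages := by
        intro s
        induction s using Finset.induction_on with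
        | empty => exact C.subset_mem C.diagonal_mem (by simp)
        | insert a s _ ih =>
          rw [Finset.set_biUnion_insert]
          exact C.union_mem (hE a) ih
      simpa using key Finset.univ
    refine (h _ (C.comp_mem hG (C.inv_mem hG))).mono ?_
    rintro x ⟨hx, _, ⟨p, rfl⟩, hp⟩
    refine ⟨hx, fun i j => ⟨p, ?_, ?_⟩⟩
    · exact Set.mem_iUnion.2 ⟨i, _, hp, rfl⟩
    · exact Set.mem_iUnion.2 ⟨j, _, hp, rfl⟩

lemma coboundary_mem_cochains {C : CoarseStructure X} {m : ℕ} {φ : (Fin (m + 1) → X) → M}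
    (hφ : φ ∈ C.cochains m M) : coboundary X M m φ ∈ C.cochains (m + 1) M := by
  rw [mem_cochains_iff] at hφ ⊢
  intro E hE
  have h1 : ∀ i : Fin (m + 2), (C.pi (Fin (m + 2))).IsPrecompact
      {x | i.removeNth x ∈ Function.support φ ∩ closeTuples E m ∧ x ∈ closeTuples E (m + 1)} := by
    intro i
    refine (hφ E hE).transport (D := C.pi (Fin (m + 2)))
      (fun t => {x | i.removeNth x ∈ t ∧ x ∈ closeTuples E (m + 1)}) ?_ ?_
    · intro t ht
      rw [isBounded_pi] at ht ⊢
      intro k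
      refine C.subset_mem (C.comp_mem hE (C.comp_mem (ht 0) hE)) ?_
      rintro ⟨_, _⟩ ⟨⟨x, ⟨hx, hxE⟩, rfl⟩, ⟨y, ⟨hy, hyE⟩, rfl⟩⟩
      exact ⟨i.removeNth x 0, hxE _ _, i.removeNth y 0, ⟨⟨_, hx, rfl⟩, ⟨_, hy, rfl⟩⟩, hyE _ _⟩
    · rintro x ⟨hx, hxE⟩
      exact ⟨_, hx, fun t ht => ⟨ht, hxE⟩⟩
  refine (IsPrecompact.biUnion Finset.univ _ fun i _ => h1 i).mono ?_
  rintro x ⟨hx, hxE⟩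
  have hx' : ∑ i : Fin (m + 2), (-1 : ℤ) ^ (i : ℕ) • φ (i.removeNth x) ≠ 0 := hx
  obtain ⟨i, _, hi⟩ := Finset.exists_ne_zero_of_sum_ne_zero hx'
  refine Set.mem_iUnion₂.2 ⟨i, Finset.mem_univ _, ⟨?_, fun a b => hxE _ _⟩, hxE⟩
  intro h0
  exact hi (by rw [h0, smul_zero])

/-- Cochains vanishing on all tuples contained in one of the subsets in the family `𝒜`.
Thus `CX^m(X, A; M)` is the case `𝒜 = {A}`, and `CX^m(X, A + B; M)` is the case `𝒜 = {A, B}`. -/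
def relCochains (C : CoarseStructure X) (𝒜 : Set (Set X)) (m : ℕ) (M : Type*) [AddCommGroup M] :
    AddSubgroup ((Fin (m + 1) → X) → M) where
  carrier := {φ | φ ∈ C.cochains m M ∧ ∀ A ∈ 𝒜, ∀ x : Fin (m + 1) → X, (∀ i, x i ∈ A) → φ x = 0}
  zero_mem' := ⟨zero_mem _, fun _ _ _ _ => rfl⟩
  add_mem' := fun ha hb => ⟨add_mem ha.1 hb.1, fun A hA x hx => by
    simp [ha.2 A hA x hx, hb.2 A hA x hx]⟩
  neg_mem' := fun ha => ⟨neg_mem ha.1, fun A hA x hx => by simp [ha.2 A hA x hx]⟩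

lemma coboundary_mem_relCochains {C : CoarseStructure X} {𝒜 : Set (Set X)} {m : ℕ}
    {φ : (Fin (m + 1) → X) → M} (hφ : φ ∈ C.relCochains 𝒜 m M) :
    coboundary X M m φ ∈ C.relCochains 𝒜 (m + 1) M :=
  ⟨coboundary_mem_cochains hφ.1, fun A hA x hx => by
    rw [coboundary_apply]
    exact Finset.sum_eq_zero fun i _ => by
      rw [hφ.2 A hA (i.removeNth x) (fun j => hx _), smul_zero]⟩

/-- Relative cocycles. -/
def cocycles (C : CoarseStructure X) (𝒜 : Set (Set X)) (m : ℕ) (M : Type*) [AddCommGroup M] :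
    AddSubgroup ((Fin (m + 1) → X) → M) :=
  C.relCochains 𝒜 m M ⊓ (coboundary X M m).ker

/-- Relative coboundaries (there are none in degree `0`). -/
def coboundaries (C : CoarseStructure X) (𝒜 : Set (Set X)) :
    (m : ℕ) → (M : Type*) → [AddCommGroup M] → AddSubgroup ((Fin (m + 1) → X) → M)
  | 0, _, _ => ⊥
  | m + 1, M, _ => (C.relCochains 𝒜 m M).map (coboundary X M m)

lemma coboundaries_le_cocycles (C : CoarseStructure X) (𝒜 : Set (Set X)) (m : ℕ) :
    C.coboundaries 𝒜 m M ≤ C.cocycles 𝒜 m M := by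
  cases m with
  | zero => exact bot_le
  | succ m =>
    rintro _ ⟨φ, hφ, rfl⟩
    exact ⟨coboundary_mem_relCochains hφ, coboundary_coboundary φ⟩

/-- The relative ordinary coarse cohomology group. `HX^m(X, A; M)` is `C.HX {A} m M`, and the
cohomology of `CX^*(X, A + B; M)` is `C.HX {A, B} m M`. -/
abbrev HX (C : CoarseStructure X) (𝒜 : Set (Set X)) (m : ℕ) (M : Type*) [AddCommGroup M] :=
  C.cocycles 𝒜 m M ⧸ (C.coboundaries 𝒜 m M).addSubgroupOf (C.cocycles 𝒜 m M)

/-- The function `φ` on `X^(m+1)` is a cocycle representing the cohomology class `c`. -/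
def Represents {C : CoarseStructure X} {𝒜 : Set (Set X)} {m : ℕ}
    (φ : (Fin (m + 1) → X) → M) (c : C.HX 𝒜 m M) : Prop :=
  ∃ h : φ ∈ C.cocycles 𝒜 m M, (QuotientAddGroup.mk ⟨φ, h⟩ : C.HX 𝒜 m M) = c

/-- Pullback of functions on tuples. -/
def pullbackFun (M : Type*) [AddCommGroup M] (f : X → Y) (m : ℕ) :
    ((Fin (m + 1) → Y) → M) →+ ((Fin (m + 1) → X) → M) where
  toFun φ := fun x => φ (fun i => f (x i))
  map_zero' := rfl
  map_add' _ _ := rfl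

lemma coboundary_pullbackFun (f : X → Y) (m : ℕ) (φ : (Fin (m + 1) → Y) → M) :
    coboundary X M m (pullbackFun M f m φ) = pullbackFun M f (m + 1) (coboundary Y M m φ) := rfl

lemma pullbackFun_mem_relCochains {C : CoarseStructure X} {D : CoarseStructure Y} {f : X → Y}
    (hf : IsCoarse C D f) {𝒜 : Set (Set X)} {ℬ : Set (Set Y)}
    (hAB : ∀ A ∈ 𝒜, ∃ B ∈ ℬ, Set.MapsTo f A B) {m : ℕ} {φ : (Fin (m + 1) → Y) → M}
    (hφ : φ ∈ D.relCochains ℬ m M) : pullbackFun M f m φ ∈ C.relCochains 𝒜 m M := by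
  refine ⟨?_, fun A hA x hx => ?_⟩
  · have h := hφ.1
    rw [mem_cochains_iff] at h ⊢
    intro E hE
    refine (h _ (hf.controlled E hE)).transport (D := C.pi (Fin (m + 1)))
      (fun t => (fun (x : Fin (m + 1) → X) i => f (x i)) ⁻¹' t)
      (fun t ht => (hf.pi (Fin (m + 1))).proper t ht) ?_
    rintro x ⟨hx, hxE⟩
    exact ⟨fun i => f (x i), ⟨hx, fun i j => ⟨(x i, x j), hxE i j, rfl⟩⟩, fun t ht => ht⟩
  · obtain ⟨B, hB, hAB⟩ := hAB A hA
    exact hφ.2 B hB _ fun i => hAB (hx i)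

/-- The homomorphism induced on cohomology by a coarse map of pairs (more generally, by a coarse map
such that each member of `𝒜` is mapped into a member of `ℬ`). -/
def HX.map {C : CoarseStructure X} {D : CoarseStructure Y} (f : X → Y)
    (hf : IsCoarse C D f) {𝒜 : Set (Set X)} {ℬ : Set (Set Y)}
    (hAB : ∀ A ∈ 𝒜, ∃ B ∈ ℬ, Set.MapsTo f A B) (m : ℕ) (M : Type*) [AddCommGroup M] :
    D.HX ℬ m M →+ C.HX 𝒜 m M :=
  QuotientAddGroup.map _ _
    (((pullbackFun M f m).comp (D.cocycles ℬ m M).subtype).codRestrict (C.cocycles 𝒜 m M) (by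
      rintro ⟨φ, hφ⟩
      refine ⟨pullbackFun_mem_relCochains hf hAB hφ.1, ?_⟩
      change coboundary X M m (pullbackFun M f m φ) = 0
      rw [coboundary_pullbackFun, show coboundary Y M m φ = 0 from hφ.2, map_zero]))
    (by
      rintro ⟨φ, hφ⟩ h
      rw [AddSubgroup.mem_addSubgroupOf] at h
      change pullbackFun M f m φ ∈ C.coboundaries 𝒜 m M
      cases m with
      | zero =>
        have h0 : φ = 0 := h
        rw [h0, map_zero]
        exact zero_mem _
      | succ m =>
        obtain ⟨α, hα, rfl⟩ := h
        exact ⟨pullbackFun M f m α, pullbackFun_mem_relCochains hf hAB hα, rfl⟩)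

open Classical in
/-- Extension by zero of a function on tuples in the subset `Z`. -/
noncomputable def extendZero (Z : Set X) (m : ℕ) (M : Type*) [AddCommGroup M] :
    ((Fin (m + 1) → Z) → M) →+ ((Fin (m + 1) → X) → M) where
  toFun φ := fun x => if h : ∀ i, x i ∈ Z then φ (fun i => ⟨x i, h i⟩) else 0
  map_zero' := by ext x; simp
  map_add' φ ψ := by ext x; by_cases h : ∀ i, x i ∈ Z <;> simp [h]

lemma extendZero_apply {Z : Set X} {m : ℕ} (φ : (Fin (m + 1) → Z) → M) (x : Fin (m + 1) → Z) :
    extendZero Z m M φ (fun i => x i) = φ x := by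
  simp [extendZero]

/-- The subset `W ∩ Z` regarded as a subset of `Z`. -/
def within (Z W : Set X) : Set Z := Subtype.val ⁻¹' W

lemma extendZero_mem_relCochains {C : CoarseStructure X} {Z W : Set X} {m : ℕ}
    {φ : (Fin (m + 1) → Z) → M} (hφ : φ ∈ (C.subspace Z).relCochains {within Z W} m M) :
    extendZero Z m M φ ∈ C.relCochains {W} m M := by
  refine ⟨?_, ?_⟩
  · have h := hφ.1
    rw [mem_cochains_iff] at h ⊢
    intro E hE
    have hE' : Prod.map (Subtype.val : Z → X) Subtype.val ⁻¹' E ∈ (C.subspace Z).entourages :=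
      C.subset_mem hE (Set.image_preimage_subset _ _)
    refine (h _ hE').transport (D := C.pi (Fin (m + 1)))
      (fun t => (fun (x : Fin (m + 1) → Z) i => (x i : X)) '' t) ?_ ?_
    · intro t ht
      exact ht.image (IsControlled.pi (C := C.subspace Z) (D := C) (fun E hE => hE) _)
    · rintro x ⟨hx, hxE⟩
      by_cases hZ : ∀ i, x i ∈ Z
      · have e : extendZero Z m M φ x = φ (fun i => ⟨x i, hZ i⟩) :=
          extendZero_apply φ (fun i => ⟨x i, hZ i⟩)
        refine ⟨fun i => ⟨x i, hZ i⟩, ⟨fun h0 => hx (e.trans h0), fun i j => hxE i j⟩, fun t ht => ?_⟩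
        exact ⟨_, ht, rfl⟩
      · exact absurd (by simp [extendZero, hZ]) hx
  · rintro A rfl x hx
    by_cases hZ : ∀ i, x i ∈ Z
    · have e : extendZero Z m M φ x = φ (fun i => ⟨x i, hZ i⟩) :=
        extendZero_apply φ (fun i => ⟨x i, hZ i⟩)
      rw [e]
      exact hφ.2 _ rfl _ hx
    · simp [extendZero, hZ]

lemma coboundary_extendZero_apply {Z : Set X} {m : ℕ} (φ : (Fin (m + 1) → Z) → M)
    (x : Fin (m + 2) → Z) :
    coboundary X M m (extendZero Z m M φ) (fun i => x i) = coboundary Z M m φ x := by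
  simp only [coboundary_apply]
  exact Finset.sum_congr rfl fun i _ => by rw [← extendZero_apply φ (i.removeNth x)]; rfl

/-- The connecting homomorphism `HX^m(Z, W; M) → HX^(m+1)(X, Z; M)` of the triple `(X, Z, W)`:
extend a cocycle of `(Z, W)` to a cochain of `(X, W)` and apply the coboundary map. -/
noncomputable def connecting (C : CoarseStructure X) (Z W : Set X) (hWZ : W ⊆ Z) (m : ℕ)
    (M : Type*) [AddCommGroup M] :
    (C.subspace Z).HX {within Z W} m M →+ C.HX {Z} (m + 1) M :=
  QuotientAddGroup.map _ _
    (((coboundary X M m).comp ((extendZero Z m M).comp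
      ((C.subspace Z).cocycles {within Z W} m M).subtype)).codRestrict
        (C.cocycles {Z} (m + 1) M) (by
      rintro ⟨φ, hφ⟩
      refine ⟨⟨(coboundary_mem_relCochains (extendZero_mem_relCochains hφ.1)).1, ?_⟩,
        coboundary_coboundary _⟩
      rintro A rfl x hx
      have h := coboundary_extendZero_apply φ (fun i => ⟨x i, hx i⟩)
      rw [show coboundary A M m φ = 0 from hφ.2] at h
      exact h))
    (by
      rintro ⟨φ, hφ⟩ h
      rw [AddSubgroup.mem_addSubgroupOf] at h
      change coboundary X M m (extendZero Z m M φ) ∈ C.coboundaries {Z} (m + 1) M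
      cases m with
      | zero =>
        have h0 : φ = 0 := h
        rw [h0, map_zero, map_zero]
        exact zero_mem _
      | succ m =>
        obtain ⟨α, hα, rfl⟩ := h
        have hα' := extendZero_mem_relCochains hα
        refine ⟨extendZero Z (m + 1) M (coboundary Z M m α)
          - coboundary X M m (extendZero Z m M α), ⟨?_, ?_⟩, ?_⟩
        · exact sub_mem (extendZero_mem_relCochains hφ.1).1
            (coboundary_mem_relCochains hα').1
        · rintro A rfl x hx
          have h1 := coboundary_extendZero_apply α (fun i => ⟨x i, hx i⟩)
          have h2 := extendZero_apply (coboundary A M m α) (fun i => ⟨x i, hx i⟩)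
          rw [Pi.sub_apply]
          exact sub_eq_zero.2 (h2.trans h1.symm)
        · rw [map_sub, coboundary_coboundary, sub_zero])

lemma represents_connecting {C : CoarseStructure X} {Z W : Set X} (hWZ : W ⊆ Z) {m : ℕ}
    {φ : (Fin (m + 1) → Z) → M} {c : (C.subspace Z).HX {within Z W} m M} (h : Represents φ c) :
    Represents (coboundary X M m (extendZero Z m M φ)) (C.connecting Z W hWZ m M c) := by
  obtain ⟨hφ, rfl⟩ := h
  exact ⟨_, rfl⟩

end Cochains

section Warped

variable {X K : Type*}

/-- Membership in `𝒩(X; K)`: families of neighbourhoods of the diagonal of `K`, indexed by `X`. -/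
def IsNbhdFamily [TopologicalSpace K] (U : X → Set (K × K)) : Prop :=
  ∀ x, U x ∈ nhdsSet (Set.diagonal K)

/-- The warped cartesian product: `X × K` with the coarse structure generated by the sets
`E ×̄ Diag[K]` for entourages `E` of `X` and by the set `E_U`. -/
def warped (C : CoarseStructure X) (U : X → Set (K × K)) : CoarseStructure (X × K) :=
  generate ({W | ∃ E ∈ C.entourages, W = {p | (p.1.1, p.2.1) ∈ E ∧ p.1.2 = p.2.2}} ∪
    {{p | p.1.1 = p.2.1 ∧ (p.1.2, p.2.2) ∈ U p.1.1}})

/-- Membership in `𝒩^σ(X, A; K)`: neighbourhood families satisfying the suspension condition. -/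
def IsSuspensionFamily [PseudoMetricSpace K] (C : CoarseStructure X) (A : Set X)
    (U : X → Set (K × K)) : Prop :=
  IsNbhdFamily U ∧ ∀ ε > 0, ∃ E ∈ C.entourages, ∀ x ∉ pen E A, ∀ p ∈ U x, dist p.1 p.2 ≤ ε

/-- `A` is a weak generalized controlled deformation retract of `X` via the homotopy `H`. -/
def IsDeformation (C : CoarseStructure X) (A : Set X) (H : X × unitInterval → X) : Prop :=
  (∃ U : X → Set (unitInterval × unitInterval), C.IsSuspensionFamily A U ∧
    IsControlled (C.warped U) C H) ∧
  (∀ x, H (x, 0) = x) ∧ (∀ x, H (x, 1) ∈ A) ∧ ∀ x ∈ A, ∀ t, H (x, t) ∈ A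

/-- `A` is a weak generalized controlled deformation retract of `X`. -/
def IsWeakDeformationRetract (C : CoarseStructure X) (A : Set X) : Prop :=
  ∃ H : X × unitInterval → X, C.IsDeformation A H

/-- The interval `[-1, 1]`. -/
abbrev Interval : Type := Set.Icc (-1 : ℝ) 1

/-- The lower endpoint `-1`. -/
def Interval.bot : Interval := ⟨-1, by norm_num⟩

/-- The upper endpoint `1`. -/
def Interval.top : Interval := ⟨1, by norm_num⟩

/-- `t⁺ = max(t, 0)`. -/
def Interval.pos (t : Interval) : unitInterval :=
  ⟨max (t : ℝ) 0, le_max_right _ _, max_le t.2.2 zero_le_one⟩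

/-- `t⁻ = -min(t, 0)`. -/
def Interval.neg (t : Interval) : unitInterval :=
  ⟨-min (t : ℝ) 0, by simp, by
    rw [neg_le]
    exact le_min t.2.1 (by norm_num)⟩

lemma warped_mono (C : CoarseStructure X) {U V : X → Set (K × K)} (h : ∀ x, V x ⊆ U x) :
    IsControlled (C.warped V) (C.warped U) id := by
  intro E hE
  rw [Prod.map_id, Set.image_id]
  refine hE _ ?_
  rintro W (hW | rfl)
  · exact mem_generate (Or.inl hW)
  · exact subset_mem _ (mem_generate (Or.inr rfl)) fun p hp => ⟨hp.1, h _ hp.2⟩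

lemma warped_fst (C : CoarseStructure X) (U : X → Set (K × K)) :
    IsControlled (C.warped U) C Prod.fst := by
  intro E hE
  refine hE (C.comap Prod.fst) ?_
  rintro W (⟨E, hE, rfl⟩ | rfl)
  · exact C.subset_mem hE (by rintro _ ⟨p, hp, rfl⟩; exact hp.1)
  · exact C.subset_mem C.diagonal_mem (by rintro _ ⟨p, hp, rfl⟩; exact hp.1)

lemma IsBounded.union {C : CoarseStructure X} {S T : Set X} (hS : C.IsBounded S)
    (hT : C.IsBounded T) {x : X} (hxS : x ∈ S) (hxT : x ∈ T) : C.IsBounded (S ∪ T) := by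
  have h := C.union_mem (C.union_mem hS hT)
    (C.union_mem (C.comp_mem hS hT) (C.comp_mem hT hS))
  refine C.subset_mem h ?_
  rintro ⟨a, b⟩ ⟨ha | ha, hb | hb⟩
  · exact Or.inl (Or.inl ⟨ha, hb⟩)
  · exact Or.inr (Or.inl ⟨x, ⟨ha, hxS⟩, ⟨hxT, hb⟩⟩)
  · exact Or.inr (Or.inr ⟨x, ⟨ha, hxT⟩, ⟨hxS, hb⟩⟩)
  · exact Or.inl (Or.inr ⟨ha, hb⟩)

/-- Fibres of a warped product with the interval are bounded. -/
lemma isBounded_fiber (C : CoarseStructure X) {U : X → Set (Interval × Interval)}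
    (hU : IsNbhdFamily U) (x : X) :
    (C.warped U).IsBounded {p | p.1 = x} := by
  have h := hU x
  rw [nhdsSet_diagonal_eq_uniformity] at h
  obtain ⟨ε, hε, hεU⟩ := Metric.mem_uniformity_dist.1 h
  have hEU : {p : (X × Interval) × (X × Interval) | p.1.1 = p.2.1 ∧ (p.1.2, p.2.2) ∈ U p.1.1}
      ∈ (C.warped U).entourages := mem_generate (Or.inr rfl)
  have key : ∀ n : ℕ,
      (C.warped U).IsBounded {p | p.1 = x ∧ (p.2 : ℝ) ≤ -1 + n * (ε / 2)} := by
    intro n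
    induction n with
    | zero =>
      refine subset_mem _ (diagonal_mem _) ?_
      rintro ⟨⟨a, s⟩, ⟨b, t⟩⟩ ⟨⟨ha, hs⟩, ⟨hb, ht⟩⟩
      simp only [Nat.cast_zero, zero_mul, add_zero] at hs ht
      have hs' := s.2.1
      have ht' := t.2.1
      have : s = t := Subtype.ext (by linarith)
      simp only [Set.mem_diagonal_iff, Prod.mk.injEq]
      exact ⟨ha.trans hb.symm, this⟩
    | succ n ih =>
      by_cases hn : -1 + (n : ℝ) * (ε / 2) ≤ 1
      · have hmem : -1 + (n : ℝ) * (ε / 2) ∈ Set.Icc (-1 : ℝ) 1 :=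
          ⟨by have : 0 ≤ (n : ℝ) * (ε / 2) := by positivity
              linarith, hn⟩
        have hstep : (C.warped U).IsBounded {p | p.1 = x ∧
            -1 + (n : ℝ) * (ε / 2) ≤ (p.2 : ℝ) ∧ (p.2 : ℝ) ≤ -1 + ((n : ℝ) + 1) * (ε / 2)} := by
          refine subset_mem _ hEU ?_
          rintro ⟨⟨a, s⟩, ⟨b, t⟩⟩ ⟨⟨rfl, hs, hs'⟩, ⟨hb, ht, ht'⟩⟩
          refine ⟨hb.symm, hεU ?_⟩
          rw [Subtype.dist_eq, Real.dist_eq, abs_lt]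
          simp only at hs hs' ht ht'
          constructor <;> nlinarith
        refine (ih.union hstep (x := (x, ⟨_, hmem⟩)) ⟨rfl, le_rfl⟩ ⟨rfl, le_rfl, ?_⟩).mono ?_
        · simp only
          nlinarith
        · rintro ⟨a, s⟩ ⟨ha, hs⟩
          push_cast at hs
          rcases le_total (s : ℝ) (-1 + (n : ℝ) * (ε / 2)) with h | h
          · exact Or.inl ⟨ha, h⟩
          · exact Or.inr ⟨ha, h, hs⟩
      · refine ih.mono ?_
        rintro ⟨a, s⟩ ⟨ha, -⟩
        exact ⟨ha, s.2.2.trans (not_le.1 hn).le⟩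
  obtain ⟨n, hn⟩ := exists_nat_gt (2 / (ε / 2))
  refine (key n).mono ?_
  rintro ⟨a, s⟩ ha
  refine ⟨ha, ?_⟩
  have h2 : 2 < n * (ε / 2) := by rwa [div_lt_iff₀ (by positivity)] at hn
  have := s.2.2
  simp only
  linarith

lemma isBounded_cylinder (C : CoarseStructure X) {U : X → Set (Interval × Interval)}
    (hU : IsNbhdFamily U) {A : Set X} (hA : C.IsBounded A) :
    (C.warped U).IsBounded {p | p.1 ∈ A} := by
  rcases A.eq_empty_or_nonempty with rfl | ⟨a, ha⟩
  · exact subset_mem _ (diagonal_mem _) (by rintro p ⟨h, _⟩; exact h.elim)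
  have h1 : {p : (X × Interval) × (X × Interval) | (p.1.1, p.2.1) ∈ A ×ˢ A ∧ p.1.2 = p.2.2}
      ∈ (C.warped U).entourages := mem_generate (Or.inl ⟨_, hA, rfl⟩)
  refine subset_mem _ (comp_mem _ h1 (comp_mem _ (C.isBounded_fiber hU a) h1)) ?_
  rintro ⟨⟨x, s⟩, ⟨y, t⟩⟩ ⟨hx, hy⟩
  exact ⟨(a, s), ⟨⟨hx, ha⟩, rfl⟩, (a, t), ⟨rfl, rfl⟩, ⟨⟨ha, hy⟩, rfl⟩⟩

/-- Refining the neighbourhood family yields a coarse identity map. -/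
lemma isCoarse_refine (C : CoarseStructure X) {U V : X → Set (Interval × Interval)}
    (hV : IsNbhdFamily V) (h : ∀ x, V x ⊆ U x) : IsCoarse (C.warped V) (C.warped U) id := by
  refine ⟨C.warped_mono h, fun S hS => ?_⟩
  exact (C.isBounded_cylinder hV (hS.image (C.warped_fst U))).mono fun p hp => ⟨p, hp, rfl⟩

/-- The subset `X × ∂I ∪ A × I` of `X × I`. -/
def suspBase (A : Set X) : Set (X × Interval) :=
  {p | p.2 = Interval.bot ∨ p.2 = Interval.top ∨ p.1 ∈ A}

/-- The subset `X × {1} ∪ A × I` of `X × I`. -/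
def suspTop (A : Set X) : Set (X × Interval) := {p | p.2 = Interval.top ∨ p.1 ∈ A}

lemma suspTop_subset (A : Set X) : suspTop A ⊆ suspBase A := fun _ hp => Or.inr hp

/-- The inclusion `x ↦ (x, -1)` of `X` into `X × ∂I ∪ A × I`. -/
def bottomIncl (A : Set X) (x : X) : suspBase A := ⟨(x, Interval.bot), Or.inl rfl⟩

lemma isCoarse_bottomIncl (C : CoarseStructure X) (A : Set X) (U : X → Set (Interval × Interval)) :
    IsCoarse C ((C.warped U).subspace (suspBase A)) (bottomIncl A) := by
  constructor
  · intro E hE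
    refine (C.warped U).subset_mem (mem_generate (Or.inl ⟨E, hE, rfl⟩)) ?_
    rintro _ ⟨_, ⟨p, hp, rfl⟩, rfl⟩
    exact ⟨hp, rfl⟩
  · intro S hS
    have h1 : IsControlled ((C.warped U).subspace (suspBase A)) (C.warped U) Subtype.val :=
      fun E hE => hE
    exact ((hS.image h1).image (C.warped_fst U)).mono fun x hx => ⟨_, ⟨_, hx, rfl⟩, rfl⟩

variable {M : Type*} [AddCommGroup M]

/-- The homomorphism
`HX^m(X × ∂I ∪ A × I, X × {1} ∪ A × I; M) → HX^m(X, A; M)` induced by `x ↦ (x, -1)`. -/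
def bottomMap (C : CoarseStructure X) (A : Set X) (U : X → Set (Interval × Interval)) (m : ℕ)
    (M : Type*) [AddCommGroup M] :
    ((C.warped U).subspace (suspBase A)).HX {within (suspBase A) (suspTop A)} m M →+
      C.HX {A} m M :=
  HX.map (bottomIncl A) (C.isCoarse_bottomIncl A U) (by
    rintro _ rfl
    exact ⟨_, rfl, fun x hx => Or.inr hx⟩) m M

/-- The connecting homomorphism of the triple
`(X × I, X × ∂I ∪ A × I, X × {1} ∪ A × I)`, where `X × I` carries the warped structure. -/
noncomputable def suspConnecting (C : CoarseStructure X) (A : Set X)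
    (U : X → Set (Interval × Interval)) (m : ℕ) (M : Type*) [AddCommGroup M] :
    ((C.warped U).subspace (suspBase A)).HX {within (suspBase A) (suspTop A)} m M →+
      (C.warped U).HX {suspBase A} (m + 1) M :=
  (C.warped U).connecting (suspBase A) (suspTop A) (suspTop_subset A) m M

/-- The restriction homomorphism to a refinement of the neighbourhood family. -/
def refineMap (C : CoarseStructure X) (A : Set X) {U V : X → Set (Interval × Interval)}
    (hV : IsNbhdFamily V) (h : ∀ x, V x ⊆ U x) (m : ℕ) (M : Type*) [AddCommGroup M] :
    (C.warped U).HX {suspBase A} m M →+ (C.warped V).HX {suspBase A} m M :=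
  HX.map id (C.isCoarse_refine hV h) (fun A hA => ⟨A, hA, fun _ hx => hx⟩) m M

/-- The graph of the suspension homomorphism
`σ : HX^(m+1)((X, A) ×_U (I, ∂I); M) → HX^m(X, A; M)`, i.e. the statement `z = σ(w)`.
For a refinement `V` of `U` for which the homomorphism
`HX^m(X, A) ≅ HX^m(X × ∂I ∪ A × I, X × {1} ∪ A × I) → HX^(m+1)((X, A) ×_V (I, ∂I))`
(inverse of the map induced by `x ↦ (x, -1)`, followed by the connecting homomorphism) is
an isomorphism, `σ` is restriction from `U` to `V` followed by the inverse of that isomorphism. -/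
def IsSuspension (C : CoarseStructure X) (A : Set X) (U : X → Set (Interval × Interval)) (m : ℕ)
    (w : (C.warped U).HX {suspBase A} (m + 1) M) (z : C.HX {A} m M) : Prop :=
  ∃ (V : X → Set (Interval × Interval)) (hV : C.IsSuspensionFamily A V) (h : ∀ x, V x ⊆ U x),
    Function.Bijective (C.bottomMap A V m M) ∧
    Function.Bijective (C.suspConnecting A V m M) ∧
    ∃ c, C.bottomMap A V m M c = z ∧ C.suspConnecting A V m M c = C.refineMap A hV.1 h (m + 1) M w

end Warped

section Products

variable {X Y M₁ M₂ M₃ : Type*} [AddCommGroup M₁] [AddCommGroup M₂] [AddCommGroup M₃]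

/-- The cup product of functions,
`(φ ∪ ψ)(x₀,…,x_{m+n}) = φ(x₀,…,x_m) · ψ(x_m,…,x_{m+n})`. -/
def cup (μ : M₁ →+ M₂ →+ M₃) {m n l : ℕ} (h : m + n = l) (φ : (Fin (m + 1) → X) → M₁)
    (ψ : (Fin (n + 1) → X) → M₂) : (Fin (l + 1) → X) → M₃ :=
  fun x => μ (φ fun i => x ⟨i, by omega⟩) (ψ fun j => x ⟨m + j, by omega⟩)

/-- The cross product of functions,
`(φ × ψ)((x₀,y₀),…,(x_{m+n},y_{m+n})) = φ(x₀,…,x_m) · ψ(y_m,…,y_{m+n})`. -/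
def cross (μ : M₁ →+ M₂ →+ M₃) {m n l : ℕ} (h : m + n = l) (φ : (Fin (m + 1) → X) → M₁)
    (ψ : (Fin (n + 1) → Y) → M₂) : (Fin (l + 1) → X × Y) → M₃ :=
  cup μ h (pullbackFun M₁ Prod.fst m φ) (pullbackFun M₂ Prod.snd n ψ)

/-- The inclusion-induced homomorphism `HX^m(X, A ∪ B; M) → H^m(CX^*(X, A + B; M))`. -/
def sumMap (C : CoarseStructure X) (A B : Set X) (m : ℕ) (M : Type*) [AddCommGroup M] :
    C.HX {A ∪ B} m M →+ C.HX {A, B} m M :=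
  HX.map id C.isCoarse_id (by
    rintro S (rfl | rfl)
    · exact ⟨_, rfl, fun _ hx => Or.inl hx⟩
    · exact ⟨_, rfl, fun _ hx => Or.inr hx⟩) m M

/-- The statement `p = x × y` for the cross product
`HX^m(X, A; M₁) ⊗ HX^n(Y, B; M₂) → HX^(m+n)((X, A) × (Y, B); M₃)`, where
`(X, A) × (Y, B) = (X × Y, A × Y ∪ X × B)`: the class `p` is mapped by the comparison isomorphism
to the class of the cocycles `φ × ψ` relative to `A × Y + X × B`. -/
def IsCrossProduct (μ : M₁ →+ M₂ →+ M₃) (C : CoarseStructure X) (D : CoarseStructure Y)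
    (A : Set X) (B : Set Y) {m n l : ℕ} (h : m + n = l) (x : C.HX {A} m M₁) (y : D.HX {B} n M₂)
    (p : (C.prod D).HX {A ×ˢ Set.univ ∪ Set.univ ×ˢ B} l M₃) : Prop :=
  ∀ φ ψ, Represents φ x → Represents ψ y →
    Represents (cross μ h φ ψ) ((C.prod D).sumMap (A ×ˢ Set.univ) (Set.univ ×ˢ B) l M₃ p)

/-- The function `(s_o φ)(x₀,…,x_m) = φ(o,x₀,…,x_m)`. -/
def cone {m : ℕ} (o : X) {M : Type*} (φ : (Fin (m + 2) → X) → M) : (Fin (m + 1) → X) → M :=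
  fun x => φ (Fin.cons o x)

/-- `(s_a φ) ∪ ψ`. If `φ` has degree `0` then `s_a φ` has degree `-1` and the product is `0`. -/
def coneCup (μ : M₁ →+ M₂ →+ M₃) (a : X) : {m n k : ℕ} → m + n = k + 1 →
    ((Fin (m + 1) → X) → M₁) → ((Fin (n + 1) → X) → M₂) → (Fin (k + 1) → X) → M₃
  | 0, _, _, _, _, _ => 0
  | _ + 1, _, _, h, φ, ψ => cup μ (by omega) (cone a φ) ψ

/-- `φ ∪ (s_b ψ)`. If `ψ` has degree `0` then `s_b ψ` has degree `-1` and the product is `0`. -/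
def cupCone (μ : M₁ →+ M₂ →+ M₃) (b : X) : {m n k : ℕ} → m + n = k + 1 →
    ((Fin (m + 1) → X) → M₁) → ((Fin (n + 1) → X) → M₂) → (Fin (k + 1) → X) → M₃
  | _, 0, _, _, _, _ => 0
  | _, _ + 1, _, h, φ, ψ => cup μ (by omega) φ (cone b ψ)

/-- The secondary product of functions `φ * ψ = (-1)^(m+1) (s_a φ) ∪ ψ + φ ∪ (s_b ψ)`. -/
def roeFun (μ : M₁ →+ M₂ →+ M₃) (a b : X) {m n k : ℕ} (h : m + n = k + 1)
    (φ : (Fin (m + 1) → X) → M₁) (ψ : (Fin (n + 1) → X) → M₂) : (Fin (k + 1) → X) → M₃ :=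
  (-1 : ℤ) ^ (m + 1) • coneCup μ a h φ ψ + cupCone μ b h φ ψ

/-- The statement `z = x * y` for the Roe secondary product
`HX^m(X, A; M₁) ⊗ HX^n(X, B; M₂) → HX^(m+n-1)(X, A ∪ B; M₃)` formed with the base points
`a ∈ A` and `b ∈ B`: the class `z` is mapped by the comparison isomorphism to the class of the
cocycles `φ * ψ` relative to `A + B`. -/
def IsRoeProduct (μ : M₁ →+ M₂ →+ M₃) (C : CoarseStructure X) (A B : Set X) (a b : X)
    {m n k : ℕ} (h : m + n = k + 1) (x : C.HX {A} m M₁) (y : C.HX {B} n M₂)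
    (z : C.HX {A ∪ B} k M₃) : Prop :=
  ∀ φ ψ, Represents φ x → Represents ψ y →
    Represents (roeFun μ a b h φ ψ) (C.sumMap A B k M₃ z)

/-- The map `Γ(x, t) = (H^A(x, t⁻), H^B(x, t⁺))`. -/
def Gamma (HA HB : X × unitInterval → X) (p : X × Interval) : X × X :=
  (HA (p.1, p.2.neg), HB (p.1, p.2.pos))

/-- The family `U ∈ 𝒩^σ(X, A ∪ B; I)` supports `Γ`. -/
def Supports (C : CoarseStructure X) (A B : Set X) (HA HB : X × unitInterval → X)
    (U : X → Set (Interval × Interval)) : Prop :=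
  C.IsSuspensionFamily (A ∪ B) U ∧ IsCoarse (C.warped U) (C.prod C) (Gamma HA HB)

lemma mapsTo_Gamma {C : CoarseStructure X} {A B : Set X} {HA HB : X × unitInterval → X}
    (hHA : C.IsDeformation A HA) (hHB : C.IsDeformation B HB) :
    Set.MapsTo (Gamma HA HB) (suspBase (A ∪ B)) (A ×ˢ Set.univ ∪ Set.univ ×ˢ B) := by
  rintro ⟨x, t⟩ (h | h | h | h)
  · left
    have h1 : Interval.neg t = 1 := by
      simp only at h
      rw [h]
      exact Subtype.ext (by simp [Interval.neg, Interval.bot])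
    refine ⟨?_, trivial⟩
    simp only [Gamma, h1]
    exact hHA.2.2.1 x
  · right
    have h1 : Interval.pos t = 1 := by
      simp only at h
      rw [h]
      exact Subtype.ext (by simp [Interval.pos, Interval.top])
    refine ⟨trivial, ?_⟩
    simp only [Gamma, h1]
    exact hHB.2.2.1 x
  · exact Or.inl ⟨hHA.2.2.2 x h _, trivial⟩
  · exact Or.inr ⟨trivial, hHB.2.2.2 x h _⟩

/-- The homomorphism
`Γ^* : HX^l((X, A) × (X, B); M) → HX^l((X, A ∪ B) ×_U (I, ∂I); M)`. -/
def gammaMap {C : CoarseStructure X} {A B : Set X} {HA HB : X × unitInterval → X}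
    (hHA : C.IsDeformation A HA) (hHB : C.IsDeformation B HB)
    {U : X → Set (Interval × Interval)} (hU : C.Supports A B HA HB U) (l : ℕ)
    (M : Type*) [AddCommGroup M] :
    (C.prod C).HX {A ×ˢ Set.univ ∪ Set.univ ×ˢ B} l M →+ (C.warped U).HX {suspBase (A ∪ B)} l M :=
  HX.map (Gamma HA HB) hU.2 (by
    rintro _ rfl
    exact ⟨_, rfl, mapsTo_Gamma hHA hHB⟩) l M

/-- The statement `z = (-1)^m σ(Γ^*(x × y))`, i.e. that `z` is the secondary cup product of `x` and
`y` formed with the homotopies `HA`, `HB` and the family `U`. -/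
def IsSecondaryCupProduct (μ : M₁ →+ M₂ →+ M₃) {C : CoarseStructure X} {A B : Set X}
    {HA HB : X × unitInterval → X} (hHA : C.IsDeformation A HA) (hHB : C.IsDeformation B HB)
    {U : X → Set (Interval × Interval)} (hU : C.Supports A B HA HB U)
    {m n k : ℕ} (h : m + n = k + 1) (x : C.HX {A} m M₁) (y : C.HX {B} n M₂)
    (z : C.HX {A ∪ B} k M₃) : Prop :=
  ∃ p s, IsCrossProduct μ C C A B h x y p ∧
    C.IsSuspension (A ∪ B) U k (gammaMap hHA hHB hU (k + 1) M₃ p) s ∧ z = (-1 : ℤ) ^ m • s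

end Products

end CoarseStructure

/-!
# The secondary products agree

Both products are obtained from a natural primitive of a cocycle which has two of them.

**Excision.** In a countably generated space every point of a penumbra of `A` can be moved to a nearest
point of `A` in a controlled way (`IsCountablyGenerated.exists_nearest`). For an excisive triad this
gives a map `π` of `A ∪ B` into `A ∩ B` that is close to the identity near both pieces. The prism
operator from the identity to `π`, cut off outside of `A ∪ B`, then preserves coarse cochains vanishing
on `A` and on `B`, and it turns them into cochains vanishing on `A ∪ B`
(`IsExcisionMap.exists_sub_mem_relCochains`). Hence classes relative to `A ∪ B` and to `A + B`
correspond (`IsExcisionMap.sumMap_bijective`), so that there is at most one Roe product, and the cross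
product exists. The same argument shows that `x ↦ (x, -1)` induces an isomorphism
(`bottomMap_bijective`).

**Suspension.** Every neighbourhood family is refined by a dyadic one, of widths `2⁻ⁿ⁽ˣ⁾`. For such a
family the cylinder is contracted to its top by raising a floor whose height over `x` is rounded to
multiples of `2⁻ⁿ⁽ˣ⁾` (`slide`). The points over `x` then move at finitely many times and in steps the
warped product allows, so that the sum of the prism operators of all steps, stripped of the
contributions of the points at rest, is a well-defined cochain homotopy of coarse cochains
(`slideHomotopy`). Therefore the cohomology relative to `X × {1} ∪ D × I` vanishes, and the connecting
homomorphism is an isomorphism (`suspConnecting_bijective`). A suspension may be computed with any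
finer family (`IsSuspension.exists_refine`), in particular with a dyadic one.

**Comparison.** On `X × X` the cocycle `φ × ψ` has two primitives, one from coning off `φ` and one from
coning off `ψ`, neither of which is coarse. Pulled back along `Γ`, the first one is coarse over
`t ≤ 0`, where `Γ` is the identity in the second factor, and the second one over `t ≥ 0`. Glued at
`t = 0` they form a coarse cochain `θ` whose coboundary is `Γ^*(φ × ψ)` up to a term concentrated at the
jump. The sliding homotopy evaluates that term at the bottom of the cylinder as the difference of the
two primitives on the diagonal (`slideHomotopy_jump`), which is `φ * ψ` up to sign
(`primitives_diag`). So the secondary cup product is a Roe product for all base points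
(`IsSecondaryCupProduct.isRoeProduct`), and the uniqueness of the latter identifies all of them.
-/

namespace CoarseStructure

open Finset

/-! ### Alexander–Spanier calculus: Leibniz rule, cones and prisms -/

section Sequences

variable {X Y M M₁ M₂ M₃ : Type*} [AddCommGroup M] [AddCommGroup M₁] [AddCommGroup M₂]
  [AddCommGroup M₃]

/-- The strictly increasing enumeration of the natural numbers other than `i`. Tuples are handled
below as initial segments of sequences `ℕ → X`, where faces need no index bounds. -/
def skip (i j : ℕ) : ℕ := if j < i then j else j + 1

lemma exists_seq {m : ℕ} (x : Fin (m + 1) → X) : ∃ s : ℕ → X, x = fun i : Fin (m + 1) => s i := by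
  refine ⟨fun j => x ⟨min j m, by omega⟩, ?_⟩
  ext i
  congr 1
  ext
  simp
  omega

lemma removeNth_seq {m : ℕ} (s : ℕ → X) (i : Fin (m + 2)) :
    (i.removeNth (fun j : Fin (m + 2) => s j) : Fin (m + 1) → X) = fun j : Fin (m + 1) => s (skip i j) := by
  ext j
  simp only [Fin.removeNth, skip]
  congr 1
  simp only [Fin.succAbove, Fin.lt_def]
  split_ifs <;> simp_all

lemma coboundary_seq {m : ℕ} (φ : (Fin (m + 1) → X) → M) (s : ℕ → X) :
    coboundary X M m φ (fun i : Fin (m + 2) => s i) =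
      ∑ i ∈ range (m + 2), (-1 : ℤ) ^ i • φ (fun j : Fin (m + 1) => s (skip i j)) := by
  rw [coboundary_apply, Finset.sum_range]
  exact Finset.sum_congr rfl fun i _ => by rw [removeNth_seq]

/-- The Leibniz rule. -/
lemma coboundary_cup (μ : M₁ →+ M₂ →+ M₃) {m n l : ℕ} (h : m + n = l)
    (h₁ : m + 1 + n = l + 1) (h₂ : m + (n + 1) = l + 1)
    (φ : (Fin (m + 1) → X) → M₁) (ψ : (Fin (n + 1) → X) → M₂) :
    coboundary X M₃ l (cup μ h φ ψ) =
      cup μ h₁ (coboundary X M₁ m φ) ψ + (-1 : ℤ) ^ m • cup μ h₂ φ (coboundary X M₂ n ψ) := by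
  subst h
  ext x
  obtain ⟨s, rfl⟩ := exists_seq x
  rw [coboundary_seq]
  simp only [cup, Pi.add_apply, Pi.smul_apply]
  rw [coboundary_seq φ s, coboundary_seq ψ (fun j => s (m + j))]
  rw [show m + n + 2 = (m + 1) + (n + 1) by ring, Finset.sum_range_add,
    Finset.sum_range_succ _ (m + 1), Finset.sum_range_succ' _ (n + 1)]
  simp only [map_add, map_sum, AddMonoidHom.add_apply, AddMonoidHom.finsetSum_apply, smul_add,
    map_zsmul, AddMonoidHom.zsmul_apply, Finset.smul_sum, smul_smul, ← pow_add]
  have e1 : ∀ i ∈ range (m + 1),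
      (-1 : ℤ) ^ i • μ (φ fun j : Fin (m + 1) => s (skip i j))
        (ψ fun j : Fin (n + 1) => s (skip i (m + j))) =
      (-1 : ℤ) ^ i • μ (φ fun j : Fin (m + 1) => s (skip i j))
        (ψ fun j : Fin (n + 1) => s (m + 1 + j)) := by
    intro i hi
    have hi := mem_range.1 hi
    congr 3
    ext j
    congr 1
    simp only [skip]
    split_ifs <;> omega
  have e2 : ∀ i ∈ range (n + 1),
      (-1 : ℤ) ^ (m + 1 + i) • μ (φ fun j : Fin (m + 1) => s (skip (m + 1 + i) j))
        (ψ fun j : Fin (n + 1) => s (skip (m + 1 + i) (m + j))) =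
      (-1 : ℤ) ^ (m + (i + 1)) • μ (φ fun j : Fin (m + 1) => s j)
        (ψ fun j : Fin (n + 1) => s (m + skip (i + 1) j)) := by
    intro i hi
    have hi := mem_range.1 hi
    congr 1
    · congr 1; omega
    · congr 2
      · congr 2
        ext j
        congr 1
        simp only [skip]
        split_ifs <;> omega
      · ext j
        congr 1
        simp only [skip]
        split_ifs <;> omega
  rw [Finset.sum_congr rfl e1, Finset.sum_congr rfl e2]
  have e3 : (fun j : Fin (m + 1) => s (skip (m + 1) j)) = fun j : Fin (m + 1) => s j := by
    ext j
    simp only [skip]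
    congr 1
    split_ifs <;> omega
  have e4 : (fun j : Fin (n + 1) => s (m + skip 0 j)) = fun j : Fin (n + 1) => s (m + 1 + j) := by
    ext j
    simp only [skip]
    congr 1
    split_ifs <;> omega
  simp only [e3, e4, pow_succ, add_zero, mul_neg, mul_one, neg_smul]
  abel

/-- Coning off at `o` is a contraction of the Alexander–Spanier complex in positive degrees. -/
lemma coboundary_cone {m : ℕ} (o : X) {φ : (Fin (m + 2) → X) → M}
    (hφ : coboundary X M (m + 1) φ = 0) : coboundary X M m (cone o φ) = φ := by
  ext x
  have h := congrFun hφ (Fin.cons o x)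
  rw [coboundary_apply, Fin.sum_univ_succ] at h
  rw [coboundary_apply]
  simp only [Fin.val_zero, pow_zero, one_smul, Fin.val_succ, pow_succ, mul_neg, mul_one, neg_smul,
    Finset.sum_neg_distrib, Pi.zero_apply] at h
  have e : ∀ i : Fin (m + 2), (Fin.removeNth i.succ (Fin.cons o x : Fin (m + 3) → X) :
      Fin (m + 2) → X) = Fin.cons o (i.removeNth x) := by
    intro i
    ext j
    refine Fin.cases ?_ (fun j => ?_) j
    · simp [Fin.removeNth]
    · simp [Fin.removeNth]
  have e0 : (Fin.removeNth 0 (Fin.cons o x : Fin (m + 3) → X) : Fin (m + 2) → X) = x := by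
    ext j
    simp [Fin.removeNth]
  simp only [e, e0] at h
  exact (sub_eq_zero.1 (by rw [sub_eq_add_neg]; exact h)).symm

/-- A cocycle of degree `0` is constant. -/
lemma eq_zero_of_coboundary_eq_zero {φ : (Fin 1 → X) → M} (hφ : coboundary X M 0 φ = 0) (o : X)
    (ho : φ (fun _ => o) = 0) : φ = 0 := by
  ext x
  have h := congrFun hφ (fun j => if j = 0 then o else x 0)
  rw [coboundary_apply] at h
  change ∑ i : Fin 2, (-1 : ℤ) ^ (i : ℕ) •
    φ (i.removeNth fun j : Fin 2 => if j = 0 then o else x 0) = 0 at h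
  simp only [Fin.sum_univ_two, Fin.val_zero, pow_zero, one_smul, Fin.val_one, pow_one,
    neg_smul] at h
  have e0 : (Fin.removeNth 0 (fun j : Fin 2 => if j = 0 then o else x 0) : Fin 1 → X) = x := by
    ext j; fin_cases j; simp [Fin.removeNth]
  have e1 : (Fin.removeNth 1 (fun j : Fin 2 => if j = 0 then o else x 0) : Fin 1 → X)
      = fun _ => o := by
    ext j; fin_cases j; simp [Fin.removeNth]
  rw [e0, e1, ho] at h
  simpa using h

lemma cup_zero_left (μ : M₁ →+ M₂ →+ M₃) {m n l : ℕ} (h : m + n = l)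
    (ψ : (Fin (n + 1) → X) → M₂) : cup μ h (0 : (Fin (m + 1) → X) → M₁) ψ = 0 := by
  ext x; simp [cup]

lemma cup_zero_right (μ : M₁ →+ M₂ →+ M₃) {m n l : ℕ} (h : m + n = l)
    (φ : (Fin (m + 1) → X) → M₁) : cup μ h φ (0 : (Fin (n + 1) → X) → M₂) = 0 := by
  ext x; simp [cup]

/-- A primitive of `φ ∪ ψ`. In degree `m = 0`, where it is `0` by convention, a cocycle `φ` that
vanishes at `o` vanishes altogether. -/
lemma coboundary_coneCup (μ : M₁ →+ M₂ →+ M₃) (o : X) {m n k : ℕ} (h : m + n = k + 1)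
    {φ : (Fin (m + 1) → X) → M₁} {ψ : (Fin (n + 1) → X) → M₂}
    (hφ : coboundary X M₁ m φ = 0) (hψ : coboundary X M₂ n ψ = 0) (ho : φ (fun _ => o) = 0) :
    coboundary X M₃ k (coneCup μ o h φ ψ) = cup μ h φ ψ := by
  cases m with
  | zero =>
    rw [eq_zero_of_coboundary_eq_zero hφ o ho, cup_zero_left]
    exact map_zero _
  | succ m =>
    rw [coneCup, coboundary_cup μ _ h (by omega), hψ, cup_zero_right, coboundary_cone o hφ,
      smul_zero, add_zero]

lemma coboundary_cupCone (μ : M₁ →+ M₂ →+ M₃) (o : X) {m n k : ℕ} (h : m + n = k + 1)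
    {φ : (Fin (m + 1) → X) → M₁} {ψ : (Fin (n + 1) → X) → M₂}
    (hφ : coboundary X M₁ m φ = 0) (hψ : coboundary X M₂ n ψ = 0) (ho : ψ (fun _ => o) = 0) :
    coboundary X M₃ k (cupCone μ o h φ ψ) = (-1 : ℤ) ^ m • cup μ h φ ψ := by
  cases n with
  | zero =>
    rw [eq_zero_of_coboundary_eq_zero hψ o ho, cup_zero_right, smul_zero]
    exact map_zero _
  | succ n =>
    rw [cupCone, coboundary_cup μ _ (by omega) h, hφ, cup_zero_left, coboundary_cone o hψ,
      zero_add]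

/-- The vertices `u(y₀),…,u(yᵢ),v(yᵢ),…,v(y_k)` of a simplex of the prism over `y`. -/
def prismTuple (u v : Y → X) {k : ℕ} (i : ℕ) (y : Fin (k + 1) → Y) : Fin (k + 2) → X :=
  fun j => if (j : ℕ) ≤ i then u (y ⟨min j k, by omega⟩) else v (y ⟨j - 1, by omega⟩)

/-- The prism operator of two maps `u, v`, a cochain homotopy from `u^*` to `v^*`. -/
def prism (M : Type*) [AddCommGroup M] (u v : Y → X) (k : ℕ) :
    ((Fin (k + 2) → X) → M) →+ ((Fin (k + 1) → Y) → M) where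
  toFun φ := fun y => ∑ i ∈ range (k + 1), (-1 : ℤ) ^ i • φ (prismTuple u v i y)
  map_zero' := by ext; simp
  map_add' φ ψ := by ext; simp [Finset.sum_add_distrib]

lemma prism_apply (u v : Y → X) (k : ℕ) (φ : (Fin (k + 2) → X) → M) (y : Fin (k + 1) → Y) :
    prism M u v k φ y = ∑ i ∈ range (k + 1), (-1 : ℤ) ^ i • φ (prismTuple u v i y) := rfl

lemma prismTuple_seq (u v : Y → X) {k i : ℕ} (hi : i ≤ k) (s : ℕ → Y) :
    prismTuple u v i (fun j : Fin (k + 1) => s j) =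
      fun j : Fin (k + 2) => if (j : ℕ) ≤ i then u (s j) else v (s (j - 1)) := by
  ext j
  simp only [prismTuple]
  split_ifs with h
  · rw [min_eq_left (h.trans hi)]
  · rfl

/-- The combinatorics of the prism identity: all terms cancel in pairs except for two. -/
lemma sum_prism_terms (f : ℕ → ℕ → M) (G : ℕ → M) (k : ℕ) :
    ∑ i ∈ range (k + 1), (-1 : ℤ) ^ i • ∑ j ∈ range (k + 2), (-1 : ℤ) ^ j •
        (if j < i then f (i - 1) j else if j = i then G i else if j = i + 1 then G (i + 1)
          else f i (j - 1)) +
      ∑ j ∈ range (k + 1), (-1 : ℤ) ^ j • ∑ i ∈ range k, (-1 : ℤ) ^ i • f i j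
      = G 0 - G (k + 1) := by
  induction k with
  | zero => simp [Finset.sum_range_succ, sub_eq_add_neg]
  | succ k ih =>
    rw [← sub_add_sub_cancel (G 0) (G (k + 1)) (G (k + 1 + 1)), ← ih]
    rw [Finset.sum_range_succ _ (k + 1)]
    have r1 : ∀ i ∈ range (k + 1), (-1 : ℤ) ^ i • ∑ j ∈ range (k + 1 + 2), (-1 : ℤ) ^ j •
        (if j < i then f (i - 1) j else if j = i then G i else if j = i + 1 then G (i + 1)
          else f i (j - 1)) = (-1 : ℤ) ^ i • ∑ j ∈ range (k + 2), (-1 : ℤ) ^ j •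
        (if j < i then f (i - 1) j else if j = i then G i else if j = i + 1 then G (i + 1)
          else f i (j - 1)) + (-1 : ℤ) ^ (k + 2) • (-1 : ℤ) ^ i • f i (k + 1) := by
      intro i hi
      have hi := mem_range.1 hi
      rw [Finset.sum_range_succ, smul_add, if_neg (by omega), if_neg (by omega),
        if_neg (by omega), smul_comm ((-1 : ℤ) ^ i)]
      rfl
    have r2 : ∑ j ∈ range (k + 1 + 2), (-1 : ℤ) ^ j •
        (if j < k + 1 then f (k + 1 - 1) j else if j = k + 1 then G (k + 1)
          else if j = k + 1 + 1 then G (k + 1 + 1) else f (k + 1) (j - 1)) =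
        ∑ j ∈ range (k + 1), (-1 : ℤ) ^ j • f k j + (-1 : ℤ) ^ (k + 1) • G (k + 1)
          + (-1 : ℤ) ^ (k + 2) • G (k + 2) := by
      rw [Finset.sum_range_succ, Finset.sum_range_succ]
      congr 1
      · congr 1
        · exact Finset.sum_congr rfl fun j hj => by rw [if_pos (mem_range.1 hj)]; rfl
        · simp
      · simp
    have r3 : ∀ j ∈ range (k + 1 + 1), (-1 : ℤ) ^ j • ∑ i ∈ range (k + 1), (-1 : ℤ) ^ i • f i j =
        (-1 : ℤ) ^ j • ∑ i ∈ range k, (-1 : ℤ) ^ i • f i j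
          + (-1 : ℤ) ^ k • (-1 : ℤ) ^ j • f k j := by
      intro j _
      rw [Finset.sum_range_succ, smul_add, smul_comm ((-1 : ℤ) ^ j)]
    rw [Finset.sum_congr rfl r1, r2, Finset.sum_congr rfl r3, Finset.sum_add_distrib,
      Finset.sum_add_distrib, Finset.sum_range_succ _ (k + 1), Finset.sum_range_succ _ (k + 1),
      ← Finset.smul_sum, ← Finset.smul_sum, Finset.sum_range_succ (fun i => (-1 : ℤ) ^ i • f i _) k]
    simp only [smul_add, smul_smul, ← pow_add]
    have p1 : (-1 : ℤ) ^ (k + 1 + (k + 1)) = 1 := Even.neg_one_pow ⟨k + 1, rfl⟩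
    have p2 : (-1 : ℤ) ^ (k + 1 + (k + 2)) = -1 := Odd.neg_one_pow ⟨k + 1, by ring⟩
    have p3 : (-1 : ℤ) ^ (k + (k + 1)) = -1 := Odd.neg_one_pow ⟨k, by ring⟩
    have p4 : (-1 : ℤ) ^ (k + 2 + k) = 1 := Even.neg_one_pow ⟨k + 1, by ring⟩
    have p5 : (-1 : ℤ) ^ (k + 1) = - (-1 : ℤ) ^ k := by ring
    have p6 : (-1 : ℤ) ^ (k + 2) = (-1 : ℤ) ^ k := by ring
    simp only [p1, p2, p3, p4, p5, p6, one_smul, neg_smul]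
    abel

lemma prism_coboundary_zero (u v : Y → X) (φ : (Fin 1 → X) → M) :
    prism M u v 0 (coboundary X M 0 φ) = pullbackFun M v 0 φ - pullbackFun M u 0 φ := by
  ext y
  obtain ⟨s, rfl⟩ := exists_seq y
  rw [prism_apply, Finset.sum_range_one, prismTuple_seq u v le_rfl,
    coboundary_seq φ (fun j => if j ≤ 0 then u (s j) else v (s (j - 1)))]
  simp [Finset.sum_range_succ, skip, sub_eq_add_neg, pullbackFun]

/-- The prism operator is a cochain homotopy in positive degrees. -/
lemma coboundary_prism (u v : Y → X) (k : ℕ) (φ : (Fin (k + 2) → X) → M) :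
    prism M u v (k + 1) (coboundary X M (k + 1) φ) + coboundary Y M k (prism M u v k φ)
      = pullbackFun M v (k + 1) φ - pullbackFun M u (k + 1) φ := by
  ext y
  obtain ⟨s, rfl⟩ := exists_seq y
  rw [Pi.add_apply, Pi.sub_apply, coboundary_seq, prism_apply]
  -- The interior faces `f` occur twice; the faces `G` between neighbouring simplices telescope.
  let f : ℕ → ℕ → M := fun i j => φ (fun l : Fin (k + 2) =>
    if (l : ℕ) ≤ i then u (s (skip j l)) else v (s (skip j (l - 1))))
  let G : ℕ → M := fun i => φ (fun l : Fin (k + 2) => if (l : ℕ) < i then u (s l) else v (s l))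
  have key := sum_prism_terms f G (k + 1)
  have g0 : G 0 = pullbackFun M v (k + 1) φ (fun j : Fin (k + 2) => s j) := by
    simp [G, pullbackFun]
  have g1 : G (k + 1 + 1) = pullbackFun M u (k + 1) φ (fun j : Fin (k + 2) => s j) := by
    change φ _ = φ _
    congr 1
    ext l
    exact if_pos l.2
  rw [← g0, ← g1, ← key]
  congr 1
  · refine Finset.sum_congr rfl fun i hi => ?_
    have hi := mem_range.1 hi
    rw [prismTuple_seq u v (by omega),
      coboundary_seq φ (fun j => if j ≤ i then u (s j) else v (s (j - 1)))]
    congr 1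
    refine Finset.sum_congr rfl fun j _ => ?_
    congr 1
    split_ifs with h1 h2 h3
    · simp only [f]
      congr 1; ext l; simp only [skip]
      split_ifs <;> first | rfl | (congr 2; omega)
    · simp only [G]
      congr 1; ext l; simp only [skip]
      split_ifs <;> first | rfl | (congr 2; omega)
    · simp only [G]
      congr 1; ext l; simp only [skip]
      split_ifs <;> first | rfl | (congr 2; omega)
    · simp only [f]
      congr 1; ext l; simp only [skip]
      split_ifs <;> first | rfl | (congr 2; omega)
  · refine Finset.sum_congr rfl fun j _ => ?_
    rw [prism_apply]
    congr 1
    refine Finset.sum_congr rfl fun i hi => ?_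
    have hi := mem_range.1 hi
    rw [prismTuple_seq u v (by omega) (fun l => s (skip j l))]

end Sequences

/-! ### Coarse cochains on coarsely connected spaces -/

section Bounded

variable {X Y Z M M₁ M₂ M₃ : Type*} [AddCommGroup M] [AddCommGroup M₁] [AddCommGroup M₂]
  [AddCommGroup M₃]

lemma IsCoarselyConnected.isBounded_union {C : CoarseStructure X} (hC : C.IsCoarselyConnected)
    {S T : Set X} (hS : C.IsBounded S) (hT : C.IsBounded T) : C.IsBounded (S ∪ T) := by
  rcases S.eq_empty_or_nonempty with rfl | ⟨s, hs⟩
  · simpa using hT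
  rcases T.eq_empty_or_nonempty with rfl | ⟨t, ht⟩
  · simpa using hS
  obtain ⟨E, hE, hst⟩ := hC s t
  have hS' : C.IsBounded (S ∪ {t}) := by
    have h := C.comp_mem hS hE
    refine C.subset_mem (C.union_mem (C.union_mem hS h)
      (C.union_mem (C.inv_mem h) C.diagonal_mem)) ?_
    rintro ⟨x, y⟩ ⟨hx | hx, hy | hy⟩
    · exact Or.inl (Or.inl ⟨hx, hy⟩)
    · exact Or.inl (Or.inr ⟨s, ⟨hx, hs⟩, hy.symm ▸ hst⟩)
    · exact Or.inr (Or.inl ⟨s, ⟨hy, hs⟩, hx.symm ▸ hst⟩)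
    · exact Or.inr (Or.inr (hx.trans hy.symm))
  exact (hS'.union hT (Or.inr rfl) ht).mono (Set.union_subset_union_left _ Set.subset_union_left)

lemma IsCoarselyConnected.isBounded_biUnion {C : CoarseStructure X} (hC : C.IsCoarselyConnected)
    {ι : Type*} {T : Set ι} (hT : T.Finite) {S : ι → Set X} (hS : ∀ t ∈ T, C.IsBounded (S t)) :
    C.IsBounded (⋃ t ∈ T, S t) := by
  induction T, hT using Set.Finite.induction_on with
  | empty => exact C.subset_mem C.diagonal_mem (by simp)
  | insert _ _ ih =>
    rw [Set.biUnion_insert]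
    exact hC.isBounded_union (hS _ (Set.mem_insert _ _))
      (ih fun t ht => hS t (Set.mem_insert_of_mem _ ht))

/-- The set of points that are `E`-close to a bounded set is bounded. -/
lemma IsBounded.pen {C : CoarseStructure X} {S : Set X} (hS : C.IsBounded S) {E : Set (X × X)}
    (hE : E ∈ C.entourages) : C.IsBounded (pen E S) := by
  refine C.subset_mem (C.comp_mem hE (C.comp_mem hS (C.inv_mem hE))) ?_
  rintro ⟨x, y⟩ ⟨⟨x', hx', hx⟩, ⟨y', hy', hy⟩⟩
  exact ⟨x', hx, y', ⟨hx', hy'⟩, hy⟩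

lemma subset_pen {E F : Set (X × X)} (h : E ⊆ F) (A : Set X) :
    pen E A ⊆ pen F A := fun _ ⟨y, hy, hxy⟩ => ⟨y, hy, h hxy⟩

/-- The function `φ` on tuples in `Y`, seen along `g : Y → X`, has the support of a coarse cochain:
on tuples with `E`-close images, `φ` vanishes unless the images lie in a fixed bounded set. -/
def SupportedAlong (C : CoarseStructure X) (g : Y → X) {m : ℕ} (φ : (Fin (m + 1) → Y) → M) :
    Prop :=
  ∀ E ∈ C.entourages, ∃ B, C.IsBounded B ∧ ∀ y : Fin (m + 1) → Y,
    (∀ i j, (g (y i), g (y j)) ∈ E) → φ y ≠ 0 → ∀ i, g (y i) ∈ B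

/-- It is enough to control one vertex of each tuple. -/
lemma SupportedAlong.of_vertex {C : CoarseStructure X} {g : Y → X} {m : ℕ}
    {φ : (Fin (m + 1) → Y) → M}
    (h : ∀ E ∈ C.entourages, ∃ B, C.IsBounded B ∧ ∀ y : Fin (m + 1) → Y,
      (∀ i j, (g (y i), g (y j)) ∈ E) → φ y ≠ 0 → ∃ i, g (y i) ∈ B) :
    C.SupportedAlong g φ := by
  intro E hE
  obtain ⟨B, hB, h⟩ := h E hE
  refine ⟨_, hB.pen hE, fun y hy hφ i => ?_⟩
  obtain ⟨j, hj⟩ := h y hy hφ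
  exact ⟨_, hj, hy i j⟩

lemma supportedAlong_of_mem_cochains {C : CoarseStructure X} (hC : C.IsCoarselyConnected) {m : ℕ}
    {φ : (Fin (m + 1) → X) → M} (hφ : φ ∈ C.cochains m M) : C.SupportedAlong id φ := by
  rw [mem_cochains_iff] at hφ
  refine SupportedAlong.of_vertex fun E hE => ?_
  obtain ⟨T, hT, hb, hS⟩ := hφ E hE
  refine ⟨⋃ t ∈ T, (fun x : Fin (m + 1) → X => x 0) '' t,
    hC.isBounded_biUnion hT fun t ht => isBounded_pi.1 (hb t ht) 0, fun y hy h => ⟨0, ?_⟩⟩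
  have hyS : y ∈ Function.support φ ∩ closeTuples E m := ⟨h, hy⟩
  rw [hS] at hyS
  obtain ⟨t, ht, hyt⟩ := hyS
  exact Set.mem_biUnion ht ⟨y, hyt, rfl⟩

lemma mem_cochains_of_supportedAlong {C : CoarseStructure X} {m : ℕ}
    {φ : (Fin (m + 1) → X) → M} (hφ : C.SupportedAlong id φ) : φ ∈ C.cochains m M := by
  rw [mem_cochains_iff]
  intro E hE
  obtain ⟨B, hB, h⟩ := hφ E hE
  refine IsPrecompact.mono (S := {x : Fin (m + 1) → X | ∀ i, x i ∈ B})
    ⟨{{x | ∀ i, x i ∈ B}}, Set.finite_singleton _, ?_, by simp⟩ fun x hx => h x hx.2 hx.1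
  rintro _ rfl
  rw [isBounded_pi]
  intro i
  exact hB.mono (by rintro _ ⟨x, hx, rfl⟩; exact hx i)

lemma SupportedAlong.pullbackFun {C : CoarseStructure X} {g : Y → X} {m : ℕ}
    {φ : (Fin (m + 1) → Y) → M} (hφ : C.SupportedAlong g φ) (f : Z → Y) :
    C.SupportedAlong (g ∘ f) (pullbackFun M f m φ) := by
  intro E hE
  obtain ⟨B, hB, h⟩ := hφ E hE
  exact ⟨B, hB, fun y hy hne => h (fun i => f (y i)) hy hne⟩

lemma SupportedAlong.of_subtuple {C : CoarseStructure X} {g : Y → X} {m n : ℕ}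
    {φ : (Fin (m + 1) → Y) → M} {ψ : (Fin (n + 1) → Y) → M₁} (hφ : C.SupportedAlong g φ)
    (ι : Fin (m + 1) → Fin (n + 1)) (h : ∀ y, ψ y ≠ 0 → φ (fun i => y (ι i)) ≠ 0) :
    C.SupportedAlong g ψ := by
  refine .of_vertex fun E hE => ?_
  obtain ⟨B, hB, hφ⟩ := hφ E hE
  exact ⟨B, hB, fun y hy hne => ⟨ι 0, hφ _ (fun i j => hy _ _) (h y hne) 0⟩⟩

lemma SupportedAlong.cup_left {C : CoarseStructure X} {g : Y → X} (μ : M₁ →+ M₂ →+ M₃)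
    {m n l : ℕ} (h : m + n = l) {φ : (Fin (m + 1) → Y) → M₁} (hφ : C.SupportedAlong g φ)
    (ψ : (Fin (n + 1) → Y) → M₂) : C.SupportedAlong g (cup μ h φ ψ) :=
  hφ.of_subtuple (fun i => ⟨i, by omega⟩) fun y hy h0 => hy (by simp [cup, h0])

lemma SupportedAlong.cup_right {C : CoarseStructure X} {g : Y → X} (μ : M₁ →+ M₂ →+ M₃)
    {m n l : ℕ} (h : m + n = l) (φ : (Fin (m + 1) → Y) → M₁) {ψ : (Fin (n + 1) → Y) → M₂}
    (hψ : C.SupportedAlong g ψ) : C.SupportedAlong g (cup μ h φ ψ) :=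
  hψ.of_subtuple (fun j => ⟨m + j, by omega⟩) fun y hy h0 => hy (by simp [cup, h0])

lemma supportedAlong_zero (C : CoarseStructure X) (g : Y → X) (m : ℕ) :
    C.SupportedAlong g (0 : (Fin (m + 1) → Y) → M) :=
  fun _ _ => ⟨∅, C.subset_mem C.diagonal_mem (by simp), fun _ _ h => (h rfl).elim⟩

lemma SupportedAlong.coneCup {C : CoarseStructure X} {g : Y → X} (μ : M₁ →+ M₂ →+ M₃) (o : Y)
    {m n k : ℕ} (h : m + n = k + 1) (φ : (Fin (m + 1) → Y) → M₁) {ψ : (Fin (n + 1) → Y) → M₂}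
    (hψ : C.SupportedAlong g ψ) : C.SupportedAlong g (coneCup μ o h φ ψ) := by
  cases m with
  | zero => exact supportedAlong_zero _ _ _
  | succ m => exact hψ.cup_right μ (by omega) _

lemma SupportedAlong.cupCone {C : CoarseStructure X} {g : Y → X} (μ : M₁ →+ M₂ →+ M₃) (o : Y)
    {m n k : ℕ} (h : m + n = k + 1) {φ : (Fin (m + 1) → Y) → M₁} (ψ : (Fin (n + 1) → Y) → M₂)
    (hφ : C.SupportedAlong g φ) : C.SupportedAlong g (cupCone μ o h φ ψ) := by
  cases n with
  | zero => exact supportedAlong_zero _ _ _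
  | succ n => exact hφ.cup_left μ (by omega) _

/-- The function `φ` vanishes on all tuples of points of `S`. -/
def VanishesOn {n : ℕ} (φ : (Fin n → X) → M) (S : Set X) : Prop := ∀ x, (∀ i, x i ∈ S) → φ x = 0

end Bounded

/-! ### Relative cochains and excision -/

section Excision

variable {X Y M : Type*} [AddCommGroup M]

lemma VanishesOn.mono {n : ℕ} {φ : (Fin n → X) → M} {S T : Set X} (h : VanishesOn φ T)
    (hST : S ⊆ T) : VanishesOn φ S := fun x hx => h x fun i => hST (hx i)

lemma VanishesOn.add {n : ℕ} {φ ψ : (Fin n → X) → M} {S : Set X} (hφ : VanishesOn φ S)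
    (hψ : VanishesOn ψ S) : VanishesOn (φ + ψ) S := fun x hx => by
  rw [Pi.add_apply, hφ x hx, hψ x hx, add_zero]

lemma VanishesOn.sub {n : ℕ} {φ ψ : (Fin n → X) → M} {S : Set X} (hφ : VanishesOn φ S)
    (hψ : VanishesOn ψ S) : VanishesOn (φ - ψ) S := fun x hx => by
  rw [Pi.sub_apply, hφ x hx, hψ x hx, sub_zero]

lemma VanishesOn.pullbackFun {m : ℕ} {φ : (Fin (m + 1) → X) → M} {S : Set X} {T : Set Y}
    (hφ : VanishesOn φ S) {f : Y → X} (hf : Set.MapsTo f T S) :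
    VanishesOn (pullbackFun M f m φ) T := fun _ hx => hφ _ fun i => hf (hx i)

lemma mem_relCochains_singleton {C : CoarseStructure X} {A : Set X} {m : ℕ}
    {φ : (Fin (m + 1) → X) → M} :
    φ ∈ C.relCochains {A} m M ↔ φ ∈ C.cochains m M ∧ VanishesOn φ A :=
  ⟨fun h => ⟨h.1, h.2 A rfl⟩, fun h => ⟨h.1, by rintro _ rfl; exact h.2⟩⟩

lemma mem_relCochains_pair {C : CoarseStructure X} {A B : Set X} {m : ℕ}
    {φ : (Fin (m + 1) → X) → M} :
    φ ∈ C.relCochains {A, B} m M ↔ φ ∈ C.cochains m M ∧ VanishesOn φ A ∧ VanishesOn φ B :=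
  ⟨fun h => ⟨h.1, h.2 A (Or.inl rfl), h.2 B (Or.inr rfl)⟩,
    fun h => ⟨h.1, by rintro _ (rfl | rfl); exacts [h.2.1, h.2.2]⟩⟩

/-- The coboundary only sees the restriction of a cochain to the vertices of each tuple. -/
lemma coboundary_congr {m : ℕ} {φ ψ : (Fin (m + 1) → X) → M} {S : Set X}
    (h : ∀ x, (∀ i, x i ∈ S) → φ x = ψ x) {x : Fin (m + 2) → X} (hx : ∀ i, x i ∈ S) :
    coboundary X M m φ x = coboundary X M m ψ x := by
  simp only [coboundary_apply]
  exact Finset.sum_congr rfl fun i _ => by rw [h (i.removeNth x) fun j => hx _]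

lemma coboundary_eq_zero_of_mem_coboundaries {C : CoarseStructure X} {𝒜 : Set (Set X)} {m : ℕ}
    {φ : (Fin (m + 1) → X) → M} (h : φ ∈ C.coboundaries 𝒜 m M) : coboundary X M m φ = 0 :=
  (C.coboundaries_le_cocycles 𝒜 m h).2

lemma exists_represents {C : CoarseStructure X} {𝒜 : Set (Set X)} {m : ℕ} (c : C.HX 𝒜 m M) :
    ∃ φ, Represents φ c := by
  obtain ⟨⟨φ, hφ⟩, rfl⟩ := QuotientAddGroup.mk_surjective c
  exact ⟨φ, hφ, rfl⟩

lemma exists_class {C : CoarseStructure X} {𝒜 : Set (Set X)} {m : ℕ}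
    {φ : (Fin (m + 1) → X) → M} (h : φ ∈ C.cocycles 𝒜 m M) : ∃ c : C.HX 𝒜 m M, Represents φ c :=
  ⟨_, h, rfl⟩

lemma Represents.mem {C : CoarseStructure X} {𝒜 : Set (Set X)} {m : ℕ}
    {φ : (Fin (m + 1) → X) → M} {c : C.HX 𝒜 m M} (h : Represents φ c) : φ ∈ C.cocycles 𝒜 m M :=
  h.1

lemma Represents.eq_iff {C : CoarseStructure X} {𝒜 : Set (Set X)} {m : ℕ}
    {φ ψ : (Fin (m + 1) → X) → M} {c d : C.HX 𝒜 m M} (hφ : Represents φ c)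
    (hψ : Represents ψ d) : c = d ↔ ψ - φ ∈ C.coboundaries 𝒜 m M := by
  obtain ⟨hφ, rfl⟩ := hφ
  obtain ⟨hψ, rfl⟩ := hψ
  rw [QuotientAddGroup.eq, AddSubgroup.mem_addSubgroupOf, sub_eq_neg_add]
  rfl

lemma Represents.of_sub_mem {C : CoarseStructure X} {𝒜 : Set (Set X)} {m : ℕ}
    {φ ψ : (Fin (m + 1) → X) → M} {c : C.HX 𝒜 m M} (hφ : Represents φ c)
    (h : ψ - φ ∈ C.coboundaries 𝒜 m M) : Represents ψ c := by
  have hψ : ψ ∈ C.cocycles 𝒜 m M := by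
    rw [← sub_add_cancel ψ φ]
    exact add_mem (C.coboundaries_le_cocycles 𝒜 m h) hφ.mem
  obtain ⟨d, hd⟩ := exists_class hψ
  rwa [(hφ.eq_iff hd).2 h]

lemma Represents.zsmul {C : CoarseStructure X} {𝒜 : Set (Set X)} {m : ℕ}
    {φ : (Fin (m + 1) → X) → M} {c : C.HX 𝒜 m M} (h : Represents φ c) (r : ℤ) :
    Represents (r • φ) (r • c) := by
  obtain ⟨h, rfl⟩ := h
  exact ⟨zsmul_mem h r, rfl⟩

lemma Represents.map {C : CoarseStructure X} {D : CoarseStructure Y} {f : X → Y}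
    {hf : IsCoarse C D f} {𝒜 : Set (Set X)} {ℬ : Set (Set Y)}
    {hAB : ∀ A ∈ 𝒜, ∃ B ∈ ℬ, Set.MapsTo f A B} {m : ℕ} {φ : (Fin (m + 1) → Y) → M}
    {c : D.HX ℬ m M} (h : Represents φ c) :
    Represents (CoarseStructure.pullbackFun M f m φ) (HX.map f hf hAB m M c) := by
  obtain ⟨h, rfl⟩ := h
  exact ⟨_, rfl⟩

lemma Represents.sumMap {C : CoarseStructure X} {A B : Set X} {m : ℕ}
    {φ : (Fin (m + 1) → X) → M} {c : C.HX {A ∪ B} m M} (h : Represents φ c) :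
    Represents φ (C.sumMap A B m M c) :=
  show Represents (CoarseStructure.pullbackFun M id m φ) _ from h.map

lemma prismTuple_zero (u v : Y → X) {k : ℕ} (i : ℕ) (y : Fin (k + 1) → Y) :
    prismTuple u v i y 0 = u (y 0) := by
  simp [prismTuple]

/-- Relations between the vertices over `y` hold between the vertices of the prism. -/
lemma prismTuple_rel {u v : Y → X} {k : ℕ} (i : ℕ) {y : Fin (k + 1) → Y} {F : Set (X × X)}
    (huu : ∀ i j, (u (y i), u (y j)) ∈ F) (huv : ∀ i j, (u (y i), v (y j)) ∈ F)
    (hvu : ∀ i j, (v (y i), u (y j)) ∈ F) (hvv : ∀ i j, (v (y i), v (y j)) ∈ F)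
    (a b : Fin (k + 2)) : (prismTuple u v i y a, prismTuple u v i y b) ∈ F := by
  simp only [prismTuple]
  split_ifs
  exacts [huu _ _, huv _ _, hvu _ _, hvv _ _]

lemma exists_prismTuple_ne_zero {u v : Y → X} {k : ℕ} {φ : (Fin (k + 2) → X) → M}
    {y : Fin (k + 1) → Y} (h : prism M u v k φ y ≠ 0) : ∃ i, φ (prismTuple u v i y) ≠ 0 := by
  rw [prism_apply] at h
  obtain ⟨i, _, hi⟩ := Finset.exists_ne_zero_of_sum_ne_zero h
  exact ⟨i, fun h0 => hi (by rw [h0, smul_zero])⟩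

lemma VanishesOn.prism {u v : Y → X} {k : ℕ} {φ : (Fin (k + 2) → X) → M} {S : Set X} {T : Set Y}
    (h : VanishesOn φ S) (hu : Set.MapsTo u T S) (hv : Set.MapsTo v T S) :
    VanishesOn (prism M u v k φ) T := by
  intro y hy
  by_contra h0
  obtain ⟨i, hi⟩ := exists_prismTuple_ne_zero h0
  refine hi (h _ fun j => ?_)
  simp only [prismTuple]
  split_ifs
  exacts [hu (hy _), hv (hy _)]

/-- A witness of excisiveness: a map of `A ∪ B` into `A ∩ B` which, for every entourage `E`, moves
the points that are `E`-close to both `A` and `B` by a bounded amount only. -/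
structure IsExcisionMap (C : CoarseStructure X) (A B : Set X) (π : X → X) : Prop where
  mapsTo : Set.MapsTo π (A ∪ B) (A ∩ B)
  close : ∀ E ∈ C.entourages, ∃ F ∈ C.entourages, ∀ x ∈ pen E A ∩ pen E B, (x, π x) ∈ F

open Classical in
/-- Excision at the level of cochains. The prism operator from the identity to `π`, cut off outside
of `A ∪ B`, preserves coarse cochains vanishing on `A` and on `B`: it only involves tuples
with vertices in `A` and in `B`, on which `π` is close to the identity. -/
lemma IsExcisionMap.exists_sub_mem_relCochains {C : CoarseStructure X}
    (hC : C.IsCoarselyConnected) {A B : Set X} {π : X → X} (hπ : C.IsExcisionMap A B π) {k : ℕ}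
    {φ : (Fin (k + 1) → X) → M} (hφ : φ ∈ C.relCochains {A, B} k M)
    (hδ : VanishesOn (coboundary X M k φ) (A ∪ B)) :
    ∃ κ ∈ C.coboundaries {A, B} k M, φ - κ ∈ C.relCochains {A ∪ B} k M := by
  cases k with
  | zero =>
    refine ⟨0, zero_mem _, ?_⟩
    rw [sub_zero]
    rw [mem_relCochains_pair] at hφ
    refine mem_relCochains_singleton.2 ⟨hφ.1, fun x hx => ?_⟩
    rcases hx 0 with h | h
    · exact hφ.2.1 x fun i => (Fin.fin_one_eq_zero i : i = 0) ▸ h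
    · exact hφ.2.2 x fun i => (Fin.fin_one_eq_zero i : i = 0) ▸ h
  | succ k =>
    have hφ' := mem_relCochains_pair.1 hφ
    have hπA : Set.MapsTo π A A := fun x hx => (hπ.mapsTo (Or.inl hx)).1
    have hπB : Set.MapsTo π B B := fun x hx => (hπ.mapsTo (Or.inr hx)).2
    let κ : (Fin (k + 1) → X) → M := fun x =>
      if ∀ i, x i ∈ A ∪ B then prism M id π k φ x else 0
    have hκA : VanishesOn κ A := fun x hx =>
      (if_pos fun i => Or.inl (hx i)).trans (hφ'.2.1.prism (Set.mapsTo_id A) hπA x hx)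
    have hκB : VanishesOn κ B := fun x hx =>
      (if_pos fun i => Or.inr (hx i)).trans (hφ'.2.2.prism (Set.mapsTo_id B) hπB x hx)
    have hκ : κ ∈ C.relCochains {A, B} k M := by
      refine mem_relCochains_pair.2 ⟨mem_cochains_of_supportedAlong ?_, hκA, hκB⟩
      refine .of_vertex fun E hE => ?_
      obtain ⟨F, hF, hclose⟩ := hπ.close E hE
      have hF' := C.union_mem C.diagonal_mem hF
      have hG := C.comp_mem (C.inv_mem hF') (C.comp_mem hE hF')
      obtain ⟨S, hS, hφS⟩ := supportedAlong_of_mem_cochains hC hφ'.1 _ hG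
      refine ⟨S, hS, fun x hx hne => ⟨0, ?_⟩⟩
      have hAB : ∀ i, x i ∈ A ∪ B := by
        by_contra h
        exact hne (if_neg h)
      have hne' : prism M id π k φ x ≠ 0 := by
        rwa [show κ x = prism M id π k φ x from if_pos hAB] at hne
      have h1 : ∃ i, x i ∈ B := by
        by_contra h
        exact hne (hκA x fun i => (hAB i).resolve_right fun hi => h ⟨i, hi⟩)
      have h2 : ∃ i, x i ∈ A := by
        by_contra h
        exact hne (hκB x fun i => (hAB i).resolve_left fun hi => h ⟨i, hi⟩)
      obtain ⟨b, hb⟩ := h1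
      obtain ⟨a, ha⟩ := h2
      have hxF : ∀ i, (x i, π (x i)) ∈ F := fun i =>
        hclose _ ⟨⟨_, ha, hx i a⟩, ⟨_, hb, hx i b⟩⟩
      obtain ⟨i, hi⟩ := exists_prismTuple_ne_zero hne'
      have : prismTuple id π i x 0 ∈ S := hφS _ (prismTuple_rel i
        (fun i j => ⟨x i, Or.inl rfl, x j, hx i j, Or.inl rfl⟩)
        (fun i j => ⟨x i, Or.inl rfl, x j, hx i j, Or.inr (hxF j)⟩)
        (fun i j => ⟨x i, Or.inr (hxF i), x j, hx i j, Or.inl rfl⟩)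
        (fun i j => ⟨x i, Or.inr (hxF i), x j, hx i j, Or.inr (hxF j)⟩)) hi 0
      rwa [prismTuple_zero] at this
    refine ⟨-coboundary X M k κ, neg_mem ⟨κ, hκ, rfl⟩, ?_⟩
    rw [sub_neg_eq_add]
    refine mem_relCochains_singleton.2
      ⟨add_mem hφ.1 (coboundary_mem_relCochains hκ).1, fun x hx => ?_⟩
    have h1 : coboundary X M k κ x = coboundary X M k (prism M id π k φ) x :=
      coboundary_congr (fun y hy => if_pos hy) hx
    have h2 := congrFun (coboundary_prism id π k φ) x
    have h3 : prism M id π (k + 1) (coboundary X M (k + 1) φ) x = 0 :=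
      hδ.prism (Set.mapsTo_id _) (fun y hy => Or.inl (hπ.mapsTo hy).1) x hx
    have h4 : pullbackFun M π (k + 1) φ x = 0 :=
      hφ'.2.1 _ fun i => (hπ.mapsTo (hx i)).1
    rw [Pi.add_apply, Pi.sub_apply, h3, h4, zero_add, zero_sub] at h2
    rw [Pi.add_apply, h1, h2]
    exact add_neg_cancel (φ x)

lemma IsExcisionMap.sumMap_bijective {C : CoarseStructure X} (hC : C.IsCoarselyConnected)
    {A B : Set X} {π : X → X} (hπ : C.IsExcisionMap A B π) (k : ℕ) (M : Type*)
    [AddCommGroup M] : Function.Bijective (C.sumMap A B k M) := by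
  constructor
  · rw [injective_iff_map_eq_zero]
    intro c hc
    obtain ⟨φ, hφ⟩ := exists_represents c
    have h0 : ∀ 𝒜 : Set (Set X), Represents (0 : (Fin (k + 1) → X) → M) (0 : C.HX 𝒜 k M) :=
      fun 𝒜 => ⟨zero_mem _, rfl⟩
    have h := ((h0 _).eq_iff hφ.sumMap).1 hc.symm
    refine Eq.symm (((h0 _).eq_iff hφ).2 ?_)
    rw [sub_zero] at h ⊢
    cases k with
    | zero => exact h
    | succ k =>
      obtain ⟨η, hη, rfl⟩ := h
      obtain ⟨κ, hκ, hη'⟩ := hπ.exists_sub_mem_relCochains hC hη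
        (mem_relCochains_singleton.1 hφ.mem.1).2
      refine ⟨_, hη', ?_⟩
      rw [map_sub, coboundary_eq_zero_of_mem_coboundaries hκ, sub_zero]
  · intro c
    obtain ⟨φ, hφ⟩ := exists_represents c
    obtain ⟨κ, hκ, hφ'⟩ := hπ.exists_sub_mem_relCochains hC hφ.mem.1
      (by rw [show coboundary X M k φ = 0 from hφ.mem.2]; exact fun _ _ => rfl)
    have hmem : φ - κ ∈ C.cocycles {A ∪ B} k M := ⟨hφ', by
      change coboundary X M k (φ - κ) = 0
      rw [map_sub, coboundary_eq_zero_of_mem_coboundaries hκ, sub_zero]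
      exact hφ.mem.2⟩
    obtain ⟨d, hd⟩ := exists_class hmem
    refine ⟨d, (hd.sumMap.eq_iff hφ).2 ?_⟩
    rwa [sub_sub_cancel]

/-- In a countably generated coarse space, every nonempty subset `A` admits a map `X → A` moving
the points of each penumbra of `A` by a bounded amount only: choose a point of `A` that is closest
with respect to a generating sequence of entourages. -/
lemma IsCountablyGenerated.exists_nearest {C : CoarseStructure X} (hC : C.IsCountablyGenerated)
    {A : Set X} (hA : A.Nonempty) :
    ∃ ρ : X → X, (∀ x, ρ x ∈ A) ∧
      ∀ E ∈ C.entourages, ∃ F ∈ C.entourages, ∀ x ∈ pen E A, (x, ρ x) ∈ F := by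
  classical
  obtain ⟨E, hmono, hE, hgen⟩ := hC
  obtain ⟨a, ha⟩ := hA
  have key : ∀ x, ∃ y ∈ A, ∀ n, x ∈ pen (E n) A → (x, y) ∈ E n := by
    intro x
    by_cases h : ∃ n, x ∈ pen (E n) A
    · obtain ⟨y, hy, hxy⟩ := Nat.find_spec h
      exact ⟨y, hy, fun n hn => hmono (Nat.find_min' h hn) hxy⟩
    · exact ⟨a, ha, fun n hn => (h ⟨n, hn⟩).elim⟩
  choose ρ hρ hclose using key
  refine ⟨ρ, hρ, fun F hF => ?_⟩
  obtain ⟨n, hn⟩ := hgen F hF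
  exact ⟨E n, hE n, fun x hx => hclose x n (subset_pen hn A hx)⟩

lemma exists_isExcisionMap {C : CoarseStructure X} (hconn : C.IsCoarselyConnected)
    (hcount : C.IsCountablyGenerated) {A B : Set X} (hexc : C.IsExcisive A B)
    (hA : A.Nonempty) (hB : B.Nonempty) : ∃ π, C.IsExcisionMap A B π := by
  obtain ⟨a, ha⟩ := hA
  obtain ⟨b, hb⟩ := hB
  obtain ⟨E, hE, hab⟩ := hconn a b
  -- The point `a` is close to `A` and to `B`, so that `A ∩ B` is nonempty by excisiveness.
  obtain ⟨F, -, hF⟩ := hexc _ (C.union_mem hE C.diagonal_mem)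
  obtain ⟨c, hc, -⟩ := hF (show a ∈ _ from ⟨⟨a, ha, Or.inr rfl⟩, ⟨b, hb, Or.inl hab⟩⟩)
  obtain ⟨π, hπ, hclose⟩ := hcount.exists_nearest ⟨c, hc⟩
  refine ⟨π, fun x _ => hπ x, fun E hE => ?_⟩
  obtain ⟨F, hF, hEF⟩ := hexc E hE
  obtain ⟨G, hG, hFG⟩ := hclose F hF
  exact ⟨G, hG, fun x hx => hFG x (hEF hx)⟩

/-- The triad in the definition of the cross product is excisive: apply the nearest point maps of
`A` and `B` in the two factors. -/
lemma exists_isExcisionMap_prod {C : CoarseStructure X} {D : CoarseStructure Y}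
    (hC : C.IsCountablyGenerated) (hD : D.IsCountablyGenerated) {A : Set X} {B : Set Y}
    (hA : A.Nonempty) (hB : B.Nonempty) :
    ∃ π, (C.prod D).IsExcisionMap (A ×ˢ Set.univ) (Set.univ ×ˢ B) π := by
  obtain ⟨α, hα, hα'⟩ := hC.exists_nearest hA
  obtain ⟨β, hβ, hβ'⟩ := hD.exists_nearest hB
  refine ⟨Prod.map α β, fun p _ => ⟨⟨hα _, trivial⟩, ⟨trivial, hβ _⟩⟩, fun E hE => ?_⟩
  obtain ⟨F, hF, hEF⟩ := hα' _ hE.1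
  obtain ⟨G, hG, hEG⟩ := hβ' _ hE.2
  refine ⟨{p | (p.1.1, p.2.1) ∈ F ∧ (p.1.2, p.2.2) ∈ G}, ⟨?_, ?_⟩, ?_⟩
  · exact C.subset_mem hF (by rintro _ ⟨p, hp, rfl⟩; exact hp.1)
  · exact D.subset_mem hG (by rintro _ ⟨p, hp, rfl⟩; exact hp.2)
  · rintro ⟨x, y⟩ ⟨⟨p, hp, hpE⟩, ⟨q, hq, hqE⟩⟩
    exact ⟨hEF x ⟨p.1, hp.1, ⟨_, hpE, rfl⟩⟩, hEG y ⟨q.2, hq.2, ⟨_, hqE, rfl⟩⟩⟩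

lemma IsCoarselyConnected.prod {C : CoarseStructure X} {D : CoarseStructure Y}
    (hC : C.IsCoarselyConnected) (hD : D.IsCoarselyConnected) :
    (C.prod D).IsCoarselyConnected := by
  rintro ⟨x, y⟩ ⟨x', y'⟩
  obtain ⟨E, hE, h1⟩ := hC x x'
  obtain ⟨F, hF, h2⟩ := hD y y'
  refine ⟨{p | (p.1.1, p.2.1) ∈ E ∧ (p.1.2, p.2.2) ∈ F}, ⟨?_, ?_⟩, h1, h2⟩
  · exact C.subset_mem hE (by rintro _ ⟨p, hp, rfl⟩; exact hp.1)
  · exact D.subset_mem hF (by rintro _ ⟨p, hp, rfl⟩; exact hp.2)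

end Excision

/-! ### Warped products and dyadic neighbourhood families -/

section Dyadic

variable {X M : Type*} [AddCommGroup M]

lemma IsCoarselyConnected.warped {C : CoarseStructure X} (hC : C.IsCoarselyConnected)
    {U : X → Set (Interval × Interval)} (hU : IsNbhdFamily U) :
    (C.warped U).IsCoarselyConnected := by
  rintro ⟨x, s⟩ ⟨y, t⟩
  obtain ⟨E, hE, hxy⟩ := hC x y
  have h1 : {p : (X × Interval) × (X × Interval) | (p.1.1, p.2.1) ∈ E ∧ p.1.2 = p.2.2}
      ∈ (C.warped U).entourages := mem_generate (Or.inl ⟨_, hE, rfl⟩)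
  exact ⟨_, comp_mem _ h1 (C.isBounded_fiber hU y), (y, s), ⟨hxy, rfl⟩, rfl, rfl⟩

lemma IsCoarselyConnected.subspace {C : CoarseStructure X} (hC : C.IsCoarselyConnected)
    (Z : Set X) : (C.subspace Z).IsCoarselyConnected := by
  intro x y
  obtain ⟨E, hE, hxy⟩ := hC x y
  exact ⟨Prod.map Subtype.val Subtype.val ⁻¹' E,
    C.subset_mem hE (Set.image_preimage_subset _ _), hxy⟩

/-- For coarse cochains on a warped product, supports need only be controlled in the base. -/
lemma mem_cochains_warped {C : CoarseStructure X} {U : X → Set (Interval × Interval)}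
    (hU : IsNbhdFamily U) {m : ℕ} {φ : (Fin (m + 1) → X × Interval) → M}
    (h : ∀ E ∈ (C.warped U).entourages, ∃ B, C.IsBounded B ∧ ∀ y : Fin (m + 1) → X × Interval,
      (∀ i j, (y i, y j) ∈ E) → φ y ≠ 0 → ∃ i, (y i).1 ∈ B) :
    φ ∈ (C.warped U).cochains m M := by
  refine mem_cochains_of_supportedAlong (.of_vertex fun E hE => ?_)
  obtain ⟨B, hB, h⟩ := h E hE
  exact ⟨_, C.isBounded_cylinder hU hB, h⟩

/-- The family of the neighbourhoods of width `2⁻ⁿ⁽ˣ⁾` of the diagonal. -/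
def dyadicFamily (n : X → ℕ) : X → Set (Interval × Interval) :=
  fun x => {p | dist p.1 p.2 ≤ (2⁻¹ : ℝ) ^ n x}

lemma isNbhdFamily_dyadicFamily (n : X → ℕ) : IsNbhdFamily (dyadicFamily n) := by
  intro x
  rw [nhdsSet_diagonal_eq_uniformity]
  exact Filter.mem_of_superset
    (Metric.dist_mem_uniformity (show (0 : ℝ) < 2⁻¹ ^ n x by positivity))
    fun p (hp : dist p.1 p.2 < _) => hp.le

lemma IsNbhdFamily.exists_dyadicFamily {U : X → Set (Interval × Interval)} (hU : IsNbhdFamily U) :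
    ∃ n, ∀ x, dyadicFamily n x ⊆ U x := by
  have key : ∀ x, ∃ n : ℕ, {p : Interval × Interval | dist p.1 p.2 ≤ (2⁻¹ : ℝ) ^ n} ⊆ U x := by
    intro x
    have h := hU x
    rw [nhdsSet_diagonal_eq_uniformity] at h
    obtain ⟨ε, hε, hεU⟩ := Metric.mem_uniformity_dist.1 h
    obtain ⟨n, hn⟩ := exists_pow_lt_of_lt_one hε (show (2⁻¹ : ℝ) < 1 by norm_num)
    exact ⟨n, fun p hp => hεU (lt_of_le_of_lt hp hn)⟩
  choose n hn using key
  exact ⟨n, hn⟩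

lemma IsSuspensionFamily.mono {C : CoarseStructure X} {A : Set X}
    {U V : X → Set (Interval × Interval)} (hU : C.IsSuspensionFamily A U) (hV : IsNbhdFamily V)
    (h : ∀ x, V x ⊆ U x) : C.IsSuspensionFamily A V :=
  ⟨hV, fun ε hε => (hU.2 ε hε).imp fun _ hE => ⟨hE.1, fun x hx p hp => hE.2 x hx p (h x hp)⟩⟩

/-- The largest multiple of `2⁻ⁿ` that is at most `s`. -/
noncomputable def dyadicFloor (n : ℕ) (s : Interval) : Interval :=
  ⟨(⌊(s : ℝ) * 2 ^ n⌋ : ℝ) / 2 ^ n, by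
    constructor
    · rw [le_div_iff₀ (by positivity)]
      have h : (-(2 ^ n : ℤ)) ≤ ⌊(s : ℝ) * 2 ^ n⌋ := by
        rw [Int.le_floor]
        push_cast
        nlinarith [s.2.1, show (0 : ℝ) < 2 ^ n by positivity]
      have h' : ((-(2 ^ n : ℤ) : ℤ) : ℝ) ≤ (⌊(s : ℝ) * 2 ^ n⌋ : ℝ) := by exact_mod_cast h
      push_cast at h'
      linarith
    · rw [div_le_iff₀ (by positivity), one_mul]
      refine (Int.floor_le _).trans ?_
      nlinarith [s.2.2, show (0 : ℝ) < 2 ^ n by positivity]⟩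

lemma coe_dyadicFloor (n : ℕ) (s : Interval) :
    (dyadicFloor n s : ℝ) = (⌊(s : ℝ) * 2 ^ n⌋ : ℝ) / 2 ^ n := rfl

lemma dyadicFloor_le (n : ℕ) (s : Interval) : (dyadicFloor n s : ℝ) ≤ s := by
  rw [coe_dyadicFloor, div_le_iff₀ (by positivity)]
  exact Int.floor_le _

lemma lt_dyadicFloor_add (n : ℕ) (s : Interval) :
    (s : ℝ) < dyadicFloor n s + (2⁻¹ : ℝ) ^ n := by
  have h := Int.lt_floor_add_one ((s : ℝ) * 2 ^ n)
  rw [coe_dyadicFloor, inv_pow, inv_eq_one_div, ← add_div, lt_div_iff₀ (by positivity)]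
  exact h

lemma dyadicFloor_eq_self (n : ℕ) {s : Interval} {r : ℤ} (hs : (s : ℝ) = r) :
    dyadicFloor n s = s := by
  apply Subtype.ext
  have h : (s : ℝ) * 2 ^ n = ((r * 2 ^ n : ℤ) : ℝ) := by push_cast; rw [hs]
  rw [coe_dyadicFloor, h, Int.floor_intCast, ← h]
  field_simp

lemma dyadicFloor_neg_iff (n : ℕ) (s : Interval) : (dyadicFloor n s : ℝ) < 0 ↔ (s : ℝ) < 0 := by
  have h2 : (0 : ℝ) < 2 ^ n := by positivity
  rw [coe_dyadicFloor, div_lt_iff₀ h2, zero_mul]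
  norm_cast
  rw [Int.floor_lt]
  push_cast
  constructor <;> intro h <;> nlinarith

lemma abs_dyadicFloor_sub_le (n : ℕ) {s s' : Interval} (h : (s : ℝ) ≤ s')
    (h' : (s' : ℝ) ≤ s + (2⁻¹ : ℝ) ^ n) :
    |(dyadicFloor n s : ℝ) - dyadicFloor n s'| ≤ (2⁻¹ : ℝ) ^ n := by
  have h2 : (0 : ℝ) < 2 ^ n := by positivity
  have h1 : ⌊(s : ℝ) * 2 ^ n⌋ ≤ ⌊(s' : ℝ) * 2 ^ n⌋ := Int.floor_le_floor (by nlinarith)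
  have h3 : ⌊(s' : ℝ) * 2 ^ n⌋ ≤ ⌊(s : ℝ) * 2 ^ n⌋ + 1 := by
    rw [← Int.floor_add_one]
    refine Int.floor_le_floor ?_
    have : (2⁻¹ : ℝ) ^ n * 2 ^ n = 1 := by rw [← mul_pow]; norm_num
    nlinarith
  have h1' : (⌊(s : ℝ) * 2 ^ n⌋ : ℝ) ≤ ⌊(s' : ℝ) * 2 ^ n⌋ := by exact_mod_cast h1
  have h3' : (⌊(s' : ℝ) * 2 ^ n⌋ : ℝ) ≤ ⌊(s : ℝ) * 2 ^ n⌋ + 1 := by exact_mod_cast h3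
  rw [coe_dyadicFloor, coe_dyadicFloor, ← sub_div, abs_div, abs_of_pos h2, inv_pow,
    inv_eq_one_div]
  gcongr
  rw [abs_le]
  constructor <;> linarith

/-- The subdivision points `-1 + j / 2^N` of the interval. -/
noncomputable def dyadicTime (N j : ℕ) : Interval :=
  ⟨min 1 (-1 + j / 2 ^ N), le_min (by norm_num) (by
    have : (0 : ℝ) ≤ j / 2 ^ N := by positivity
    linarith), min_le_left _ _⟩

lemma coe_dyadicTime {N j : ℕ} (h : j ≤ 2 ^ (N + 1)) :
    (dyadicTime N j : ℝ) = -1 + j / 2 ^ N := by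
  refine min_eq_right ?_
  have h' : (j : ℝ) ≤ 2 ^ (N + 1) := by exact_mod_cast h
  have : (j : ℝ) / 2 ^ N ≤ 2 := by
    rw [div_le_iff₀ (by positivity)]
    rw [pow_succ] at h'
    linarith
  linarith

lemma dyadicTime_zero (N : ℕ) : dyadicTime N 0 = Interval.bot := by
  apply Subtype.ext
  rw [coe_dyadicTime (by positivity)]
  simp [Interval.bot]

lemma dyadicTime_last (N : ℕ) : dyadicTime N (2 ^ (N + 1)) = Interval.top := by
  apply Subtype.ext
  rw [coe_dyadicTime le_rfl]
  have h2 : (2 : ℝ) ^ N ≠ 0 := by positivity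
  simp only [Interval.top]
  push_cast
  rw [pow_succ]
  field_simp
  ring

lemma dyadicTime_two_mul (N j : ℕ) : dyadicTime (N + 1) (2 * j) = dyadicTime N j := by
  apply Subtype.ext
  simp only [dyadicTime]
  congr 2
  push_cast
  rw [pow_succ]
  field_simp

/-- Passing to the next level of subdivision does not create new values of `dyadicFloor n`. -/
lemma dyadicFloor_dyadicTime_odd {n N j : ℕ} (hn : n ≤ N) (hj : j < 2 ^ (N + 1)) :
    dyadicFloor n (dyadicTime (N + 1) (2 * j + 1)) = dyadicFloor n (dyadicTime N j) := by
  apply Subtype.ext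
  rw [coe_dyadicFloor, coe_dyadicFloor, coe_dyadicTime hj.le,
    coe_dyadicTime (by rw [pow_succ 2 (N + 1)]; omega)]
  congr 2
  obtain ⟨d, rfl⟩ := Nat.exists_eq_add_of_le hn
  set a : ℤ := j - 2 ^ (n + d) with ha
  set D : ℤ := 2 ^ d with hD
  have hD0 : (0 : ℝ) < D := by rw [hD]; positivity
  have e1 : (-1 + (j : ℝ) / 2 ^ (n + d)) * 2 ^ n = a / D := by
    rw [ha, hD]; push_cast; rw [pow_add]; field_simp; ring
  have e2 : (-1 + ((2 * j + 1 : ℕ) : ℝ) / 2 ^ (n + d + 1)) * 2 ^ n = (a + 1 / 2) / D := by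
    rw [ha, hD]; push_cast; rw [pow_succ, pow_add]; field_simp; ring
  rw [e1, e2, Int.floor_eq_iff]
  have h1 := Int.floor_le ((a : ℝ) / D)
  have h2 := Int.lt_floor_add_one ((a : ℝ) / D)
  set q := ⌊(a : ℝ) / D⌋
  rw [le_div_iff₀ hD0] at h1 ⊢
  rw [div_lt_iff₀ hD0] at h2 ⊢
  have h3 : a < (q + 1) * D := by exact_mod_cast h2
  have h4 : a + 1 ≤ (q + 1) * D := h3
  have h5 : (a : ℝ) + 1 ≤ (q + 1) * D := by exact_mod_cast h4
  constructor <;> linarith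

end Dyadic

section Slide

variable {X : Type*}

/-- The map `(x, t) ↦ (x, max(t, s'))`, where `s'` is `s` rounded down to a multiple of
`2⁻ⁿ⁽ˣ⁾`. Owing to the rounding, a point over `x` only moves in steps of length `2⁻ⁿ⁽ˣ⁾`,
and at finitely many times. -/
noncomputable def slide (n : X → ℕ) (s : Interval) (p : X × Interval) : X × Interval :=
  (p.1, max p.2 (dyadicFloor (n p.1) s))

lemma slide_bot (n : X → ℕ) (p : X × Interval) : slide n Interval.bot p = p := by
  have h : dyadicFloor (n p.1) Interval.bot = Interval.bot :=
    dyadicFloor_eq_self (r := -1) _ (by simp [Interval.bot])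
  simp only [slide, h]
  rw [max_eq_left]
  exact p.2.2.1

lemma slide_top (n : X → ℕ) (p : X × Interval) :
    slide n Interval.top p = (p.1, Interval.top) := by
  have h : dyadicFloor (n p.1) Interval.top = Interval.top :=
    dyadicFloor_eq_self (r := 1) _ (by simp [Interval.top])
  simp only [slide, h]
  rw [max_eq_right]
  exact p.2.2.2

lemma mem_warped_of_mem (C : CoarseStructure X) (U : X → Set (Interval × Interval)) :
    {p : (X × Interval) × (X × Interval) | p.1.1 = p.2.1 ∧ (p.1.2, p.2.2) ∈ U p.1.1} ∈
      (C.warped U).entourages := mem_generate (Or.inr rfl)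

lemma abs_max_sub_max_left (u c d : Interval) :
    |((max u c : Interval) : ℝ) - (max u d : Interval)| ≤ |(c : ℝ) - d| := by
  have h1 : ∀ c : Interval, ((max u c : Interval) : ℝ) = max (c : ℝ) u := fun c => by
    rw [max_comm]; exact Monotone.map_max (Subtype.mono_coe _)
  rw [h1, h1]
  exact abs_max_sub_max_le_abs _ _ _

/-- The slides are uniformly controlled: the slides of two points over neighbouring `x` and `y`
differ by at most one step of the coarser of the two subdivisions. -/
lemma slide_controlled (C : CoarseStructure X) (n : X → ℕ) {E : Set ((X × Interval) × X × Interval)}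
    (hE : E ∈ (C.warped (dyadicFamily n)).entourages) :
    ∃ F ∈ (C.warped (dyadicFamily n)).entourages,
      ∀ s, ∀ p ∈ E, (slide n s p.1, slide n s p.2) ∈ F := by
  set P := C.warped (dyadicFamily n) with hP
  -- The sets with this property form a coarse structure, so that generators suffice.
  let D : CoarseStructure (X × Interval) :=
    { entourages := {E | ∃ F ∈ P.entourages, ∀ s, ∀ p ∈ E, (slide n s p.1, slide n s p.2) ∈ F}
      diagonal_mem := ⟨_, P.diagonal_mem, by
        rintro s ⟨p, q⟩ (rfl : p = q); rfl⟩
      subset_mem := fun ⟨F, hF, h⟩ hs => ⟨F, hF, fun s p hp => h s p (hs hp)⟩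
      union_mem := fun ⟨F, hF, h⟩ ⟨F', hF', h'⟩ => ⟨_, P.union_mem hF hF', fun s p hp =>
        hp.imp (h s p) (h' s p)⟩
      inv_mem := fun ⟨F, hF, h⟩ => ⟨_, P.inv_mem hF, fun s p hp => h s (p.2, p.1) hp⟩
      comp_mem := fun ⟨F, hF, h⟩ ⟨F', hF', h'⟩ => ⟨_, P.comp_mem hF hF', by
        rintro s p ⟨q, hq, hq'⟩
        exact ⟨_, h s (p.1, q) hq, h' s (q, p.2) hq'⟩⟩ }
  refine hE D ?_
  have hV : {p : (X × Interval) × X × Interval |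
      p.1.1 = p.2.1 ∧ (p.1.2, p.2.2) ∈ dyadicFamily n p.1.1} ∈ P.entourages :=
    mem_warped_of_mem C _
  rintro W (⟨E, hE, rfl⟩ | rfl)
  · have hEP : {p : (X × Interval) × (X × Interval) | (p.1.1, p.2.1) ∈ E ∧ p.1.2 = p.2.2}
        ∈ P.entourages := mem_generate (Or.inl ⟨_, hE, rfl⟩)
    refine ⟨_, P.union_mem (P.comp_mem hV hEP) (P.comp_mem hEP hV), ?_⟩
    rintro s ⟨⟨x, u⟩, ⟨y, v⟩⟩ ⟨hxy, (rfl : u = v)⟩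
    have hpow : ∀ {a b : ℕ}, a ≤ b → (2⁻¹ : ℝ) ^ b ≤ 2⁻¹ ^ a := fun h =>
      pow_le_pow_of_le_one (by norm_num) (by norm_num) h
    have hx1 := dyadicFloor_le (n x) s
    have hx2 := lt_dyadicFloor_add (n x) s
    have hy1 := dyadicFloor_le (n y) s
    have hy2 := lt_dyadicFloor_add (n y) s
    rcases le_total (n x) (n y) with h | h
    · refine Or.inl ⟨(x, max u (dyadicFloor (n y) s)), ⟨rfl, ?_⟩, ⟨hxy, rfl⟩⟩
      have := hpow h
      have key : |(dyadicFloor (n x) s : ℝ) - dyadicFloor (n y) s| ≤ 2⁻¹ ^ n x :=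
        abs_le.2 ⟨by linarith, by linarith⟩
      exact (abs_max_sub_max_left _ _ _).trans key
    · refine Or.inr ⟨(y, max u (dyadicFloor (n x) s)), ⟨hxy, rfl⟩, ⟨rfl, ?_⟩⟩
      have := hpow h
      have key : |(dyadicFloor (n x) s : ℝ) - dyadicFloor (n y) s| ≤ 2⁻¹ ^ n y :=
        abs_le.2 ⟨by linarith, by linarith⟩
      exact (abs_max_sub_max_left _ _ _).trans key
  · refine ⟨_, hV, ?_⟩
    rintro s ⟨⟨x, u⟩, ⟨y, v⟩⟩ ⟨(rfl : x = y), huv⟩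
    refine ⟨rfl, ?_⟩
    have h := abs_max_sub_max_left (dyadicFloor (n x) s) u v
    rw [max_comm _ u, max_comm _ v] at h
    exact h.trans huv

/-- A point over `x` moves by at most `2⁻ⁿ⁽ˣ⁾` in each step of a subdivision that is fine enough. -/
lemma slide_step (n : X → ℕ) {N j : ℕ} (hj : j < 2 ^ (N + 1)) {p : X × Interval}
    (hp : n p.1 ≤ N) :
    dist (slide n (dyadicTime N j) p).2 (slide n (dyadicTime N (j + 1)) p).2 ≤
      (2⁻¹ : ℝ) ^ n p.1 := by
  refine (abs_max_sub_max_left _ _ _).trans ?_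
  have h2 : (2⁻¹ : ℝ) ^ N ≤ 2⁻¹ ^ n p.1 :=
    pow_le_pow_of_le_one (by norm_num) (by norm_num) hp
  have h3 : ((j + 1 : ℕ) : ℝ) / 2 ^ N = j / 2 ^ N + 2⁻¹ ^ N := by
    rw [inv_pow]; push_cast; field_simp
  have h0 : (0 : ℝ) < 2⁻¹ ^ N := by positivity
  refine abs_dyadicFloor_sub_le _ ?_ ?_ <;>
    rw [coe_dyadicTime hj.le, coe_dyadicTime hj, h3] <;> linarith

end Slide

/-! ### Contracting the cylinder onto its top -/

section SlideHomotopy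

variable {X Y M : Type*} [AddCommGroup M]

lemma prism_congr {u v u' v' : Y → X} {k : ℕ} (φ : (Fin (k + 2) → X) → M) {y : Fin (k + 1) → Y}
    (hu : ∀ i, u (y i) = u' (y i)) (hv : ∀ i, v (y i) = v' (y i)) :
    prism M u v k φ y = prism M u' v' k φ y := by
  have e : ∀ i, prismTuple u v i y = prismTuple u' v' i y := fun i => by
    ext j
    simp only [prismTuple, hu, hv]
  simp only [prism_apply, e]

/-- The homotopy from the identity to the projection to the top of the cylinder, computed with
`2^(N+1)` steps. In each step the degenerate part of the prism operator is removed, so that the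
steps at which a tuple does not move contribute nothing. -/
noncomputable def slideSum (M : Type*) [AddCommGroup M] (n : X → ℕ) (N k : ℕ) :
    ((Fin (k + 2) → X × Interval) → M) →+ ((Fin (k + 1) → X × Interval) → M) :=
  ∑ j ∈ range (2 ^ (N + 1)),
    (prism M (slide n (dyadicTime N j)) (slide n (dyadicTime N (j + 1))) k -
      prism M (slide n (dyadicTime N j)) (slide n (dyadicTime N j)) k)

lemma slideSum_apply (n : X → ℕ) (N k : ℕ) (φ : (Fin (k + 2) → X × Interval) → M)
    (y : Fin (k + 1) → X × Interval) :
    slideSum M n N k φ y = ∑ j ∈ range (2 ^ (N + 1)),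
      (prism M (slide n (dyadicTime N j)) (slide n (dyadicTime N (j + 1))) k φ y -
        prism M (slide n (dyadicTime N j)) (slide n (dyadicTime N j)) k φ y) := by
  simp [slideSum, AddMonoidHom.finsetSum_apply]

lemma slide_congr {n : X → ℕ} {s s' : Interval} {p : X × Interval}
    (h : dyadicFloor (n p.1) s = dyadicFloor (n p.1) s') : slide n s p = slide n s' p := by
  simp only [slide, h]

lemma slideSum_succ {n : X → ℕ} {N k : ℕ} (φ : (Fin (k + 2) → X × Interval) → M)
    {y : Fin (k + 1) → X × Interval} (hy : ∀ i, n (y i).1 ≤ N) :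
    slideSum M n (N + 1) k φ y = slideSum M n N k φ y := by
  have hsum : ∀ (g : ℕ → M) (K : ℕ), ∑ j ∈ range (2 * K), g j =
      ∑ j ∈ range K, (g (2 * j) + g (2 * j + 1)) := by
    intro g K
    induction K with
    | zero => simp
    | succ K ih =>
      rw [show 2 * (K + 1) = 2 * K + 1 + 1 by ring, sum_range_succ, sum_range_succ, ih,
        sum_range_succ, add_assoc]
  rw [slideSum_apply, slideSum_apply, pow_succ', hsum]
  refine sum_congr rfl fun j hj => ?_
  have hj := mem_range.1 hj
  have e : ∀ i, slide n (dyadicTime (N + 1) (2 * j + 1)) (y i) = slide n (dyadicTime N j) (y i) :=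
    fun i => slide_congr (dyadicFloor_dyadicTime_odd (hy i) hj)
  rw [show 2 * j + 1 + 1 = 2 * (j + 1) by ring, dyadicTime_two_mul, dyadicTime_two_mul,
    prism_congr φ (fun _ => rfl) e, sub_self, zero_add, prism_congr φ e (fun _ => rfl),
    prism_congr φ e e]

lemma slideSum_eq {n : X → ℕ} {N N' k : ℕ} (hN : N ≤ N') (φ : (Fin (k + 2) → X × Interval) → M)
    {y : Fin (k + 1) → X × Interval} (hy : ∀ i, n (y i).1 ≤ N) :
    slideSum M n N' k φ y = slideSum M n N k φ y := by
  induction N', hN using Nat.le_induction with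
  | base => rfl
  | succ N' h ih => rw [slideSum_succ φ fun i => (hy i).trans h, ih]

/-- The homotopy from the identity to the projection to the top of the cylinder. On each tuple it is
computed with the finest subdivision needed by its vertices; all finer ones give the same. -/
noncomputable def slideHomotopy (M : Type*) [AddCommGroup M] (n : X → ℕ) (k : ℕ) :
    ((Fin (k + 2) → X × Interval) → M) →+ ((Fin (k + 1) → X × Interval) → M) where
  toFun φ := fun y => slideSum M n (univ.sup fun i => n (y i).1) k φ y
  map_zero' := by ext; simp
  map_add' φ ψ := by ext; simp

lemma slideHomotopy_apply {n : X → ℕ} {N k : ℕ} (φ : (Fin (k + 2) → X × Interval) → M)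
    {y : Fin (k + 1) → X × Interval} (hy : ∀ i, n (y i).1 ≤ N) :
    slideHomotopy M n k φ y = slideSum M n N k φ y :=
  (slideSum_eq (Finset.sup_le fun i _ => hy i) φ
    fun i => Finset.le_sup (f := fun i => n (y i).1) (mem_univ i)).symm

lemma exists_level (n : X → ℕ) {k : ℕ} (y : Fin (k + 1) → X × Interval) :
    ∃ N, ∀ i, n (y i).1 ≤ N :=
  ⟨univ.sup fun i => n (y i).1, fun i => Finset.le_sup (f := fun i => n (y i).1) (mem_univ i)⟩

/-- The projection to the top of the cylinder. -/
def toTop (p : X × Interval) : X × Interval := (p.1, Interval.top)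

lemma sum_slide_telescope (n : X → ℕ) (N k : ℕ) (φ : (Fin (k + 1) → X × Interval) → M) :
    ∑ j ∈ range (2 ^ (N + 1)), (pullbackFun M (slide n (dyadicTime N (j + 1))) k φ -
      pullbackFun M (slide n (dyadicTime N j)) k φ) = pullbackFun M toTop k φ - φ := by
  rw [sum_range_sub fun j => pullbackFun M (slide n (dyadicTime N j)) k φ, dyadicTime_zero,
    dyadicTime_last, funext (slide_bot n), funext (slide_top n)]
  rfl

lemma slideHomotopy_coboundary_zero (n : X → ℕ) (φ : (Fin 1 → X × Interval) → M) :
    slideHomotopy M n 0 (coboundary _ M 0 φ) = pullbackFun M toTop 0 φ - φ := by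
  ext y
  obtain ⟨N, hN⟩ := exists_level n y
  rw [slideHomotopy_apply _ hN, slideSum_apply, ← sum_slide_telescope n N, Finset.sum_apply]
  refine sum_congr rfl fun j _ => ?_
  rw [prism_coboundary_zero, prism_coboundary_zero, sub_self, Pi.zero_apply, sub_zero]

lemma coboundary_slideHomotopy (n : X → ℕ) (k : ℕ) (φ : (Fin (k + 2) → X × Interval) → M) :
    slideHomotopy M n (k + 1) (coboundary _ M (k + 1) φ) +
      coboundary _ M k (slideHomotopy M n k φ) = pullbackFun M toTop (k + 1) φ - φ := by
  ext y
  obtain ⟨N, hN⟩ := exists_level n y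
  have e : coboundary _ M k (slideHomotopy M n k φ) y = coboundary _ M k (slideSum M n N k φ) y :=
    coboundary_congr (S := {p : X × Interval | n p.1 ≤ N}) (fun z hz => slideHomotopy_apply φ hz) hN
  rw [Pi.add_apply, e, slideHomotopy_apply _ hN, ← sum_slide_telescope n N, ← Pi.add_apply]
  simp only [slideSum, AddMonoidHom.finsetSum_apply, map_sum, ← sum_add_distrib]
  refine congrFun (sum_congr rfl fun j _ => ?_) y
  rw [AddMonoidHom.sub_apply, AddMonoidHom.sub_apply, map_sub, sub_add_sub_comm,
    coboundary_prism, coboundary_prism, sub_self, sub_zero]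

lemma VanishesOn.slideHomotopy {n : X → ℕ} {k : ℕ} {φ : (Fin (k + 2) → X × Interval) → M}
    {S : Set (X × Interval)} (h : VanishesOn φ S) (hS : ∀ s, Set.MapsTo (slide n s) S S) :
    VanishesOn (slideHomotopy M n k φ) S := by
  intro y hy
  obtain ⟨N, hN⟩ := exists_level n y
  rw [slideHomotopy_apply _ hN, slideSum_apply]
  refine sum_eq_zero fun j _ => ?_
  rw [h.prism (hS _) (hS _) y hy, h.prism (hS _) (hS _) y hy, sub_zero]

/-- A tuple of diameter `E` is carried by each step of the homotopy to tuples of a diameter that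
depends on `E` only. As the slides preserve the fibres, the support stays bounded in the base, whatever
the number of steps. -/
lemma slideHomotopy_mem_cochains {C : CoarseStructure X} (hC : C.IsCoarselyConnected) {n : X → ℕ}
    {k : ℕ} {φ : (Fin (k + 2) → X × Interval) → M}
    (hφ : φ ∈ (C.warped (dyadicFamily n)).cochains (k + 1) M) :
    slideHomotopy M n k φ ∈ (C.warped (dyadicFamily n)).cochains k M := by
  have hn := isNbhdFamily_dyadicFamily n
  refine mem_cochains_warped hn fun E hE => ?_
  obtain ⟨F, hF, hEF⟩ := slide_controlled C n hE
  have hV := mem_warped_of_mem C (dyadicFamily n)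
  have hG := union_mem _ hF (union_mem _ (comp_mem _ hF hV) (comp_mem _ hV hF))
  obtain ⟨S, hS, hφS⟩ := supportedAlong_of_mem_cochains (hC.warped hn) hφ _ hG
  refine ⟨_, hS.image (C.warped_fst _), fun y hy hne => ⟨0, ?_⟩⟩
  obtain ⟨N, hN⟩ := exists_level n y
  rw [slideHomotopy_apply _ hN, slideSum_apply] at hne
  obtain ⟨j, hj, hne⟩ := exists_ne_zero_of_sum_ne_zero hne
  have hj := mem_range.1 hj
  have hstep : ∀ i, (slide n (dyadicTime N j) (y i), slide n (dyadicTime N (j + 1)) (y i)) ∈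
      {p : (X × Interval) × (X × Interval) |
        p.1.1 = p.2.1 ∧ (p.1.2, p.2.2) ∈ dyadicFamily n p.1.1} :=
    fun i => ⟨rfl, slide_step n hj (hN i)⟩
  have hstep' : ∀ i, (slide n (dyadicTime N (j + 1)) (y i), slide n (dyadicTime N j) (y i)) ∈
      {p : (X × Interval) × (X × Interval) |
        p.1.1 = p.2.1 ∧ (p.1.2, p.2.2) ∈ dyadicFamily n p.1.1} :=
    fun i => ⟨rfl, (dist_comm _ _).trans_le (slide_step n hj (hN i))⟩
  have hyF : ∀ s i i', (slide n s (y i), slide n s (y i')) ∈ F := fun s i i' =>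
    hEF s (y i, y i') (hy i i')
  have key : ∀ v : X × Interval → X × Interval, (∃ i, φ (prismTuple (slide n (dyadicTime N j)) v
      i y) ≠ 0) → (v = slide n (dyadicTime N (j + 1)) ∨ v = slide n (dyadicTime N j)) →
      (y 0).1 ∈ Prod.fst '' S := by
    rintro v ⟨i, hi⟩ hv
    have : prismTuple (slide n (dyadicTime N j)) v i y 0 ∈ S := by
      refine hφS _ ?_ hi 0
      rcases hv with rfl | rfl
      · exact prismTuple_rel i (fun a b => Or.inl (hyF _ a b))
          (fun a b => Or.inr (Or.inl ⟨_, hyF _ a b, hstep b⟩))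
          (fun a b => Or.inr (Or.inr ⟨_, hstep' a, hyF _ a b⟩))
          (fun a b => Or.inl (hyF _ a b))
      · exact prismTuple_rel i (fun a b => Or.inl (hyF _ a b)) (fun a b => Or.inl (hyF _ a b))
          (fun a b => Or.inl (hyF _ a b)) (fun a b => Or.inl (hyF _ a b))
    rw [prismTuple_zero] at this
    exact ⟨_, this, rfl⟩
  by_cases h : prism M (slide n (dyadicTime N j)) (slide n (dyadicTime N (j + 1))) k φ y = 0
  · rw [h, zero_sub, neg_ne_zero] at hne
    exact key _ (exists_prismTuple_ne_zero hne) (Or.inr rfl)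
  · exact key _ (exists_prismTuple_ne_zero h) (Or.inl rfl)

/-- A subset of the cylinder containing its top and stable under upward motion carries all of the
cohomology: relative cocycles are relative coboundaries. -/
lemma mem_coboundaries_warped {C : CoarseStructure X} (hC : C.IsCoarselyConnected) {n : X → ℕ}
    {S : Set (X × Interval)} (hS : ∀ s, Set.MapsTo (slide n s) S S)
    (hS' : ∀ p : X × Interval, toTop p ∈ S) {k : ℕ} {φ : (Fin (k + 1) → X × Interval) → M}
    (hφ : φ ∈ (C.warped (dyadicFamily n)).cocycles {S} k M) :
    φ ∈ (C.warped (dyadicFamily n)).coboundaries {S} k M := by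
  have hφ' := mem_relCochains_singleton.1 hφ.1
  have htop : pullbackFun M toTop k φ = 0 := funext fun y => hφ'.2 _ fun i => hS' (y i)
  cases k with
  | zero =>
    have h := slideHomotopy_coboundary_zero n φ
    rw [show coboundary _ M 0 φ = 0 from hφ.2, map_zero, htop, zero_sub] at h
    exact neg_eq_zero.1 h.symm
  | succ k =>
    have h := coboundary_slideHomotopy n k φ
    rw [show coboundary _ M (k + 1) φ = 0 from hφ.2, map_zero, htop, zero_sub, zero_add] at h
    refine ⟨-slideHomotopy M n k φ, neg_mem (mem_relCochains_singleton.2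
      ⟨slideHomotopy_mem_cochains hC hφ'.1, hφ'.2.slideHomotopy hS⟩), ?_⟩
    rw [map_neg, h, neg_neg]

/-- The locally constant function on the cylinder that jumps at `t = 0`. -/
noncomputable def negIndicator (p : X × Interval) : ℤ :=
  open Classical in if (p.2 : ℝ) < 0 then 1 else 0

/-- Multiplying a cocycle by a function of the first vertex. -/
lemma coboundary_smul (f : X → ℤ) {k : ℕ} {R : (Fin (k + 1) → X) → M}
    (hR : coboundary X M k R = 0) (q : Fin (k + 2) → X) :
    coboundary X M k (fun y => f (y 0) • R y) q =
      (f (q 1) - f (q 0)) • R (Fin.removeNth 0 q) := by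
  have h := congrFun hR q
  rw [coboundary_apply, Fin.sum_univ_succ] at h
  have h' := eq_neg_of_add_eq_zero_right h
  rw [coboundary_apply, Fin.sum_univ_succ]
  have e : ∀ i : Fin (k + 1), (Fin.removeNth i.succ q : Fin (k + 1) → X) 0 = q 0 := by
    intro i
    simp [Fin.removeNth]
  have e0 : (Fin.removeNth 0 q : Fin (k + 1) → X) 0 = q 1 := by
    simp [Fin.removeNth]
  simp only [e, e0]
  simp only [smul_comm _ (f (q 0)), ← Finset.smul_sum]
  rw [h']
  simp only [Fin.val_zero, pow_zero, one_smul, smul_neg]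
  rw [sub_smul, sub_eq_add_neg]

/-- Where `f ∘ u` and `f ∘ v` are constant, only the first simplex of the prism contributes: it is
the only one whose first edge joins the two ends of the prism. -/
lemma prism_jump {u v : Y → X} {f : X → ℤ} {k : ℕ} {R : (Fin (k + 1) → X) → M}
    (hR : coboundary X M k R = 0) {c d : ℤ} {y : Fin (k + 1) → Y} (hu : ∀ i, f (u (y i)) = c)
    (hv : ∀ i, f (v (y i)) = d) :
    prism M u v k (coboundary X M k fun y => f (y 0) • R y) y =
      (d - c) • pullbackFun M v k R y := by
  rw [prism_apply, Finset.sum_range_succ', Finset.sum_eq_zero, zero_add, pow_zero, one_smul,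
    coboundary_smul f hR]
  · have e0 : f (prismTuple u v 0 y 0) = c := by rw [prismTuple_zero, hu]
    have e1 : f (prismTuple u v 0 y 1) = d := by simp [prismTuple, hv]
    rw [e0, e1]
    congr 2
  · intro i _
    rw [coboundary_smul f hR]
    have e0 : f (prismTuple u v (i + 1) y 0) = c := by rw [prismTuple_zero, hu]
    have e1 : f (prismTuple u v (i + 1) y 1) = c := by simp [prismTuple, hu]
    rw [e0, e1, sub_self, zero_smul, smul_zero]

/-- The homotopy picks up the jump of `negIndicator` exactly when the sliding bottom of the cylinder
reaches its middle. -/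
lemma slideHomotopy_jump (n : X → ℕ) {k : ℕ} {R : (Fin (k + 1) → X × Interval) → M}
    (hR : coboundary _ M k R = 0) (x : Fin (k + 1) → X) :
    slideHomotopy M n k (coboundary _ M k fun y => negIndicator (y 0) • R y)
      (fun i => (x i, Interval.bot)) = - R fun i => (x i, ⟨0, by norm_num⟩) := by
  classical
  set y : Fin (k + 1) → X × Interval := fun i => (x i, Interval.bot) with hy
  obtain ⟨N, hN⟩ := exists_level n y
  have hslide : ∀ s i, slide n s (y i) = (x i, dyadicFloor (n (x i)) s) := by
    intro s i
    simp only [slide, hy]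
    rw [max_eq_right]
    exact (dyadicFloor (n (x i)) s).2.1
  have hf : ∀ s i, negIndicator (slide n s (y i)) = if (s : ℝ) < 0 then 1 else 0 := by
    intro s i
    rw [hslide]
    simp only [negIndicator, dyadicFloor_neg_iff]
  rw [slideHomotopy_apply _ hN, slideSum_apply]
  simp only [fun s s' => prism_jump hR (hf s) (hf s'), sub_self, zero_smul, sub_zero]
  have hneg : ∀ j ≤ 2 ^ (N + 1), ((dyadicTime N j : ℝ) < 0 ↔ j < 2 ^ N) := by
    intro j hj
    have h2 : (0 : ℝ) < 2 ^ N := by positivity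
    rw [coe_dyadicTime hj, neg_add_lt_iff_lt_add, add_zero, div_lt_one h2]
    exact_mod_cast Iff.rfl
  have hpos : 0 < 2 ^ N := by positivity
  rw [Finset.sum_eq_single (2 ^ N - 1)]
  · rw [if_neg, if_pos, zero_sub, neg_smul, one_smul]
    · refine congrArg (fun z => -R z) (funext fun i => ?_)
      rw [hslide]
      congr 1
      have h0 : dyadicTime N (2 ^ N - 1 + 1) = ⟨0, by norm_num⟩ := by
        apply Subtype.ext
        rw [Nat.sub_add_cancel hpos, coe_dyadicTime (by rw [pow_succ]; omega)]
        have h2 : (2 : ℝ) ^ N ≠ 0 := by positivity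
        push_cast
        field_simp
        norm_num
      rw [h0]
      exact dyadicFloor_eq_self (r := 0) _ (by simp)
    · rw [hneg _ (by rw [pow_succ]; omega)]; omega
    · rw [hneg _ (by rw [pow_succ]; omega)]; omega
  · intro j hj hne
    have hj := mem_range.1 hj
    have h : (dyadicTime N (j + 1) : ℝ) < 0 ↔ (dyadicTime N j : ℝ) < 0 := by
      rw [hneg _ hj, hneg _ hj.le]
      omega
    simp only [h, sub_self, zero_smul]
  · intro h
    exact absurd (mem_range.2 (by rw [pow_succ]; omega)) h

end SlideHomotopy

/-! ### The suspension isomorphism -/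

section Suspension

variable {X Y M : Type*} [AddCommGroup M]

lemma isCoarse_subtype_val (C : CoarseStructure X) (Z : Set X) :
    IsCoarse (C.subspace Z) C Subtype.val :=
  ⟨fun _ hE => hE, fun S hS => C.subset_mem hS (by
    rintro _ ⟨⟨x, y⟩, h, rfl⟩
    exact h)⟩

lemma pullbackFun_mem_coboundaries {C : CoarseStructure X} {D : CoarseStructure Y} {f : X → Y}
    (hf : IsCoarse C D f) {𝒜 : Set (Set X)} {ℬ : Set (Set Y)}
    (hAB : ∀ A ∈ 𝒜, ∃ B ∈ ℬ, Set.MapsTo f A B) {m : ℕ} {φ : (Fin (m + 1) → Y) → M}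
    (hφ : φ ∈ D.coboundaries ℬ m M) : pullbackFun M f m φ ∈ C.coboundaries 𝒜 m M := by
  cases m with
  | zero =>
    have h0 : φ = 0 := hφ
    rw [h0, map_zero]
    exact zero_mem _
  | succ m =>
    obtain ⟨α, hα, rfl⟩ := hφ
    exact ⟨pullbackFun M f m α, pullbackFun_mem_relCochains hf hAB hα, rfl⟩

lemma coboundaries_mono (C : CoarseStructure X) {𝒜 ℬ : Set (Set X)} {m : ℕ}
    (h : ∀ A ∈ 𝒜, ∃ B ∈ ℬ, A ⊆ B) : C.coboundaries ℬ m M ≤ C.coboundaries 𝒜 m M := fun _ hφ =>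
  pullbackFun_mem_coboundaries (isCoarse_id C) (f := id) h hφ

lemma Represents.unique {C : CoarseStructure X} {𝒜 : Set (Set X)} {m : ℕ}
    {φ : (Fin (m + 1) → X) → M} {c d : C.HX 𝒜 m M} (hc : Represents φ c)
    (hd : Represents φ d) : c = d :=
  (hc.eq_iff hd).2 (by rw [sub_self]; exact zero_mem _)

/-- Points of the warped product at distance more than `ε` in the interval can only be related by an
entourage if they lie over a penumbra of `A`. -/
lemma IsSuspensionFamily.exists_pen {C : CoarseStructure X} {A : Set X}
    {U : X → Set (Interval × Interval)} (hU : C.IsSuspensionFamily A U)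
    {F : Set ((X × Interval) × X × Interval)} (hF : F ∈ (C.warped U).entourages) {ε : ℝ}
    (hε : 0 < ε) : ∃ E ∈ C.entourages, ∀ p ∈ F, ε < dist p.1.2 p.2.2 → p.1.1 ∈ pen E A := by
  -- The sets with this property, for all `ε` at once, form a coarse structure, so that generators
  -- suffice.
  let D : CoarseStructure (X × Interval) :=
    { entourages := {F | Prod.map Prod.fst Prod.fst '' F ∈ C.entourages ∧ ∀ ε > 0,
        ∃ E ∈ C.entourages, ∀ p ∈ F, ε < dist p.1.2 p.2.2 → p.1.1 ∈ pen E A}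
      diagonal_mem := ⟨(C.comap Prod.fst).diagonal_mem, fun ε hε => ⟨_, C.diagonal_mem, by
        rintro ⟨p, q⟩ (rfl : p = q) h
        rw [dist_self] at h
        exact absurd h hε.not_gt⟩⟩
      subset_mem := fun h hs => ⟨(C.comap Prod.fst).subset_mem h.1 hs, fun ε hε =>
        (h.2 ε hε).imp fun E hE => ⟨hE.1, fun p hp => hE.2 p (hs hp)⟩⟩
      union_mem := fun h h' => ⟨(C.comap Prod.fst).union_mem h.1 h'.1, fun ε hε => by
        obtain ⟨E, hE, h1⟩ := h.2 ε hε
        obtain ⟨E', hE', h2⟩ := h'.2 ε hε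
        exact ⟨_, C.union_mem hE hE', fun p hp hd => hp.elim
          (fun hp => subset_pen Set.subset_union_left A (h1 p hp hd))
          (fun hp => subset_pen Set.subset_union_right A (h2 p hp hd))⟩⟩
      inv_mem := fun h => ⟨(C.comap Prod.fst).inv_mem h.1, fun ε hε => by
        obtain ⟨E, hE, h1⟩ := h.2 ε hε
        refine ⟨_, C.comp_mem (C.inv_mem h.1) hE, fun p hp hd => ?_⟩
        obtain ⟨a, ha, hpa⟩ := h1 (p.2, p.1) hp (by rwa [dist_comm])
        exact ⟨a, ha, p.2.1, ⟨_, hp, rfl⟩, hpa⟩⟩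
      comp_mem := fun h h' => ⟨(C.comap Prod.fst).comp_mem h.1 h'.1, fun ε hε => by
        obtain ⟨E, hE, h1⟩ := h.2 (ε / 2) (by positivity)
        obtain ⟨E', hE', h2⟩ := h'.2 (ε / 2) (by positivity)
        refine ⟨_, C.union_mem hE (C.comp_mem h.1 hE'), ?_⟩
        rintro p ⟨q, hq, hq'⟩ hd
        by_cases hc : ε / 2 < dist p.1.2 q.2
        · exact subset_pen Set.subset_union_left A (h1 (p.1, q) hq hc)
        · have hd' : ε / 2 < dist q.2 p.2.2 := by
            have := dist_triangle p.1.2 q.2 p.2.2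
            linarith
          obtain ⟨a, ha, hqa⟩ := h2 (q, p.2) hq' hd'
          exact ⟨a, ha, Or.inr ⟨q.1, ⟨_, hq, rfl⟩, hqa⟩⟩⟩ }
  refine (hF D ?_).2 ε hε
  rintro W (⟨E, hE, rfl⟩ | rfl)
  · refine ⟨C.subset_mem hE (by rintro _ ⟨p, hp, rfl⟩; exact hp.1), fun ε hε =>
      ⟨_, C.diagonal_mem, fun p hp hd => ?_⟩⟩
    rw [hp.2, dist_self] at hd
    exact absurd hd hε.not_gt
  · refine ⟨C.subset_mem C.diagonal_mem (by rintro _ ⟨p, hp, rfl⟩; exact hp.1), fun ε hε => ?_⟩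
    obtain ⟨E, hE, h⟩ := hU.2 ε hε
    refine ⟨E, hE, fun p hp hd => ?_⟩
    by_contra hx
    exact absurd hd (h _ hx _ hp.2).not_gt

lemma dist_bot_top : dist Interval.bot Interval.top = 2 := by
  rw [Subtype.dist_eq, Real.dist_eq]
  simp only [Interval.bot, Interval.top]
  norm_num

lemma bot_ne_top : Interval.bot ≠ Interval.top := by
  intro h
  have := dist_bot_top
  rw [h, dist_self] at this
  norm_num at this

/-- The bottom `X × {-1}` of `X × ∂I ∪ A × I`. -/
def suspBottom (A : Set X) : Set (suspBase A) := {z | z.1.2 = Interval.bot}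

lemma suspBottom_union (A : Set X) : suspBottom A ∪ within (suspBase A) (suspTop A) = Set.univ :=
  Set.eq_univ_of_forall fun z => z.2

/-- The bottom of `X × ∂I ∪ A × I` and the rest of it form an excisive triad, although the top and the
bottom are disjoint: points of the top are close to the bottom over penumbras of `A` only, and
there `A × {-1}` is close. -/
lemma exists_isExcisionMap_suspBase {C : CoarseStructure X} (hcount : C.IsCountablyGenerated)
    {A : Set X} (hA : A.Nonempty) {U : X → Set (Interval × Interval)}
    (hU : C.IsSuspensionFamily A U) :
    ∃ π, ((C.warped U).subspace (suspBase A)).IsExcisionMap (suspBottom A)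
      (within (suspBase A) (suspTop A)) π := by
  obtain ⟨ρ, hρ, hclose⟩ := hcount.exists_nearest hA
  refine ⟨fun z => ⟨(ρ z.1.1, Interval.bot), Or.inl rfl⟩,
    fun z _ => ⟨rfl, Or.inr (hρ _)⟩, fun E hE => ?_⟩
  set P := C.warped U with hP
  have lift : ∀ {E}, E ∈ C.entourages →
      {p : (X × Interval) × (X × Interval) | (p.1.1, p.2.1) ∈ E ∧ p.1.2 = p.2.2} ∈ P.entourages :=
    fun hE => mem_generate (Or.inl ⟨_, hE, rfl⟩)
  have hE' : Prod.map Subtype.val Subtype.val '' E ∈ P.entourages := hE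
  have hE₁ := C.warped_fst U _ hE'
  have hF₁ := P.comp_mem hE' (lift (C.inv_mem hE₁))
  obtain ⟨G, hG, hGA⟩ := hU.exists_pen (P.comp_mem (P.inv_mem hF₁) hE') one_pos
  obtain ⟨H, hH, hGH⟩ := hclose _ (C.union_mem hE₁ hG)
  have hF₂ := P.comp_mem hF₁ (lift hH)
  refine ⟨Prod.map Subtype.val Subtype.val ⁻¹' _,
    P.subset_mem hF₂ (Set.image_preimage_subset _ _), ?_⟩
  rintro ⟨⟨x, t⟩, hz⟩ ⟨⟨⟨⟨x', t'⟩, hb⟩, (rfl : t' = Interval.bot), hzb⟩, ⟨⟨⟨x'', s⟩, hw⟩, hw', hzw⟩⟩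
  have h1 : ((x, t), (x', Interval.bot)) ∈ Prod.map Subtype.val Subtype.val '' E := ⟨_, hzb, rfl⟩
  have h2 : ((x, t), (x'', s)) ∈ Prod.map Subtype.val Subtype.val '' E := ⟨_, hzw, rfl⟩
  have h3 : ((x, t), (x, Interval.bot)) ∈
      {p | ∃ y, (p.1, y) ∈ Prod.map Subtype.val Subtype.val '' E ∧ (y, p.2) ∈
        {p : (X × Interval) × (X × Interval) | (p.1.1, p.2.1) ∈ {p : X × X | (p.2, p.1) ∈
          Prod.map Prod.fst Prod.fst '' (Prod.map Subtype.val Subtype.val '' E)} ∧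
            p.1.2 = p.2.2}} :=
    ⟨_, h1, ⟨_, h1, rfl⟩, rfl⟩
  refine ⟨(x, Interval.bot), h3, hGH x ?_, rfl⟩
  rcases hw' with (hs : s = Interval.top) | (hs : x'' ∈ A)
  · subst hs
    refine subset_pen Set.subset_union_right A
      (hGA ((x, Interval.bot), (x'', Interval.top)) ⟨_, h3, h2⟩ ?_)
    rw [dist_bot_top]
    norm_num
  · exact ⟨x'', hs, Or.inl ⟨_, h2, rfl⟩⟩

open Classical in
/-- The extension by zero of a cochain on `X ≅ X × {-1}` to `X × ∂I ∪ A × I`. -/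
noncomputable def extendBottom (A : Set X) {k : ℕ} (ζ : (Fin (k + 1) → X) → M)
    (y : Fin (k + 1) → suspBase A) : M :=
  if ∀ i, y i ∈ suspBottom A then ζ (fun i => (y i).1.1) else 0

lemma extendBottom_mem_relCochains {C : CoarseStructure X} (hC : C.IsCoarselyConnected) {A : Set X}
    {U : X → Set (Interval × Interval)} (hU : IsNbhdFamily U) {k : ℕ}
    {ζ : (Fin (k + 1) → X) → M} (hζ : ζ ∈ C.relCochains {A} k M) :
    extendBottom A ζ ∈
      ((C.warped U).subspace (suspBase A)).relCochains {within (suspBase A) (suspTop A)} k M := by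
  rw [mem_relCochains_singleton] at hζ ⊢
  refine ⟨mem_cochains_of_supportedAlong fun E hE => ?_, fun y hy => ?_⟩
  · obtain ⟨B, hB, h⟩ := supportedAlong_of_mem_cochains hC hζ.1 _ (C.warped_fst U _ hE)
    refine ⟨_, (isCoarse_subtype_val _ _).proper _ (C.isBounded_cylinder hU hB),
      fun y hy hne => ?_⟩
    have hb : ∀ i, y i ∈ suspBottom A := by
      by_contra h
      exact hne (if_neg h)
    exact h (fun i => (y i).1.1) (fun i j => ⟨_, ⟨_, hy i j, rfl⟩, rfl⟩)
      (by rwa [extendBottom, if_pos hb] at hne)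
  · by_cases hb : ∀ i, y i ∈ suspBottom A
    · rw [extendBottom, if_pos hb]
      refine hζ.2 _ fun i => ?_
      rcases hy i with (h : (y i).1.2 = Interval.top) | h
      · exact absurd ((hb i).symm.trans h) bot_ne_top
      · exact h
    · exact if_neg hb

lemma exists_bottomIncl {A : Set X} {k : ℕ} {y : Fin (k + 1) → suspBase A}
    (hy : ∀ i, y i ∈ suspBottom A) : y = fun i => bottomIncl A (y i).1.1 :=
  funext fun i => Subtype.ext (Prod.ext rfl (hy i))

lemma coboundary_extendBottom {A : Set X} {k : ℕ} (ζ : (Fin (k + 1) → X) → M)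
    (x : Fin (k + 2) → X) :
    coboundary _ M k (extendBottom A ζ) (fun i => bottomIncl A (x i)) = coboundary _ M k ζ x := by
  simp only [coboundary_apply]
  refine sum_congr rfl fun i _ => ?_
  congr 1
  exact if_pos fun i => rfl

/-- `x ↦ (x, -1)` induces an isomorphism: excision of `X × {1} ∪ A × I`. -/
lemma bottomMap_bijective {C : CoarseStructure X} (hC : C.IsCoarselyConnected)
    (hcount : C.IsCountablyGenerated) {A : Set X} (hA : A.Nonempty)
    {U : X → Set (Interval × Interval)} (hU : C.IsSuspensionFamily A U) (k : ℕ) (M : Type*)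
    [AddCommGroup M] : Function.Bijective (C.bottomMap A U k M) := by
  obtain ⟨π, hπ⟩ := exists_isExcisionMap_suspBase hcount hA hU
  set Q := (C.warped U).subspace (suspBase A) with hQ
  have hQc : Q.IsCoarselyConnected := (hC.warped hU.1).subspace _
  -- The bottom and the relative part cover everything, so excision kills all relative cocycles.
  have key : ∀ {k : ℕ} {φ : (Fin (k + 1) → suspBase A) → M},
      φ ∈ Q.relCochains {suspBottom A, within (suspBase A) (suspTop A)} k M →
      coboundary _ M k φ = 0 →
      φ ∈ Q.coboundaries {suspBottom A, within (suspBase A) (suspTop A)} k M := by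
    intro k φ hφ hδ
    obtain ⟨κ, hκ, h⟩ := hπ.exists_sub_mem_relCochains hQc hφ (by rw [hδ]; exact fun _ _ => rfl)
    rw [suspBottom_union, mem_relCochains_singleton] at h
    have h0 : φ - κ = 0 := funext fun y => h.2 y fun _ => trivial
    rwa [sub_eq_zero.1 h0]
  have hmono : ∀ {k : ℕ}, Q.coboundaries {suspBottom A, within (suspBase A) (suspTop A)} k M ≤
      Q.coboundaries {within (suspBase A) (suspTop A)} k M :=
    @fun k => coboundaries_mono Q (by rintro _ rfl; exact ⟨_, Or.inr rfl, subset_rfl⟩)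
  constructor
  · rw [injective_iff_map_eq_zero]
    intro c hc
    obtain ⟨φ, hφ⟩ := exists_represents c
    have h0 : Represents (0 : (Fin (k + 1) → X) → M) (0 : C.HX {A} k M) := ⟨zero_mem _, rfl⟩
    have h0' : Represents (0 : (Fin (k + 1) → suspBase A) → M)
      (0 : Q.HX {within (suspBase A) (suspTop A)} k M) := ⟨zero_mem _, rfl⟩
    have h := (h0.eq_iff hφ.map).1 hc.symm
    refine Eq.symm ((h0'.eq_iff hφ).2 ?_)
    rw [sub_zero] at h ⊢
    have hφ' := mem_relCochains_singleton.1 hφ.mem.1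
    have hδφ : coboundary _ M k φ = 0 := hφ.mem.2
    cases k with
    | zero =>
      have h : pullbackFun M (bottomIncl A) 0 φ = 0 := h
      refine hmono (key (mem_relCochains_pair.2 ⟨hφ'.1, fun y hy => ?_, hφ'.2⟩) hδφ)
      rw [exists_bottomIncl hy]
      exact congrFun h _
    | succ k =>
      obtain ⟨ζ, hζ, h⟩ := h
      have hext := extendBottom_mem_relCochains hC hU.1 hζ
      have hext' := mem_relCochains_singleton.1 (coboundary_mem_relCochains hext)
      rw [← sub_add_cancel φ (coboundary _ M k (extendBottom A ζ))]
      refine add_mem (hmono (key (mem_relCochains_pair.2 ⟨sub_mem hφ'.1 hext'.1, fun y hy => ?_,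
        hφ'.2.sub hext'.2⟩) ?_)) ⟨_, hext, rfl⟩
      · rw [exists_bottomIncl hy, Pi.sub_apply, coboundary_extendBottom, h]
        exact sub_self _
      · rw [map_sub, hδφ, coboundary_coboundary, sub_zero]
  · intro c
    obtain ⟨ζ, hζ⟩ := exists_represents c
    have hext := extendBottom_mem_relCochains hC hU.1 hζ.mem.1
    have hext' := mem_relCochains_singleton.1 (coboundary_mem_relCochains hext)
    have hδζ : coboundary _ M k ζ = 0 := hζ.mem.2
    obtain ⟨α, hα, hδα⟩ := key (k := k + 1) (mem_relCochains_pair.2 ⟨hext'.1, fun y hy => by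
      rw [exists_bottomIncl hy, coboundary_extendBottom, hδζ]; rfl, hext'.2⟩)
      (coboundary_coboundary _)
    have hα' := mem_relCochains_pair.1 hα
    have hmem : extendBottom A ζ - α ∈ Q.cocycles {within (suspBase A) (suspTop A)} k M := by
      refine ⟨(Q.relCochains _ k M).sub_mem hext (mem_relCochains_singleton.2 ⟨hα'.1, hα'.2.2⟩), ?_⟩
      change coboundary _ M k (_ - α) = 0
      rw [map_sub, hδα, sub_self]
    obtain ⟨d, hd⟩ := exists_class hmem
    refine ⟨d, Represents.unique (φ := ζ) ?_ hζ⟩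
    have e : pullbackFun M (bottomIncl A) k (extendBottom A ζ - α) = ζ := by
      ext x
      have h1 : α (fun i => bottomIncl A (x i)) = 0 := hα'.2.1 _ fun i => rfl
      have h2 : extendBottom A ζ (fun i => bottomIncl A (x i)) = ζ x := if_pos fun i => rfl
      change extendBottom A ζ (fun i => bottomIncl A (x i)) - α _ = ζ x
      rw [h1, h2, sub_zero]
    rw [← e]
    exact hd.map

/-- For a dyadic family the connecting homomorphism is an isomorphism, because the third term
of the long exact sequence of the triple, the cohomology relative to the top, vanishes. -/
lemma suspConnecting_bijective {C : CoarseStructure X} (hC : C.IsCoarselyConnected) (A : Set X)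
    (n : X → ℕ) (k : ℕ) (M : Type*) [AddCommGroup M] :
    Function.Bijective (C.suspConnecting A (dyadicFamily n) k M) := by
  set P := C.warped (dyadicFamily n) with hP
  have hslide : ∀ s, Set.MapsTo (slide n s) (suspTop A) (suspTop A) := by
    rintro s ⟨x, t⟩ ((h : t = Interval.top) | h)
    · refine Or.inl ?_
      subst h
      exact max_eq_left (dyadicFloor (n x) s).2.2
    · exact Or.inr h
  have htop : ∀ p : X × Interval, toTop p ∈ suspTop A := fun p => Or.inl rfl
  have key : ∀ {k : ℕ} {φ : (Fin (k + 1) → X × Interval) → M}, φ ∈ P.cocycles {suspTop A} k M →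
      φ ∈ P.coboundaries {suspTop A} k M := fun hφ => mem_coboundaries_warped hC hslide htop hφ
  have hval : ∀ B ∈ ({within (suspBase A) (suspTop A)} : Set (Set (suspBase A))),
      ∃ B' ∈ ({suspTop A} : Set (Set (X × Interval))), Set.MapsTo Subtype.val B B' := by
    rintro _ rfl
    exact ⟨_, rfl, fun z hz => hz⟩
  have hres : ∀ {k : ℕ} (φ : (Fin (k + 1) → suspBase A) → M),
      pullbackFun M Subtype.val k (extendZero (suspBase A) k M φ) = φ := fun φ =>
    funext fun y => extendZero_apply φ y
  constructor
  · rw [injective_iff_map_eq_zero]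
    intro c hc
    obtain ⟨φ, hφ⟩ := exists_represents c
    have h0 : Represents (0 : (Fin (k + 2) → X × Interval) → M)
      (0 : P.HX {suspBase A} (k + 1) M) := ⟨zero_mem _, rfl⟩
    have h0' : Represents (0 : (Fin (k + 1) → suspBase A) → M)
      (0 : (P.subspace (suspBase A)).HX {within (suspBase A) (suspTop A)} k M) :=
      ⟨zero_mem _, rfl⟩
    have h := (h0.eq_iff (represents_connecting (suspTop_subset A) hφ)).1 hc.symm
    refine Eq.symm ((h0'.eq_iff hφ).2 ?_)
    rw [sub_zero] at h ⊢
    obtain ⟨η, hη, h⟩ := h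
    have hη' := mem_relCochains_singleton.1 hη
    have hext := mem_relCochains_singleton.1 (extendZero_mem_relCochains hφ.mem.1)
    have h1 := pullbackFun_mem_coboundaries (isCoarse_subtype_val P (suspBase A)) hval
      (key (φ := extendZero (suspBase A) k M φ - η) ⟨mem_relCochains_singleton.2
        ⟨sub_mem hext.1 hη'.1, hext.2.sub (hη'.2.mono (suspTop_subset A))⟩, by
        change coboundary _ M k (_ - η) = 0
        rw [map_sub, h, sub_self]⟩)
    have h2 : pullbackFun M (Subtype.val : suspBase A → X × Interval) k η = 0 :=
      funext fun y => hη'.2 _ fun i => (y i).2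
    rwa [map_sub, hres, h2, sub_zero] at h1
  · intro c
    obtain ⟨ω, hω⟩ := exists_represents c
    have hω' := mem_relCochains_singleton.1 hω.mem.1
    obtain ⟨η, hη, hδη⟩ := key (k := k + 1) ⟨mem_relCochains_singleton.2
      ⟨hω'.1, hω'.2.mono (suspTop_subset A)⟩, hω.mem.2⟩
    have hmem : pullbackFun M Subtype.val k η ∈
        (P.subspace (suspBase A)).cocycles {within (suspBase A) (suspTop A)} k M := by
      refine ⟨pullbackFun_mem_relCochains (isCoarse_subtype_val P (suspBase A)) hval hη, ?_⟩
      change coboundary _ M k (pullbackFun M _ k η) = 0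
      rw [coboundary_pullbackFun, hδη]
      exact funext fun y => hω'.2 _ fun i => (y i).2
    obtain ⟨d, hd⟩ := exists_class hmem
    refine ⟨d, ((represents_connecting (suspTop_subset A) hd).eq_iff hω).2 ?_⟩
    have hext := extendZero_mem_relCochains (C := P) (W := suspTop A) hmem.1
    refine ⟨η - extendZero (suspBase A) k M (pullbackFun M Subtype.val k η),
      mem_relCochains_singleton.2 ⟨sub_mem hη.1 hext.1, fun y hy => ?_⟩, by rw [map_sub, hδη]⟩
    have := congrFun (hres (pullbackFun M (Subtype.val : suspBase A → X × Interval) k η))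
      fun i => ⟨y i, hy i⟩
    exact sub_eq_zero.2 this.symm

lemma exists_suspension {C : CoarseStructure X} (hC : C.IsCoarselyConnected)
    (hcount : C.IsCountablyGenerated) {A : Set X} (hA : A.Nonempty)
    {U : X → Set (Interval × Interval)} (hU : C.IsSuspensionFamily A U) {k : ℕ}
    (w : (C.warped U).HX {suspBase A} (k + 1) M) : ∃ z, C.IsSuspension A U k w z := by
  obtain ⟨n, hn⟩ := hU.1.exists_dyadicFamily
  have hV := hU.mono (isNbhdFamily_dyadicFamily n) hn
  have hbij := suspConnecting_bijective hC A n k M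
  obtain ⟨c, hc⟩ := hbij.2 (C.refineMap A hV.1 hn (k + 1) M w)
  exact ⟨_, _, hV, hn, bottomMap_bijective hC hcount hA hV k M, hbij, c, rfl, hc⟩

lemma isCoarse_refine_subspace (C : CoarseStructure X) {U V : X → Set (Interval × Interval)}
    (hV : IsNbhdFamily V) (h : ∀ x, V x ⊆ U x) (Z : Set (X × Interval)) :
    IsCoarse ((C.warped V).subspace Z) ((C.warped U).subspace Z) id := by
  refine ⟨fun E hE => ?_, fun S hS => ?_⟩
  · rw [Prod.map_id, Set.image_id]
    have := C.warped_mono h _ hE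
    rwa [Prod.map_id, Set.image_id] at this
  · have h1 := (C.isCoarse_refine hV h).proper _
      (hS.image (isCoarse_subtype_val (C.warped U) Z).controlled)
    exact ((isCoarse_subtype_val (C.warped V) Z).proper _ h1).mono fun z hz => ⟨z, hz, rfl⟩

/-- A suspension may be computed with any finer family. -/
lemma IsSuspension.exists_refine {C : CoarseStructure X} {A : Set X}
    {U : X → Set (Interval × Interval)} {k : ℕ} {w : (C.warped U).HX {suspBase A} (k + 1) M}
    {z : C.HX {A} k M} (h : C.IsSuspension A U k w z) : ∃ V : X → Set (Interval × Interval),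
      IsNbhdFamily V ∧ ∀ (V' : X → Set (Interval × Interval)) (hV' : IsNbhdFamily V')
        (hU : ∀ x, V' x ⊆ U x), (∀ x, V' x ⊆ V x) → ∃ c, C.bottomMap A V' k M c = z ∧
          C.suspConnecting A V' k M c = C.refineMap A hV' hU (k + 1) M w := by
  obtain ⟨V, hV, hVU, -, -, c, rfl, hc⟩ := h
  refine ⟨V, hV.1, fun V' hV' hU hVV' => ?_⟩
  have hco := C.isCoarse_refine_subspace hV' hVV' (suspBase A)
  have hid : ∀ {T : Type _} (𝒜 : Set (Set T)), ∀ A ∈ 𝒜, ∃ B ∈ 𝒜, Set.MapsTo id A B :=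
    fun 𝒜 A hA => ⟨A, hA, fun x hx => hx⟩
  obtain ⟨φ, hφ⟩ := exists_represents c
  obtain ⟨ω, hω⟩ := exists_represents w
  have hφ' : Represents φ (HX.map id hco (hid _) k M c) :=
    show Represents (pullbackFun M id k φ) _ from hφ.map
  refine ⟨HX.map id hco (hid _) k M c, ?_, ?_⟩
  · exact hφ'.map.unique hφ.map
  · have h1 : Represents ω (C.refineMap A hV.1 hVU (k + 1) M w) :=
      show Represents (pullbackFun M id (k + 1) ω) _ from hω.map
    have h2 : Represents ω (C.refineMap A hV' hU (k + 1) M w) :=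
      show Represents (pullbackFun M id (k + 1) ω) _ from hω.map
    have h3 := ((represents_connecting (suspTop_subset A) hφ).eq_iff h1).1 hc
    exact ((represents_connecting (suspTop_subset A) hφ').eq_iff h2).2
      (pullbackFun_mem_coboundaries (C.isCoarse_refine hV' hVV') (hid _) h3)

end Suspension

/-! ### Cross products and supporting families -/

section Cross

variable {X Y M M₁ M₂ M₃ : Type*} [AddCommGroup M] [AddCommGroup M₁] [AddCommGroup M₂]
  [AddCommGroup M₃]

lemma mem_cochains_prod {C : CoarseStructure X} {D : CoarseStructure Y} {m : ℕ}
    {φ : (Fin (m + 1) → X × Y) → M} (h₁ : C.SupportedAlong Prod.fst φ)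
    (h₂ : D.SupportedAlong Prod.snd φ) : φ ∈ (C.prod D).cochains m M := by
  refine mem_cochains_of_supportedAlong fun E hE => ?_
  obtain ⟨S, hS, h₁⟩ := h₁ _ hE.1
  obtain ⟨T, hT, h₂⟩ := h₂ _ hE.2
  refine ⟨S ×ˢ T, ⟨C.subset_mem hS ?_, D.subset_mem hT ?_⟩, fun y hy hne i =>
    ⟨h₁ y (fun i j => ⟨_, hy i j, rfl⟩) hne i, h₂ y (fun i j => ⟨_, hy i j, rfl⟩) hne i⟩⟩
  · rintro _ ⟨p, hp, rfl⟩
    exact ⟨hp.1.1, hp.2.1⟩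
  · rintro _ ⟨p, hp, rfl⟩
    exact ⟨hp.1.2, hp.2.2⟩

lemma VanishesOn.cup_left (μ : M₁ →+ M₂ →+ M₃) {m n l : ℕ} (h : m + n = l)
    {φ : (Fin (m + 1) → X) → M₁} {S : Set X} (hφ : VanishesOn φ S)
    (ψ : (Fin (n + 1) → X) → M₂) : VanishesOn (cup μ h φ ψ) S := fun _ hx => by
  rw [cup, hφ _ fun i => hx _, map_zero, AddMonoidHom.zero_apply]

lemma VanishesOn.cup_right (μ : M₁ →+ M₂ →+ M₃) {m n l : ℕ} (h : m + n = l)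
    (φ : (Fin (m + 1) → X) → M₁) {S : Set X} {ψ : (Fin (n + 1) → X) → M₂}
    (hψ : VanishesOn ψ S) : VanishesOn (cup μ h φ ψ) S := fun _ hx => by
  rw [cup, hψ _ fun i => hx _, map_zero]

lemma VanishesOn.cone {m : ℕ} {φ : (Fin (m + 2) → X) → M} {S : Set X} (hφ : VanishesOn φ S)
    {o : X} (ho : o ∈ S) : VanishesOn (cone o φ) S :=
  fun _ hx => hφ _ fun i => Fin.cases ho (fun j => hx j) i

lemma VanishesOn.coneCup (μ : M₁ →+ M₂ →+ M₃) {o : X} {m n k : ℕ} (h : m + n = k + 1)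
    {φ : (Fin (m + 1) → X) → M₁} {ψ : (Fin (n + 1) → X) → M₂} {S : Set X}
    (H : (o ∈ S ∧ VanishesOn φ S) ∨ VanishesOn ψ S) : VanishesOn (coneCup μ o h φ ψ) S := by
  cases m with
  | zero => exact fun _ _ => rfl
  | succ m =>
    exact H.elim (fun H => (H.2.cone H.1).cup_left μ (by omega) ψ) fun H => H.cup_right μ (by omega) _

lemma VanishesOn.cupCone (μ : M₁ →+ M₂ →+ M₃) {o : X} {m n k : ℕ} (h : m + n = k + 1)
    {φ : (Fin (m + 1) → X) → M₁} {ψ : (Fin (n + 1) → X) → M₂} {S : Set X}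
    (H : VanishesOn φ S ∨ (o ∈ S ∧ VanishesOn ψ S)) : VanishesOn (cupCone μ o h φ ψ) S := by
  cases n with
  | zero => exact fun _ _ => rfl
  | succ n =>
    exact H.elim (fun H => H.cup_left μ (by omega) _)
      fun H => (H.2.cone H.1).cup_right μ (by omega) φ

lemma cross_mem_relCochains (μ : M₁ →+ M₂ →+ M₃) {C : CoarseStructure X} {D : CoarseStructure Y}
    (hC : C.IsCoarselyConnected) (hD : D.IsCoarselyConnected) {A : Set X} {B : Set Y}
    {m n l : ℕ} (h : m + n = l) {φ : (Fin (m + 1) → X) → M₁} {ψ : (Fin (n + 1) → Y) → M₂}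
    (hφ : φ ∈ C.relCochains {A} m M₁) (hψ : ψ ∈ D.relCochains {B} n M₂) :
    cross μ h φ ψ ∈ (C.prod D).relCochains {A ×ˢ Set.univ, Set.univ ×ˢ B} l M₃ := by
  rw [mem_relCochains_singleton] at hφ hψ
  refine mem_relCochains_pair.2 ⟨mem_cochains_prod ?_ ?_, ?_, ?_⟩
  · exact ((supportedAlong_of_mem_cochains hC hφ.1).pullbackFun Prod.fst).cup_left μ h _
  · exact ((supportedAlong_of_mem_cochains hD hψ.1).pullbackFun Prod.snd).cup_right μ h _
  · exact (hφ.2.pullbackFun fun p hp => hp.1).cup_left μ h _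
  · exact (hψ.2.pullbackFun fun p hp => hp.2).cup_right μ h _

lemma coboundary_cross (μ : M₁ →+ M₂ →+ M₃) {m n l : ℕ} (h : m + n = l)
    (h₁ : m + 1 + n = l + 1) (h₂ : m + (n + 1) = l + 1) (φ : (Fin (m + 1) → X) → M₁)
    (ψ : (Fin (n + 1) → Y) → M₂) :
    coboundary _ M₃ l (cross μ h φ ψ) = cross μ h₁ (coboundary X M₁ m φ) ψ +
      (-1 : ℤ) ^ m • cross μ h₂ φ (coboundary Y M₂ n ψ) :=
  coboundary_cup μ h h₁ h₂ _ _

lemma cross_zero_left (μ : M₁ →+ M₂ →+ M₃) {m n l : ℕ} (h : m + n = l)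
    (ψ : (Fin (n + 1) → Y) → M₂) : cross μ h (0 : (Fin (m + 1) → X) → M₁) ψ = 0 := by
  rw [cross, map_zero, cup_zero_left]

lemma cross_zero_right (μ : M₁ →+ M₂ →+ M₃) {m n l : ℕ} (h : m + n = l)
    (φ : (Fin (m + 1) → X) → M₁) : cross μ h φ (0 : (Fin (n + 1) → Y) → M₂) = 0 := by
  rw [cross, map_zero, cup_zero_right]

lemma coboundary_cross_eq_zero (μ : M₁ →+ M₂ →+ M₃) {m n l : ℕ} (h : m + n = l)
    {φ : (Fin (m + 1) → X) → M₁} {ψ : (Fin (n + 1) → Y) → M₂} (hφ : coboundary X M₁ m φ = 0)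
    (hψ : coboundary Y M₂ n ψ = 0) : coboundary _ M₃ l (cross μ h φ ψ) = 0 := by
  rw [coboundary_cross μ h (by omega) (by omega), hφ, hψ, cross_zero_left, cross_zero_right,
    smul_zero, add_zero]

lemma cross_mem_coboundaries_left (μ : M₁ →+ M₂ →+ M₃) {C : CoarseStructure X}
    {D : CoarseStructure Y} (hC : C.IsCoarselyConnected) (hD : D.IsCoarselyConnected) {A : Set X}
    {B : Set Y} {m n l : ℕ} (h : m + n = l) {φ : (Fin (m + 1) → X) → M₁}
    {ψ : (Fin (n + 1) → Y) → M₂} (hφ : φ ∈ C.coboundaries {A} m M₁)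
    (hψ : ψ ∈ D.cocycles {B} n M₂) :
    cross μ h φ ψ ∈ (C.prod D).coboundaries {A ×ˢ Set.univ, Set.univ ×ˢ B} l M₃ := by
  cases m with
  | zero =>
    rw [show φ = 0 from hφ, cross_zero_left]
    exact zero_mem _
  | succ m =>
    obtain ⟨α, hα, rfl⟩ := hφ
    obtain ⟨l, rfl⟩ : ∃ l', l = l' + 1 := ⟨m + n, by omega⟩
    have h' : m + n = l := by omega
    refine ⟨cross μ h' α ψ, cross_mem_relCochains μ hC hD h' hα hψ.1, ?_⟩
    rw [coboundary_cross μ h' h (by omega), show coboundary Y M₂ n ψ = 0 from hψ.2,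
      cross_zero_right, smul_zero, add_zero]

lemma cross_mem_coboundaries_right (μ : M₁ →+ M₂ →+ M₃) {C : CoarseStructure X}
    {D : CoarseStructure Y} (hC : C.IsCoarselyConnected) (hD : D.IsCoarselyConnected) {A : Set X}
    {B : Set Y} {m n l : ℕ} (h : m + n = l) {φ : (Fin (m + 1) → X) → M₁}
    {ψ : (Fin (n + 1) → Y) → M₂} (hφ : φ ∈ C.cocycles {A} m M₁)
    (hψ : ψ ∈ D.coboundaries {B} n M₂) :
    cross μ h φ ψ ∈ (C.prod D).coboundaries {A ×ˢ Set.univ, Set.univ ×ˢ B} l M₃ := by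
  cases n with
  | zero =>
    rw [show ψ = 0 from hψ, cross_zero_right]
    exact zero_mem _
  | succ n =>
    obtain ⟨β, hβ, rfl⟩ := hψ
    obtain ⟨l, rfl⟩ : ∃ l', l = l' + 1 := ⟨m + n, by omega⟩
    have h' : m + n = l := by omega
    refine ⟨(-1 : ℤ) ^ m • cross μ h' φ β,
      zsmul_mem (cross_mem_relCochains μ hC hD h' hφ.1 hβ) _, ?_⟩
    rw [map_zsmul, coboundary_cross μ h' (by omega) h, show coboundary X M₁ m φ = 0 from hφ.2,
      cross_zero_left, zero_add, smul_smul, ← mul_pow]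
    simp

lemma exists_isCrossProduct (μ : M₁ →+ M₂ →+ M₃) {C : CoarseStructure X} {D : CoarseStructure Y}
    (hC : C.IsCoarselyConnected) (hD : D.IsCoarselyConnected) (hC' : C.IsCountablyGenerated)
    (hD' : D.IsCountablyGenerated) {A : Set X} {B : Set Y} (hA : A.Nonempty) (hB : B.Nonempty)
    {m n l : ℕ} (h : m + n = l) (x : C.HX {A} m M₁) (y : D.HX {B} n M₂) :
    ∃ p, IsCrossProduct μ C D A B h x y p := by
  obtain ⟨φ, hφ⟩ := exists_represents x
  obtain ⟨ψ, hψ⟩ := exists_represents y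
  obtain ⟨π, hπ⟩ := exists_isExcisionMap_prod hC' hD' hA hB
  obtain ⟨c, hc⟩ := exists_class (C := C.prod D)
    ⟨cross_mem_relCochains μ hC hD h hφ.mem.1 hψ.mem.1,
      coboundary_cross_eq_zero μ h hφ.mem.2 hψ.mem.2⟩
  obtain ⟨p, hp⟩ := (hπ.sumMap_bijective (hC.prod hD) l M₃).2 c
  refine ⟨p, fun φ' ψ' hφ' hψ' => ?_⟩
  rw [hp]
  have e : cross μ h φ' ψ' - cross μ h φ ψ =
      cross μ h (φ' - φ) ψ' + cross μ h φ (ψ' - ψ) := by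
    ext q
    simp [cross, cup]
  refine hc.of_sub_mem ?_
  rw [e]
  exact add_mem (cross_mem_coboundaries_left μ hC hD h ((hφ.eq_iff hφ').1 rfl) hψ'.mem)
    (cross_mem_coboundaries_right μ hC hD h hφ.mem ((hψ.eq_iff hψ').1 rfl))

end Cross

section Supports

variable {X K L : Type*}

lemma warped_map (C : CoarseStructure X) {U : X → Set (K × K)} {V : X → Set (L × L)} {f : K → L}
    (h : ∀ x, ∀ p ∈ U x, (f p.1, f p.2) ∈ V x) :
    IsControlled (C.warped U) (C.warped V) fun p => (p.1, f p.2) := by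
  intro E hE
  refine hE ((C.warped V).comap fun p => (p.1, f p.2)) ?_
  rintro W (⟨E, hE, rfl⟩ | rfl)
  · refine (C.warped V).subset_mem (mem_generate (Or.inl ⟨E, hE, rfl⟩)) ?_
    rintro _ ⟨p, hp, rfl⟩
    exact ⟨hp.1, congrArg f hp.2⟩
  · refine (C.warped V).subset_mem (mem_generate (Or.inr rfl)) ?_
    rintro _ ⟨p, hp, rfl⟩
    exact ⟨hp.1, h _ _ hp.2⟩

lemma isControlled_prod {Y Z : Type*} {C : CoarseStructure X} {D : CoarseStructure Y}
    {F : CoarseStructure Z} {f : X → Y × Z} (h₁ : IsControlled C D fun x => (f x).1)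
    (h₂ : IsControlled C F fun x => (f x).2) : IsControlled C (D.prod F) f := by
  intro E hE
  refine ⟨D.subset_mem (h₁ E hE) ?_, F.subset_mem (h₂ E hE) ?_⟩ <;>
  · rintro _ ⟨_, ⟨p, hp, rfl⟩, rfl⟩
    exact ⟨p, hp, rfl⟩

lemma IsControlled.comp {Y Z : Type*} {C : CoarseStructure X} {D : CoarseStructure Y}
    {F : CoarseStructure Z} {g : Y → Z} {f : X → Y} (hg : IsControlled D F g)
    (hf : IsControlled C D f) : IsControlled C F (g ∘ f) := by
  intro E hE
  have := hg _ (hf _ hE)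
  rwa [Set.image_image] at this

lemma isControlled_fst {Y : Type*} (C : CoarseStructure X) (D : CoarseStructure Y) :
    IsControlled (C.prod D) C Prod.fst := fun _ hE => hE.1

lemma isControlled_snd {Y : Type*} (C : CoarseStructure X) (D : CoarseStructure Y) :
    IsControlled (C.prod D) D Prod.snd := fun _ hE => hE.2

lemma Interval.neg_eq_zero {t : Interval} (h : 0 ≤ (t : ℝ)) : t.neg = 0 :=
  Subtype.ext (by simp [Interval.neg, h])

lemma Interval.pos_eq_zero {t : Interval} (h : (t : ℝ) ≤ 0) : t.pos = 0 :=
  Subtype.ext (by simp [Interval.pos, h])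

lemma Interval.dist_neg_le (s t : Interval) : dist s.neg t.neg ≤ dist s t := by
  rw [Subtype.dist_eq, Subtype.dist_eq, Real.dist_eq, Real.dist_eq]
  have h : ∀ t : ℝ, -min t 0 = max (-t) 0 := fun t => by
    rcases le_total t 0 with h | h <;> simp [h]
  simp only [Interval.neg, h]
  refine (abs_max_sub_max_le_abs _ _ _).trans_eq ?_
  rw [neg_sub_neg, abs_sub_comm]

lemma Interval.dist_pos_le (s t : Interval) : dist s.pos t.pos ≤ dist s t := by
  rw [Subtype.dist_eq, Subtype.dist_eq, Real.dist_eq, Real.dist_eq]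
  exact abs_max_sub_max_le_abs _ _ _

lemma Interval.dist_le (s t : Interval) : dist s t ≤ dist s.neg t.neg + dist s.pos t.pos := by
  have h : ∀ t : Interval, (t : ℝ) = (t.pos : ℝ) - t.neg := fun t => by
    simp only [Interval.pos, Interval.neg, sub_neg_eq_add]
    exact (max_add_min (t : ℝ) 0).symm ▸ by simp
  rw [Subtype.dist_eq, Subtype.dist_eq s.neg, Subtype.dist_eq s.pos, Real.dist_eq, Real.dist_eq,
    Real.dist_eq, h s, h t]
  refine (le_of_eq ?_).trans (abs_sub _ _) |>.trans (add_comm _ _).le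
  congr 1
  ring

/-- Any two deformations are supported by a family: the one for which both halves of `Γ` factor
through the warped products on which the deformations are controlled. -/
lemma exists_supports {C : CoarseStructure X} (hC : C.IsCoarselyConnected) {A B : Set X}
    {HA HB : X × unitInterval → X} (hHA : C.IsDeformation A HA) (hHB : C.IsDeformation B HB) :
    ∃ U, C.Supports A B HA HB U := by
  obtain ⟨⟨UA, hUA, hcA⟩, hA0, -, -⟩ := hHA
  obtain ⟨⟨UB, hUB, hcB⟩, hB0, -, -⟩ := hHB
  let U : X → Set (Interval × Interval) := fun x =>
    {p | (p.1.neg, p.2.neg) ∈ UA x ∧ (p.1.pos, p.2.pos) ∈ UB x}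
  have hnbhd : IsNbhdFamily U := by
    intro x
    have hA := hUA.1 x
    have hB := hUB.1 x
    rw [nhdsSet_diagonal_eq_uniformity] at hA hB ⊢
    have h1 : UniformContinuous Interval.neg :=
      (LipschitzWith.mk_one Interval.dist_neg_le).uniformContinuous
    have h2 : UniformContinuous Interval.pos :=
      (LipschitzWith.mk_one Interval.dist_pos_le).uniformContinuous
    exact Filter.inter_mem (h1 hA) (h2 hB)
  refine ⟨U, ⟨hnbhd, fun ε hε => ?_⟩, ⟨?_, fun S hS => ?_⟩⟩
  · obtain ⟨E, hE, h1⟩ := hUA.2 (ε / 2) (by positivity)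
    obtain ⟨F, hF, h2⟩ := hUB.2 (ε / 2) (by positivity)
    refine ⟨_, C.union_mem hE hF, fun x hx p hp => (Interval.dist_le _ _).trans ?_⟩
    have h1 := h1 x (fun ⟨a, ha, h⟩ => hx ⟨a, Or.inl ha, Or.inl h⟩) _ hp.1
    have h2 := h2 x (fun ⟨a, ha, h⟩ => hx ⟨a, Or.inr ha, Or.inr h⟩) _ hp.2
    simp only at h1 h2
    linarith
  · exact isControlled_prod (hcA.comp (C.warped_map fun x p hp => hp.1))
      (hcB.comp (C.warped_map fun x p hp => hp.2))
  · have h1 := hS.image (isControlled_fst C C)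
    have h2 := hS.image (isControlled_snd C C)
    refine (C.isBounded_cylinder hnbhd (hC.isBounded_union h1 h2)).mono ?_
    rintro ⟨x, t⟩ hxt
    rcases le_total 0 (t : ℝ) with h | h
    · refine Or.inl ⟨_, hxt, ?_⟩
      simp only [Gamma, Interval.neg_eq_zero h]
      exact hA0 x
    · refine Or.inr ⟨_, hxt, ?_⟩
      simp only [Gamma, Interval.pos_eq_zero h]
      exact hB0 x

end Supports

/-! ### Comparison of the two products -/

section Comparison

variable {X M₁ M₂ M₃ : Type*} [AddCommGroup M₁] [AddCommGroup M₂] [AddCommGroup M₃]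

lemma cone_pullbackFun {Y M : Type*} [AddCommGroup M] {m : ℕ} (f : X → Y) (o : X)
    (φ : (Fin (m + 2) → Y) → M) :
    cone o (pullbackFun M f (m + 1) φ) = pullbackFun M f m (cone (f o) φ) := by
  ext x
  refine congrArg φ (funext fun i => ?_)
  exact Fin.cases rfl (fun _ => rfl) i

/-- On the diagonal, the difference of the two natural primitives of `φ × ψ` is, up to sign,
the secondary product `φ * ψ`. -/
lemma primitives_diag (μ : M₁ →+ M₂ →+ M₃) (a b : X) {m n k : ℕ} (h : m + n = k + 1)
    (φ : (Fin (m + 1) → X) → M₁) (ψ : (Fin (n + 1) → X) → M₂) (x : Fin (k + 1) → X) :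
    (coneCup μ (a, b) h (pullbackFun M₁ Prod.fst m φ) (pullbackFun M₂ Prod.snd n ψ) -
      (-1 : ℤ) ^ m • cupCone μ (a, b) h (pullbackFun M₁ Prod.fst m φ)
        (pullbackFun M₂ Prod.snd n ψ)) (fun i => (x i, x i)) =
      -((-1 : ℤ) ^ m • roeFun μ a b h φ ψ) x := by
  have h1 : coneCup μ (a, b) h (pullbackFun M₁ Prod.fst m φ) (pullbackFun M₂ Prod.snd n ψ)
      (fun i => (x i, x i)) = coneCup μ a h φ ψ x := by
    cases m with
    | zero => rfl
    | succ m => simp only [coneCup, cone_pullbackFun]; rfl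
  have h2 : cupCone μ (a, b) h (pullbackFun M₁ Prod.fst m φ) (pullbackFun M₂ Prod.snd n ψ)
      (fun i => (x i, x i)) = cupCone μ b h φ ψ x := by
    cases n with
    | zero => rfl
    | succ n => simp only [cupCone, cone_pullbackFun]; rfl
  simp only [roeFun, Pi.sub_apply, Pi.smul_apply, Pi.add_apply, h1, h2, smul_add, smul_smul]
  have h3 : (-1 : ℤ) ^ m * (-1) ^ (m + 1) = -1 := by
    rw [← pow_add]
    exact Odd.neg_one_pow ⟨m, by ring⟩
  rw [h3, neg_smul, one_smul]
  abel

/-- The comparison. The pullback `Γ^*(φ × ψ)` has two primitives, of which the first one is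
coarse over the lower half of the cylinder, where `Γ` is the identity in the second factor, and
the second one is coarse over the upper half. Gluing them at `t = 0` gives a coarse cochain
`θ` whose coboundary differs from `Γ^*(φ × ψ)` by a term concentrated at `t = 0`, and sliding the
bottom of the cylinder to its top detects that term: it is the secondary product `φ * ψ`. -/
theorem represents_sumMap_bottomMap (μ : M₁ →+ M₂ →+ M₃) {C : CoarseStructure X}
    (hC : C.IsCoarselyConnected) {A B : Set X} {a b : X} (ha : a ∈ A) (hb : b ∈ B)
    {HA HB : X × unitInterval → X} (hHA : C.IsDeformation A HA) (hHB : C.IsDeformation B HB)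
    {U : X → Set (Interval × Interval)} (hU : C.Supports A B HA HB U) {m n k : ℕ}
    (h : m + n = k + 1) {φ : (Fin (m + 1) → X) → M₁} {ψ : (Fin (n + 1) → X) → M₂}
    (hφ : φ ∈ C.cocycles {A} m M₁) (hψ : ψ ∈ C.cocycles {B} n M₂)
    {p : (C.prod C).HX {A ×ˢ Set.univ ∪ Set.univ ×ˢ B} (k + 1) M₃}
    (hp : Represents (cross μ h φ ψ)
      ((C.prod C).sumMap (A ×ˢ Set.univ) (Set.univ ×ˢ B) (k + 1) M₃ p))
    {ν : X → ℕ} (hν : ∀ x, dyadicFamily ν x ⊆ U x)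
    {c : ((C.warped (dyadicFamily ν)).subspace (suspBase (A ∪ B))).HX
      {within (suspBase (A ∪ B)) (suspTop (A ∪ B))} k M₃}
    (hc : C.suspConnecting (A ∪ B) (dyadicFamily ν) k M₃ c =
      C.refineMap (A ∪ B) (isNbhdFamily_dyadicFamily ν) hν (k + 1) M₃
        (gammaMap hHA hHB hU (k + 1) M₃ p)) :
    Represents ((-1 : ℤ) ^ m • roeFun μ a b h φ ψ)
      (C.sumMap A B k M₃ (C.bottomMap (A ∪ B) (dyadicFamily ν) k M₃ c)) := by
  have hV := isNbhdFamily_dyadicFamily ν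
  let P := C.warped (dyadicFamily ν)
  set Γ := Gamma HA HB with hΓ
  have hG : IsCoarse P (C.prod C) Γ := hU.2.comp (C.isCoarse_refine hV hν)
  have hφ' := mem_relCochains_singleton.1 hφ.1
  have hψ' := mem_relCochains_singleton.1 hψ.1
  have hδφ : coboundary X M₁ m φ = 0 := hφ.2
  have hδψ : coboundary X M₂ n ψ = 0 := hψ.2
  -- The two primitives of `φ × ψ`.
  set Q := cross μ h φ ψ with hQ
  set S := coneCup μ (a, b) h (pullbackFun M₁ Prod.fst m φ) (pullbackFun M₂ Prod.snd n ψ) with hS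
  set T := (-1 : ℤ) ^ m • cupCone μ (a, b) h (pullbackFun M₁ Prod.fst m φ)
    (pullbackFun M₂ Prod.snd n ψ) with hT
  have hδ1 : coboundary (X × X) M₁ m (pullbackFun M₁ Prod.fst m φ) = 0 := by
    rw [coboundary_pullbackFun, hδφ, map_zero]
  have hδ2 : coboundary (X × X) M₂ n (pullbackFun M₂ Prod.snd n ψ) = 0 := by
    rw [coboundary_pullbackFun, hδψ, map_zero]
  have hδS : coboundary _ M₃ k S = Q :=
    coboundary_coneCup μ (a, b) h hδ1 hδ2 (hφ'.2 _ fun _ => ha)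
  have hδT : coboundary _ M₃ k T = Q := by
    rw [hT, map_zsmul, coboundary_cupCone μ (a, b) h hδ1 hδ2 (hψ'.2 _ fun _ => hb), smul_smul,
      ← mul_pow]
    simp [hQ, cross]
  have hδR : coboundary _ M₃ k (S - T) = 0 := by rw [map_sub, hδS, hδT, sub_self]
  have hvan1 : VanishesOn (pullbackFun M₁ (Prod.fst : X × X → X) m φ) (A ×ˢ Set.univ) :=
    hφ'.2.pullbackFun fun q hq => hq.1
  have hvan2 : VanishesOn (pullbackFun M₂ (Prod.snd : X × X → X) n ψ) (Set.univ ×ˢ B) :=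
    hψ'.2.pullbackFun fun q hq => hq.2
  have hSA : VanishesOn S (A ×ˢ Set.univ) := .coneCup μ h (Or.inl ⟨⟨ha, trivial⟩, hvan1⟩)
  have hSB : VanishesOn S (Set.univ ×ˢ B) := .coneCup μ h (Or.inr hvan2)
  have hTA : VanishesOn T (A ×ˢ Set.univ) := fun q hq => by
    rw [hT, Pi.smul_apply, VanishesOn.cupCone μ h (Or.inl hvan1) q hq, smul_zero]
  have hTB : VanishesOn T (Set.univ ×ˢ B) := by
    have hab : (a, b) ∈ (Set.univ ×ˢ B : Set (X × X)) := ⟨trivial, hb⟩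
    intro q hq
    rw [hT, Pi.smul_apply, VanishesOn.cupCone μ h (Or.inr ⟨hab, hvan2⟩) q hq, smul_zero]
  have hSsupp : C.SupportedAlong Prod.snd S :=
    ((supportedAlong_of_mem_cochains hC hψ'.1).pullbackFun Prod.snd).coneCup μ _ h _
  have hTsupp : C.SupportedAlong Prod.fst T :=
    (((supportedAlong_of_mem_cochains hC hφ'.1).pullbackFun Prod.fst).cupCone μ (a, b) h
      (pullbackFun M₂ Prod.snd n ψ)).of_subtuple id fun q hq h0 => hq (by
        rw [hT, Pi.smul_apply]
        exact (congrArg _ h0).trans (smul_zero _))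
  -- Gluing the primitives at `t = 0`.
  set R := pullbackFun M₃ Γ k (S - T) with hR
  have hδR' : coboundary _ M₃ k R = 0 := by rw [hR, coboundary_pullbackFun, hδR, map_zero]
  let J : (Fin (k + 1) → X × Interval) → M₃ := fun y => negIndicator (y 0) • R y
  let θ := J + pullbackFun M₃ Γ k T
  have hJ1 : ∀ y : Fin (k + 1) → X × Interval, ((y 0).2 : ℝ) < 0 →
      θ y = pullbackFun M₃ Γ k S y := by
    intro y hy
    change negIndicator (y 0) • (pullbackFun M₃ Γ k S y - pullbackFun M₃ Γ k T y) + _ = _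
    rw [negIndicator, if_pos hy, one_smul, sub_add_cancel]
  have hJ2 : ∀ y : Fin (k + 1) → X × Interval, ¬ ((y 0).2 : ℝ) < 0 →
      θ y = pullbackFun M₃ Γ k T y := by
    intro y hy
    change negIndicator (y 0) • R y + _ = _
    rw [negIndicator, if_neg hy, zero_smul, zero_add]
  have hθ : θ ∈ P.cochains k M₃ := by
    refine mem_cochains_warped hV fun E hE => ?_
    have hE' := hG.controlled E hE
    obtain ⟨B₁, hB₁, h1⟩ := hSsupp _ (isControlled_snd C C _ hE')
    obtain ⟨B₂, hB₂, h2⟩ := hTsupp _ (isControlled_fst C C _ hE')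
    refine ⟨_, hC.isBounded_union hB₁ hB₂, fun y hy hne => ⟨0, ?_⟩⟩
    by_cases ht : ((y 0).2 : ℝ) < 0
    · rw [hJ1 y ht] at hne
      have := h1 (fun i => Γ (y i)) (fun i j => ⟨_, ⟨_, hy i j, rfl⟩, rfl⟩) hne 0
      simp only [hΓ, Gamma, Interval.pos_eq_zero ht.le, hHB.2.1] at this
      exact Or.inl this
    · rw [hJ2 y ht] at hne
      have := h2 (fun i => Γ (y i)) (fun i j => ⟨_, ⟨_, hy i j, rfl⟩, rfl⟩) hne 0
      simp only [hΓ, Gamma, Interval.neg_eq_zero (not_lt.1 ht), hHA.2.1] at this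
      exact Or.inr this
  have hδθ : coboundary _ M₃ k θ = coboundary _ M₃ k J + pullbackFun M₃ Γ (k + 1) Q := by
    rw [map_add, coboundary_pullbackFun, hδT]
  have hθvan : ∀ {L : Set (X × Interval)} {L' : Set (X × X)}, VanishesOn S L' →
      VanishesOn T L' → Set.MapsTo Γ L L' → VanishesOn θ L := by
    intro L L' h1 h2 hL y hy
    change negIndicator (y 0) • (pullbackFun M₃ Γ k S y - pullbackFun M₃ Γ k T y) +
      pullbackFun M₃ Γ k T y = 0
    rw [h1.pullbackFun hL y hy, h2.pullbackFun hL y hy, sub_zero, smul_zero, add_zero]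
  -- Comparison of the representatives of the two sides of `hc`.
  obtain ⟨χ, hχ⟩ := exists_represents p
  obtain ⟨γ, hγ⟩ := exists_represents c
  obtain ⟨l₀, hl₀, hδl₀⟩ := (hχ.sumMap.eq_iff hp).1 rfl
  have hw : Represents (pullbackFun M₃ Γ (k + 1) χ)
      (C.refineMap (A ∪ B) hV hν (k + 1) M₃ (gammaMap hHA hHB hU (k + 1) M₃ p)) :=
    show Represents (pullbackFun M₃ id (k + 1) (pullbackFun M₃ Γ (k + 1) χ)) _ from
      Represents.map (Represents.map hχ)
  obtain ⟨l₁, hl₁, hδl₁⟩ :=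
    ((represents_connecting (suspTop_subset (A ∪ B)) hγ).eq_iff hw).1 hc
  have hη := mem_relCochains_singleton.1 (extendZero_mem_relCochains hγ.mem.1)
  set η := extendZero (suspBase (A ∪ B)) k M₃ γ with hηdef
  have hl₀' := mem_relCochains_pair.1 hl₀
  have hl₁' := mem_relCochains_singleton.1 hl₁
  have hl₀P : pullbackFun M₃ Γ k l₀ ∈ P.relCochains {Γ ⁻¹' (A ×ˢ Set.univ)} k M₃ :=
    pullbackFun_mem_relCochains hG (by rintro _ rfl; exact ⟨_, Or.inl rfl, fun q hq => hq⟩) hl₀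
  let ξ := η + l₁ + pullbackFun M₃ Γ k l₀ - θ
  have hξ : ξ ∈ P.cochains k M₃ := sub_mem (add_mem (add_mem hη.1 hl₁'.1) hl₀P.1) hθ
  have hδξ : coboundary _ M₃ k ξ = - coboundary _ M₃ k J := by
    have e1 : pullbackFun M₃ Γ (k + 1) Q - pullbackFun M₃ Γ (k + 1) χ =
      pullbackFun M₃ Γ (k + 1) (coboundary _ M₃ k l₀) := by rw [hδl₀, map_sub]
    rw [map_sub, map_add, map_add, hδθ, coboundary_pullbackFun, ← e1, hδl₁]
    abel
  -- Vanishing of `ξ` on the top and over `A` and `B`, and of its correction terms on the bottom.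
  have hΓbot : Set.MapsTo Γ {q : X × Interval | q.2 = Interval.bot} (A ×ˢ Set.univ) := by
    rintro ⟨x, t⟩ (rfl : t = Interval.bot)
    have : Interval.neg Interval.bot = 1 := Subtype.ext (by simp [Interval.neg, Interval.bot])
    refine ⟨?_, trivial⟩
    simp only [hΓ, Gamma, this]
    exact hHA.2.2.1 x
  have hΓtop : Set.MapsTo Γ {q : X × Interval | q.2 = Interval.top} (Set.univ ×ˢ B) := by
    rintro ⟨x, t⟩ (rfl : t = Interval.top)
    have : Interval.pos Interval.top = 1 := Subtype.ext (by simp [Interval.pos, Interval.top])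
    refine ⟨trivial, ?_⟩
    simp only [hΓ, Gamma, this]
    exact hHB.2.2.1 x
  have hΓA : Set.MapsTo Γ (Prod.fst ⁻¹' A) (A ×ˢ Set.univ) :=
    fun q hq => ⟨hHA.2.2.2 _ hq _, trivial⟩
  have hΓB : Set.MapsTo Γ (Prod.fst ⁻¹' B) (Set.univ ×ˢ B) :=
    fun q hq => ⟨trivial, hHB.2.2.2 _ hq _⟩
  have hξA : VanishesOn ξ (Prod.fst ⁻¹' A) :=
    (((hη.2.mono fun q hq => Or.inr (Or.inl hq)).add
      (hl₁'.2.mono fun q hq => Or.inr (Or.inr (Or.inl hq)))).add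
        (hl₀'.2.1.pullbackFun hΓA)).sub (hθvan hSA hTA hΓA)
  have hξB : VanishesOn ξ (Prod.fst ⁻¹' B) :=
    (((hη.2.mono fun q hq => Or.inr (Or.inr hq)).add
      (hl₁'.2.mono fun q hq => Or.inr (Or.inr (Or.inr hq)))).add
        (hl₀'.2.2.pullbackFun hΓB)).sub (hθvan hSB hTB hΓB)
  have hξtop : pullbackFun M₃ toTop k ξ = 0 := by
    have : VanishesOn ξ {q : X × Interval | q.2 = Interval.top} :=
      (((hη.2.mono fun q hq => Or.inl hq).add
        (hl₁'.2.mono fun q hq => Or.inr (Or.inl hq))).add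
          (hl₀'.2.2.pullbackFun hΓtop)).sub (hθvan hSB hTB hΓtop)
    exact funext fun y => this _ fun i => rfl
  have hξbot : ∀ x : Fin (k + 1) → X, ξ (fun i => (x i, Interval.bot)) =
      pullbackFun M₃ (bottomIncl (A ∪ B)) k γ x := by
    intro x
    have e1 : η (fun i => (x i, Interval.bot)) = pullbackFun M₃ (bottomIncl (A ∪ B)) k γ x :=
      extendZero_apply γ fun i => bottomIncl (A ∪ B) (x i)
    have e2 : l₁ (fun i => (x i, Interval.bot)) = 0 := hl₁'.2 _ fun i => Or.inl rfl
    have e3 : pullbackFun M₃ Γ k l₀ (fun i => (x i, Interval.bot)) = 0 :=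
      hl₀'.2.1.pullbackFun hΓbot _ fun i => rfl
    have e4 : θ (fun i => (x i, Interval.bot)) = 0 := hθvan hSA hTA hΓbot _ fun i => rfl
    change η _ + l₁ _ + pullbackFun M₃ Γ k l₀ _ - θ _ = _
    rw [e1, e2, e3, e4, add_zero, add_zero, sub_zero]
  -- Sliding the bottom to the top.
  have hjump : ∀ x : Fin (k + 1) → X, slideHomotopy M₃ ν k (coboundary _ M₃ k ξ)
      (fun i => (x i, Interval.bot)) = -((-1 : ℤ) ^ m • roeFun μ a b h φ ψ) x := by
    intro x
    rw [hδξ, map_neg, Pi.neg_apply, slideHomotopy_jump ν hδR' x, neg_neg, ← primitives_diag]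
    refine congrArg (S - T) (funext fun i => ?_)
    simp only [hΓ, Gamma]
    rw [Interval.neg_eq_zero le_rfl, Interval.pos_eq_zero le_rfl, hHA.2.1, hHB.2.1]
  have hbot : IsCoarse C P fun x => (x, Interval.bot) :=
    (isCoarse_subtype_val P _).comp (C.isCoarse_bottomIncl (A ∪ B) (dyadicFamily ν))
  have hfib : ∀ D : Set X, ∀ s, Set.MapsTo (slide ν s) (Prod.fst ⁻¹' D) (Prod.fst ⁻¹' D) :=
    fun D s q hq => hq
  refine Represents.of_sub_mem (hγ.map (hf := C.isCoarse_bottomIncl _ _)).sumMap ?_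
  have key : ∀ x, ((-1 : ℤ) ^ m • roeFun μ a b h φ ψ -
      pullbackFun M₃ (bottomIncl (A ∪ B)) k γ) x =
      (- (slideHomotopy M₃ ν k (coboundary _ M₃ k ξ) + ξ)) fun i => (x i, Interval.bot) := by
    intro x
    rw [Pi.neg_apply, Pi.add_apply, hjump, hξbot, Pi.sub_apply]
    abel
  cases k with
  | zero =>
    have e := slideHomotopy_coboundary_zero ν ξ
    rw [hξtop, zero_sub] at e
    change _ = _
    ext x
    rw [key, e, neg_add_cancel, neg_zero]
    rfl
  | succ k =>
    have e := coboundary_slideHomotopy ν k ξ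
    rw [hξtop, zero_sub, ← eq_sub_iff_add_eq] at e
    have hmem : coboundary _ M₃ k (slideHomotopy M₃ ν k ξ) ∈
        P.coboundaries {Prod.fst ⁻¹' A, Prod.fst ⁻¹' B} (k + 1) M₃ :=
      ⟨_, mem_relCochains_pair.2 ⟨slideHomotopy_mem_cochains hC hξ, hξA.slideHomotopy (hfib A),
        hξB.slideHomotopy (hfib B)⟩, rfl⟩
    have := pullbackFun_mem_coboundaries hbot (𝒜 := {A, B}) (by
      rintro _ (rfl | rfl)
      · exact ⟨_, Or.inl rfl, fun x hx => hx⟩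
      · exact ⟨_, Or.inr rfl, fun x hx => hx⟩) hmem
    convert this using 1
    ext x
    rw [key, e]
    change _ = coboundary _ M₃ k (slideHomotopy M₃ ν k ξ) _
    simp

/-- A class relative to `A ∪ B` is determined by its image relative to `A + B`. -/
lemma sumMap_injective {C : CoarseStructure X} (hconn : C.IsCoarselyConnected)
    (hcount : C.IsCountablyGenerated) {A B : Set X} (hexc : C.IsExcisive A B)
    (hA : A.Nonempty) (hB : B.Nonempty) (k : ℕ) (M : Type*) [AddCommGroup M] :
    Function.Injective (C.sumMap A B k M) := by
  obtain ⟨π, hπ⟩ := exists_isExcisionMap hconn hcount hexc hA hB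
  exact (hπ.sumMap_bijective hconn k M).1

/-- Secondary cup products are Roe products, whatever the choices made in forming either. -/
theorem IsSecondaryCupProduct.isRoeProduct {μ : M₁ →+ M₂ →+ M₃} {C : CoarseStructure X}
    (hC : C.IsCoarselyConnected) {A B : Set X} {HA HB : X × unitInterval → X}
    {hHA : C.IsDeformation A HA} {hHB : C.IsDeformation B HB} {U : X → Set (Interval × Interval)}
    {hU : C.Supports A B HA HB U} {m n k : ℕ} {h : m + n = k + 1} {x : C.HX {A} m M₁}
    {y : C.HX {B} n M₂} {z : C.HX {A ∪ B} k M₃}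
    (hz : IsSecondaryCupProduct μ hHA hHB hU h x y z) {a b : X} (ha : a ∈ A) (hb : b ∈ B) :
    IsRoeProduct μ C A B a b h x y z := by
  obtain ⟨p, s, hp, hs, rfl⟩ := hz
  intro φ ψ hφ hψ
  obtain ⟨V, hV, hV'⟩ := hs.exists_refine
  -- A common dyadic refinement of `U` and of the family with which the suspension was formed.
  have hVU : IsNbhdFamily fun x => V x ∩ U x := fun x => Filter.inter_mem (hV x) (hU.1.1 x)
  obtain ⟨ν, hν⟩ := hVU.exists_dyadicFamily
  obtain ⟨c, rfl, hc⟩ := hV' _ (isNbhdFamily_dyadicFamily ν) (fun x q hq => (hν x hq).2)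
    fun x q hq => (hν x hq).1
  have := (represents_sumMap_bottomMap μ hC ha hb hHA hHB hU h hφ.mem hψ.mem (hp φ ψ hφ hψ) _
    hc).zsmul ((-1 : ℤ) ^ m)
  rw [map_zsmul]
  rwa [smul_smul, ← mul_pow, neg_one_mul, neg_neg, one_pow, one_smul] at this

theorem exists_isSecondaryCupProduct (μ : M₁ →+ M₂ →+ M₃) {C : CoarseStructure X}
    (hC : C.IsCoarselyConnected) (hcount : C.IsCountablyGenerated) {A B : Set X}
    (hA : A.Nonempty) (hB : B.Nonempty) {HA HB : X × unitInterval → X}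
    (hHA : C.IsDeformation A HA) (hHB : C.IsDeformation B HB)
    {U : X → Set (Interval × Interval)} (hU : C.Supports A B HA HB U) {m n k : ℕ}
    (h : m + n = k + 1) (x : C.HX {A} m M₁) (y : C.HX {B} n M₂) :
    ∃ z, IsSecondaryCupProduct μ hHA hHB hU h x y z := by
  obtain ⟨p, hp⟩ := exists_isCrossProduct μ hC hC hcount hcount hA hB h x y
  obtain ⟨s, hs⟩ := exists_suspension hC hcount (hA.mono Set.subset_union_left) hU.1
    (gammaMap hHA hHB hU (k + 1) M₃ p)
  exact ⟨_, p, s, hp, hs, rfl⟩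

/-- There is at most one Roe product. -/
lemma IsRoeProduct.unique {μ : M₁ →+ M₂ →+ M₃} {C : CoarseStructure X} {A B : Set X}
    {m n k : ℕ} (hinj : Function.Injective (C.sumMap A B k M₃)) {a b : X}
    {h : m + n = k + 1} {x : C.HX {A} m M₁} {y : C.HX {B} n M₂} {z z' : C.HX {A ∪ B} k M₃}
    (hz : IsRoeProduct μ C A B a b h x y z) (hz' : IsRoeProduct μ C A B a b h x y z') :
    z = z' := by
  obtain ⟨φ, hφ⟩ := exists_represents x
  obtain ⟨ψ, hψ⟩ := exists_represents y
  exact hinj ((hz φ ψ hφ hψ).unique (hz' φ ψ hφ hψ))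

end Comparison

end CoarseStructure

theorem mainTheorem1 {X M₁ M₂ M₃ : Type*} [Nonempty X]
    [AddCommGroup M₁] [AddCommGroup M₂] [AddCommGroup M₃] (μ : M₁ →+ M₂ →+ M₃)
    (C : CoarseStructure X) (hconn : C.IsCoarselyConnected) (hcount : C.IsCountablyGenerated)
    (A B : Set X) (hexc : C.IsExcisive A B)
    (hA : C.IsWeakDeformationRetract A) (hB : C.IsWeakDeformationRetract B)
    {m n k : ℕ} (hk : m + n = k + 1) (x : C.HX {A} m M₁) (y : C.HX {B} n M₂) :
    ∃ z : C.HX {A ∪ B} k M₃,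
      (∀ a ∈ A, ∀ b ∈ B, ∀ w, CoarseStructure.IsRoeProduct μ C A B a b hk x y w ↔ w = z) ∧
      (∀ HA HB : X × unitInterval → X,
        ∀ (hHA : C.IsDeformation A HA) (hHB : C.IsDeformation B HB),
          (∃ U, C.Supports A B HA HB U) ∧
          ∀ U, ∀ hU : C.Supports A B HA HB U, ∀ w,
            CoarseStructure.IsSecondaryCupProduct μ hHA hHB hU hk x y w ↔ w = z) := by
  obtain ⟨o⟩ := ‹Nonempty X›
  obtain ⟨HA₀, hHA₀⟩ := hA
  obtain ⟨HB₀, hHB₀⟩ := hB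
  have ha₀ : HA₀ (o, 1) ∈ A := hHA₀.2.2.1 o
  have hb₀ : HB₀ (o, 1) ∈ B := hHB₀.2.2.1 o
  have hinj := CoarseStructure.sumMap_injective hconn hcount hexc ⟨_, ha₀⟩ ⟨_, hb₀⟩ k M₃
  obtain ⟨U₀, hU₀⟩ := CoarseStructure.exists_supports hconn hHA₀ hHB₀
  obtain ⟨z, hz⟩ := CoarseStructure.exists_isSecondaryCupProduct μ hconn hcount ⟨_, ha₀⟩
    ⟨_, hb₀⟩ hHA₀ hHB₀ hU₀ hk x y
  refine ⟨z, fun a ha b hb w => ⟨fun hw => hw.unique hinj (hz.isRoeProduct hconn ha hb), ?_⟩,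
    fun HA HB hHA hHB => ⟨CoarseStructure.exists_supports hconn hHA hHB, fun U hU w => ?_⟩⟩
  · rintro rfl
    exact hz.isRoeProduct hconn ha hb
  · have heq : ∀ w, CoarseStructure.IsSecondaryCupProduct μ hHA hHB hU hk x y w → w = z :=
      fun w hw => (hw.isRoeProduct hconn ha₀ hb₀).unique hinj (hz.isRoeProduct hconn ha₀ hb₀)
    obtain ⟨w', hw'⟩ := CoarseStructure.exists_isSecondaryCupProduct μ hconn hcount ⟨_, ha₀⟩
      ⟨_, hb₀⟩ hHA hHB hU hk x y
    refine ⟨heq w, ?_⟩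
    rintro rfl
    rwa [← heq w' hw']
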